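/- Let $\overline M$ be a smooth seven-manifold with a $G_2$-structure, i.e. a Riemannian metric $\langle\cdot,\cdot\rangle$ and a smooth three-form $\varphi$ which at each point equals $\sum_{i\in\mathbb Z_7}e_i\wedge e_{i+1}\wedge e_{i+3}$ for some orthonormal basis (a Cayley frame); in such a frame put $*\varphi=-\sum_{i}e_{i+2}\wedge e_{i+4}\wedge e_{i+5}\wedge e_{i+6}$. Let $P$ be the cross product $\langle P(x,y),z\rangle=\varphi(x,y,z)$, $\overline\nabla$ the Levi-Civita connection, and $\overline r(\varphi)(x,y)=\tfrac14\langle\overline\nabla_x\varphi,\;y\lrcorner *\varphi\rangle$ (with the norm of $p$-forms in which $e_{i_1}\wedge\dots\wedge e_{i_p}$, $i_1<\dots<i_p$, are orthonormal). Assume that the structure is of type $\mathcal X_2$ (almost parallel): $d\varphi=0$. Let $\iota:M\to\overline M$ be an (immersed) orientable hypersurface with smooth unit normal field $n$, and $\theta$ a smooth function on $M$. With the induced metric, $M$ carries the $SU(3)$-structure $$Ix=P(n,x),\qquad \omega(x,y)=\langle x,Iy\rangle,$$ $$\psi_+=\cos\theta\,\iota^*\varphi-\sin\theta\,\iota^*(n\lrcorner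 *\varphi),\qquad \psi_-=\sin\theta\,\iota^*\varphi+\cos\theta\,\iota^*(n\lrcorner *\varphi).$$ Let $\nabla$ be the Levi-Civita connection of $M$, $B(x,y)=\langle II(x,y),n\rangle$, $h=\tfrac16\operatorname{Tr}B$ ($M$ is minimal if $h=0$ everywhere), $d^*\omega=-\sum_i(\nabla_{e_i}\omega)(e_i,\cdot)$, and write, for a one-form $\mu$ and a bilinear form $b$, $I\mu=-\mu(I\cdot)$, $I_{(1)}b=-b(I\cdot,\cdot)$, $I_{(2)}b=-b(\cdot,I\cdot)$, $Ib=b(I\cdot,I\cdot)$. Let $\eta$ be the one-form such that $-3\,I\eta\otimes\psi_-$ is the component of $\nabla\psi_+$ in $T^*M\otimes\psi_-$ (the $\mathcal W_5$-part of the intrinsic torsion). Let $\mathcal W_1,\dots,\mathcal W_4$ be the Gray-Hervella modules, whose sum contains $\nabla\omega$, and, for $i=1,2$, let $\mathcal W_i^{+}$ (resp. $\mathcal W_i^-$) be the set of $a\in\mathcal W_i$ for which $r(a)(x,y)=\tfrac12\langle x\lrcorner a,y\lrcorner\psi_+\rangle$ is symmetric (resp. skew-symmetric). $M$ is *of type*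 a given sum of some of $\mathcal W_1^\pm,\mathcal W_2^\pm,\mathcal W_3,\mathcal W_4,\mathcal W_5$ if at every point $\nabla\omega$ lies in the sum of the listed modules other than $\mathcal W_5$ and, in case $\mathcal W_5$ is not listed, $\eta=0$. Then $$d^*\omega=6\,I\eta-2\,d\theta=-2\,\overline r(\varphi)(\iota_*\cdot,n),$$ and $M$ is of the type on the left if and only if the condition on the right holds on $M$: 1. $\mathcal W_1^++\mathcal W_1^-+\mathcal W_2^++\mathcal W_2^-+\mathcal W_3+\mathcal W_4$: $\;d\theta=\overline r(\varphi)(\iota_*\cdot,n)$; 2. $\mathcal W_1^++\mathcal W_1^-+\mathcal W_2^++\mathcal W_2^-+\mathcal W_3+\mathcal W_5$: $\;\overline r(\varphi)(\iota_*\cdot,n)=0$; 3. $\mathcal W_1^++\mathcal W_1^-+\mathcal W_2^++\mathcal W_2^-+\mathcal W_4+\mathcal W_5$: $\;IB=B$; 4. $\mathcal W_1^++\mathcal W_1^-+\mathcal W_2^++\mathcal W_3+\mathcal W_4+\mathcal W_5$: $\;\sin\theta\,\big((I_{(1)}-I_{(2)})\iota^*\overline r(\varphi)+(1+I)B\big)=2h\sin\theta\,\langle\cdot,\cdot\rangle$;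 5. $\mathcal W_1^++\mathcal W_1^-+\mathcal W_2^-+\mathcal W_3+\mathcal W_4+\mathcal W_5$: $\;\cos\theta\,\big((I_{(1)}-I_{(2)})\iota^*\overline r(\varphi)+(1+I)B\big)=2h\cos\theta\,\langle\cdot,\cdot\rangle$; 6. $\mathcal W_1^++\mathcal W_2^++\mathcal W_2^-+\mathcal W_3+\mathcal W_4+\mathcal W_5$: $\;h\sin\theta=0$; 7. $\mathcal W_1^-+\mathcal W_2^++\mathcal W_2^-+\mathcal W_3+\mathcal W_4+\mathcal W_5$: $\;h\cos\theta=0$; 8. $\mathcal W_1^++\mathcal W_1^-+\mathcal W_2^++\mathcal W_2^-+\mathcal W_3$: $\;\overline r(\varphi)(\iota_*\cdot,n)=0$ and $\theta$ is locally constant (constant, if $M$ is connected); 9. $\mathcal W_1^++\mathcal W_1^-+\mathcal W_3+\mathcal W_4+\mathcal W_5$: $\;(I_{(1)}-I_{(2)})\iota^*\overline r(\varphi)+(1+I)B=2h\,\langle\cdot,\cdot\rangle$; 10. $\mathcal W_2^++\mathcal W_2^-+\mathcal W_3+\mathcal W_4+\mathcal W_5$: $\;M$ is minimal. -/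

import Mathlib

open scoped Manifold ContDiff Bundle

noncomputable section

namespace G2SU3

/-! ### Riemannian geometry of a manifold modelled on `ℝ^m` -/

section Connection

variable {m : ℕ} {N : Type*} [TopologicalSpace N] [ChartedSpace (EuclideanSpace ℝ (Fin m)) N]
  [IsManifold (𝓡 m) ∞ N]

/-- The local vector field around `p` that takes the value `v` at `p` and has constant components
with respect to the chart at `p` (a constant-coefficient combination of coordinate fields; two such
fields commute). -/
def coordField {p : N} (v : TangentSpace (𝓡 m) p) (q : N) : TangentSpace (𝓡 m) q :=
  FiberBundle.extend (EuclideanSpace ℝ (Fin m)) v q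

/-- The Levi-Civita derivative `(∇_x Y)_p` of the coordinate field `Y` extending `y`, for the metric
`G`. It is the vector `w` given by the Koszul formula
`2 ⟨∇_x Y, z⟩ = x ⟨Y, Z⟩ + y ⟨X, Z⟩ - z ⟨X, Y⟩`, where `X, Y, Z` are the (commuting) coordinate fields
extending `x, y, z`. -/
def christoffel (G : ∀ q : N, TangentSpace (𝓡 m) q → TangentSpace (𝓡 m) q → ℝ) (p : N)
    (x y : TangentSpace (𝓡 m) p) : TangentSpace (𝓡 m) p :=
  Classical.epsilon fun w => ∀ z : TangentSpace (𝓡 m) p,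
    2 * G p w z =
      mvfderiv (𝓡 m) (fun q => G q (coordField y q) (coordField z q)) p x
      + mvfderiv (𝓡 m) (fun q => G q (coordField x q) (coordField z q)) p y
      - mvfderiv (𝓡 m) (fun q => G q (coordField x q) (coordField y q)) p z

/-- The Levi-Civita covariant derivative `(∇_x T)(y, z)` of a covariant two-tensor. -/
def nabla2 (G : ∀ q : N, TangentSpace (𝓡 m) q → TangentSpace (𝓡 m) q → ℝ)
    (T : ∀ q : N, TangentSpace (𝓡 m) q → TangentSpace (𝓡 m) q → ℝ) (p : N)
    (x y z : TangentSpace (𝓡 m) p) : ℝ :=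
  mvfderiv (𝓡 m) (fun q => T q (coordField y q) (coordField z q)) p x
    - T p (christoffel G p x y) z - T p y (christoffel G p x z)

/-- The Levi-Civita covariant derivative `(∇_x T)(y, z, u)` of a covariant three-tensor. -/
def nabla3 (G : ∀ q : N, TangentSpace (𝓡 m) q → TangentSpace (𝓡 m) q → ℝ)
    (T : ∀ q : N, TangentSpace (𝓡 m) q → TangentSpace (𝓡 m) q → TangentSpace (𝓡 m) q → ℝ) (p : N)
    (x y z u : TangentSpace (𝓡 m) p) : ℝ :=
  mvfderiv (𝓡 m) (fun q => T q (coordField y q) (coordField z q) (coordField u q)) p x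
    - T p (christoffel G p x y) z u - T p y (christoffel G p x z) u
    - T p y z (christoffel G p x u)

/-- The Levi-Civita derivative `∇_x V` at `p` of a vector field `V` along a map `f : M → N`:
the components of `V` in the chart at `f p` are differentiated in the direction `x`, and the
connection term `∇_{f_* x} V` is added. -/
def nablaAlong {k : ℕ} {M : Type*} [TopologicalSpace M]
    [ChartedSpace (EuclideanSpace ℝ (Fin k)) M]
    (G : ∀ q : N, TangentSpace (𝓡 m) q → TangentSpace (𝓡 m) q → ℝ) (f : M → N)
    (V : ∀ q : M, TangentSpace (𝓡 m) (f q)) (p : M) (x : TangentSpace (𝓡 k) p) :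
    TangentSpace (𝓡 m) (f p) :=
  (trivializationAt (EuclideanSpace ℝ (Fin m)) (TangentSpace (𝓡 m) : N → Type _) (f p)).symm (f p)
      (mvfderiv (𝓡 k) (fun q : M => (trivializationAt (EuclideanSpace ℝ (Fin m))
        (TangentSpace (𝓡 m) : N → Type _) (f p) ⟨f q, V q⟩).2) p x)
    + christoffel G (f p) (mfderiv (𝓡 k) (𝓡 m) f p x) (V p)

end Connection

/-! ### Linear algebra on a tangent space -/

section Algebra

variable {V : Type*}

/-- Orthonormality of a `k`-tuple with respect to the bilinear form `G`. -/
def IsOrthonormal {k : ℕ} (G : V → V → ℝ) (e : Fin k → V) : Prop :=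
  ∀ i j, G (e i) (e j) = if i = j then 1 else 0

/-- The wedge product `a 0 ∧ … ∧ a (k - 1)` of one-forms, evaluated on `k` vectors. -/
def wedge {k : ℕ} (a : Fin k → V → ℝ) (x : Fin k → V) : ℝ :=
  Matrix.det (Matrix.of fun i j => a i (x j))

/-- The three-form `∑ e_i ∧ e_{i+1} ∧ e_{i+3}`, indices modulo seven, for the one-forms
`e_i = G(e i, ·)`. -/
def cayleyThree (G : V → V → ℝ) (e : Fin 7 → V) (x y z : V) : ℝ :=
  ∑ i : Fin 7, wedge ![G (e i), G (e (i + 1)), G (e (i + 3))] ![x, y, z]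

/-- The four-form `-∑ e_{i+2} ∧ e_{i+4} ∧ e_{i+5} ∧ e_{i+6}`, indices modulo seven; it is the Hodge
dual of the three-form above for the orientation `e_0 ∧ … ∧ e_6`. -/
def cayleyFour (G : V → V → ℝ) (e : Fin 7 → V) (x y z u : V) : ℝ :=
  -∑ i : Fin 7, wedge ![G (e (i + 2)), G (e (i + 4)), G (e (i + 5)), G (e (i + 6))] ![x, y, z, u]

/-- A Cayley frame for the metric `G` and the three-form `φ`. -/
def IsCayleyFrame (G : V → V → ℝ) (φ : V → V → V → ℝ) (e : Fin 7 → V) : Prop :=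
  IsOrthonormal G e ∧ ∀ x y z, φ x y z = cayleyThree G e x y z

/-- The scalar product of two-forms, computed in an orthonormal basis `e`. -/
def inner2 {k : ℕ} (e : Fin k → V) (a b : V → V → ℝ) : ℝ :=
  (1 / 2) * ∑ i, ∑ j, a (e i) (e j) * b (e i) (e j)

/-- The scalar product of three-forms, computed in an orthonormal basis `e`. -/
def inner3 {k : ℕ} (e : Fin k → V) (a b : V → V → V → ℝ) : ℝ :=
  (1 / 6) * ∑ i, ∑ j, ∑ l, a (e i) (e j) (e l) * b (e i) (e j) (e l)

/-- The irreducible classes of `SU(3)`-structures: `W₁⁺, W₁⁻, W₂⁺, W₂⁻, W₃, W₄, W₅`. -/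
inductive TorsionClass
  | W1p | W1m | W2p | W2m | W3 | W4 | W5
  deriving DecidableEq

variable [AddCommGroup V] [Module ℝ V]

/-- An orthonormal basis (some choice of it). Everything below that uses it does not depend on
the choice. -/
def orthoFrame (k : ℕ) (G : V → V → ℝ) : Fin k → V :=
  Classical.epsilon fun e => IsOrthonormal G e

/-- The space `T* ⊗ u(3)^⊥` of the tensors with the symmetries of `∇ω`: trilinear `α` with
`α(x, y, z) = -α(x, z, y) = -α(x, I y, I z)`. -/
def IsNablaOmegaType (I : V → V) (α : V → V → V → ℝ) : Prop :=
  (∃ L : V →ₗ[ℝ] V →ₗ[ℝ] V →ₗ[ℝ] ℝ, ∀ x y z, α x y z = L x y z) ∧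
  (∀ x y z, α x y z = -α x z y) ∧ (∀ x y z, α x y z = -α x (I y) (I z))

/-- The contraction `z ↦ ∑ α(e_i, e_i, z)`. -/
def contract (e : Fin 6 → V) (α : V → V → V → ℝ) (z : V) : ℝ := ∑ i, α (e i) (e i) z

/-- The Gray-Hervella module `W₁`. -/
def IsW1 (I : V → V) (α : V → V → V → ℝ) : Prop :=
  IsNablaOmegaType I α ∧ ∀ x y, α x x y = 0

/-- The Gray-Hervella module `W₂`. -/
def IsW2 (I : V → V) (α : V → V → V → ℝ) : Prop :=
  IsNablaOmegaType I α ∧ ∀ x y z, α x y z + α y z x + α z x y = 0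

/-- The Gray-Hervella module `W₃`. -/
def IsW3 (I : V → V) (e : Fin 6 → V) (α : V → V → V → ℝ) : Prop :=
  IsNablaOmegaType I α ∧ (∀ x y z, α x y z = α (I x) (I y) z) ∧ ∀ z, contract e α z = 0

/-- The Gray-Hervella module `W₄` (in real dimension six, so that `2 (n - 1) = 4`). -/
def IsW4 (G : V → V → ℝ) (I : V → V) (e : Fin 6 → V) (α : V → V → V → ℝ) : Prop :=
  IsNablaOmegaType I α ∧ ∀ x y z, α x y z =
    (1 / 4) * (G x y * contract e α z - G x z * contract e α y
      - G x (I y) * contract e α (I z) + G x (I z) * contract e α (I y))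

/-- The bilinear form `r(α)(x, y) = ½ ⟨x ⌟ α, y ⌟ ψ₊⟩`. -/
def rForm (e : Fin 6 → V) (psi : V → V → V → ℝ) (α : V → V → V → ℝ) (x y : V) : ℝ :=
  (1 / 2) * inner2 e (α x) (psi y)

/-- Membership in the irreducible `SU(3)`-submodules of `T* ⊗ u(3)^⊥`. For `i = 1, 2` the module
`W_i⁺` (`W_i⁻`) consists of the elements of `W_i` for which `r` is symmetric (skew-symmetric).
The class `W₅` does not contribute to `∇ω`. -/
def InModule (G : V → V → ℝ) (I : V → V) (e : Fin 6 → V) (psi : V → V → V → ℝ) :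
    TorsionClass → (V → V → V → ℝ) → Prop
  | .W1p, α => IsW1 I α ∧ ∀ x y, rForm e psi α x y = rForm e psi α y x
  | .W1m, α => IsW1 I α ∧ ∀ x y, rForm e psi α x y = -rForm e psi α y x
  | .W2p, α => IsW2 I α ∧ ∀ x y, rForm e psi α x y = rForm e psi α y x
  | .W2m, α => IsW2 I α ∧ ∀ x y, rForm e psi α x y = -rForm e psi α y x
  | .W3, α => IsW3 I e α
  | .W4, α => IsW4 G I e α
  | .W5, α => ∀ x y z, α x y z = 0

end Algebra

/-! ### `G₂`-structures -/

/-- A `G₂`-structure on a seven-manifold: a Riemannian metric and a smooth three-form which at every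
point has the standard expression in some orthonormal basis. -/
structure G2Structure (N : Type*) [TopologicalSpace N]
    [ChartedSpace (EuclideanSpace ℝ (Fin 7)) N] [IsManifold (𝓡 7) ∞ N] where
  /-- the Riemannian metric -/
  metric : Bundle.ContMDiffRiemannianMetric (𝓡 7) ∞ (EuclideanSpace ℝ (Fin 7))
    (TangentSpace (𝓡 7) : N → Type _)
  /-- the fundamental three-form (alternating and trilinear by the condition `cayley`) -/
  form3 : ∀ p : N, TangentSpace (𝓡 7) p → TangentSpace (𝓡 7) p → TangentSpace (𝓡 7) p → ℝ
  /-- smoothness: around every point the components in the chart at that point are smooth -/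
  smooth_form3 : ∀ (p : N) (x y z : TangentSpace (𝓡 7) p), ContMDiffAt (𝓡 7) 𝓘(ℝ, ℝ) ∞
    (fun q => form3 q (coordField x q) (coordField y q) (coordField z q)) p
  cayley : ∀ p : N, ∃ e : Fin 7 → TangentSpace (𝓡 7) p,
    IsCayleyFrame (fun x y => metric.inner p x y) (form3 p) e

namespace G2Structure

variable {N : Type*} [TopologicalSpace N] [ChartedSpace (EuclideanSpace ℝ (Fin 7)) N]
  [IsManifold (𝓡 7) ∞ N] (S : G2Structure N)

/-- The metric as a field of bilinear forms. -/
def g (p : N) (x y : TangentSpace (𝓡 7) p) : ℝ := S.metric.inner p x y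

/-- The four-form `*φ`, computed in a Cayley frame. -/
def starPhi (p : N) : TangentSpace (𝓡 7) p → TangentSpace (𝓡 7) p → TangentSpace (𝓡 7) p →
    TangentSpace (𝓡 7) p → ℝ :=
  cayleyFour (S.g p) (Classical.epsilon fun e => IsCayleyFrame (S.g p) (S.form3 p) e)

/-- The two-fold vector cross product `P`: `⟨P(x, y), z⟩ = φ(x, y, z)`. -/
def cross (p : N) (x y : TangentSpace (𝓡 7) p) : TangentSpace (𝓡 7) p :=
  Classical.epsilon fun w => ∀ z, S.g p w z = S.form3 p x y z

/-- The covariant derivative `(∇_x φ)(y, z, u)` for the Levi-Civita connection. -/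
def nablaPhi (p : N) (x y z u : TangentSpace (𝓡 7) p) : ℝ := nabla3 S.g S.form3 p x y z u

/-- The bilinear form `r(φ)(x, y) = ¼ ⟨∇_x φ, y ⌟ *φ⟩`. -/
def rbar (p : N) (x y : TangentSpace (𝓡 7) p) : ℝ :=
  (1 / 4) * inner3 (orthoFrame 7 (S.g p)) (S.nablaPhi p x) (S.starPhi p y)

/-- The `G₂`-structure is of type `X₂` (almost parallel): the alternation of `∇φ`, that is, the
exterior derivative `dφ`, vanishes. -/
def IsTypeX2 : Prop := ∀ (p : N) (x y z u : TangentSpace (𝓡 7) p),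
  S.nablaPhi p x y z u - S.nablaPhi p y x z u + S.nablaPhi p z x y u - S.nablaPhi p u x y z = 0

end G2Structure

/-! ### Orientable hypersurfaces -/

/-- An (immersed) orientable hypersurface `ι : M → N` of a manifold with `G₂`-structure, with unit
normal vector field `n`, together with a smooth function `θ` on `M`. -/
structure Hypersurface {N : Type*} [TopologicalSpace N]
    [ChartedSpace (EuclideanSpace ℝ (Fin 7)) N] [IsManifold (𝓡 7) ∞ N] (S : G2Structure N)
    (M : Type*) [TopologicalSpace M] [ChartedSpace (EuclideanSpace ℝ (Fin 6)) M]
    [IsManifold (𝓡 6) ∞ M] where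
  /-- the immersion -/
  incl : M → N
  smooth_incl : ContMDiff (𝓡 6) (𝓡 7) ∞ incl
  immersion : ∀ p, Function.Injective (mfderiv (𝓡 6) (𝓡 7) incl p)
  /-- the unit normal vector field -/
  normal : ∀ p, TangentSpace (𝓡 7) (incl p)
  smooth_normal : ContMDiff (𝓡 6) (𝓡 7).tangent ∞
    (fun p => (⟨incl p, normal p⟩ : TangentBundle (𝓡 7) N))
  normal_unit : ∀ p, S.g (incl p) (normal p) (normal p) = 1
  normal_perp : ∀ p x, S.g (incl p) (normal p) (mfderiv (𝓡 6) (𝓡 7) incl p x) = 0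
  /-- the phase of the complex volume form -/
  theta : M → ℝ
  smooth_theta : ContMDiff (𝓡 6) 𝓘(ℝ, ℝ) ∞ theta

namespace Hypersurface

variable {N : Type*} [TopologicalSpace N] [ChartedSpace (EuclideanSpace ℝ (Fin 7)) N]
  [IsManifold (𝓡 7) ∞ N] {S : G2Structure N} {M : Type*} [TopologicalSpace M]
  [ChartedSpace (EuclideanSpace ℝ (Fin 6)) M] [IsManifold (𝓡 6) ∞ M] (H : Hypersurface S M)

/-- The push-forward `ι_*`. -/
def push (p : M) (x : TangentSpace (𝓡 6) p) : TangentSpace (𝓡 7) (H.incl p) :=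
  mfderiv (𝓡 6) (𝓡 7) H.incl p x

/-- The induced metric. -/
def g (p : M) (x y : TangentSpace (𝓡 6) p) : ℝ := S.g (H.incl p) (H.push p x) (H.push p y)

/-- An orthonormal basis of the tangent space at `p`. -/
def frame (p : M) : Fin 6 → TangentSpace (𝓡 6) p := orthoFrame 6 (H.g p)

/-- The almost complex structure `I x = P(n, x)`. -/
def I (p : M) (x : TangentSpace (𝓡 6) p) : TangentSpace (𝓡 6) p :=
  Classical.epsilon fun w => H.push p w = S.cross (H.incl p) (H.normal p) (H.push p x)

/-- The Kähler form `ω(x, y) = ⟨x, I y⟩`. -/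
def omega (p : M) (x y : TangentSpace (𝓡 6) p) : ℝ := H.g p x (H.I p y)

/-- The three-form `ι^* φ`. -/
def pullPhi (p : M) (x y z : TangentSpace (𝓡 6) p) : ℝ :=
  S.form3 (H.incl p) (H.push p x) (H.push p y) (H.push p z)

/-- The three-form `ι^* (n ⌟ *φ)`. -/
def pullStarPhi (p : M) (x y z : TangentSpace (𝓡 6) p) : ℝ :=
  S.starPhi (H.incl p) (H.normal p) (H.push p x) (H.push p y) (H.push p z)

/-- The real part `ψ₊ = cos θ ι^* φ - sin θ ι^* (n ⌟ *φ)` of the complex volume form. -/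
def psiPlus (p : M) (x y z : TangentSpace (𝓡 6) p) : ℝ :=
  Real.cos (H.theta p) * H.pullPhi p x y z - Real.sin (H.theta p) * H.pullStarPhi p x y z

/-- The imaginary part `ψ₋ = sin θ ι^* φ + cos θ ι^* (n ⌟ *φ)` of the complex volume form. -/
def psiMinus (p : M) (x y z : TangentSpace (𝓡 6) p) : ℝ :=
  Real.sin (H.theta p) * H.pullPhi p x y z + Real.cos (H.theta p) * H.pullStarPhi p x y z

/-- The covariant derivative `(∇_x ω)(y, z)` for the Levi-Civita connection of the induced metric. -/
def nablaOmega (p : M) (x y z : TangentSpace (𝓡 6) p) : ℝ := nabla2 H.g H.omega p x y z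

/-- The covariant derivative `(∇_x ψ₊)(y, z, u)`. -/
def nablaPsiPlus (p : M) (x y z u : TangentSpace (𝓡 6) p) : ℝ := nabla3 H.g H.psiPlus p x y z u

/-- The coderivative `d^* ω (x) = -∑ (∇_{e_i} ω)(e_i, x)`. -/
def coderivOmega (p : M) (x : TangentSpace (𝓡 6) p) : ℝ :=
  -∑ i, H.nablaOmega p (H.frame p i) (H.frame p i) x

/-- The action of `I` on one-forms, `(I μ)(x) = -μ(I x)`. -/
def IForm (μ : ∀ p : M, TangentSpace (𝓡 6) p → ℝ) (p : M) (x : TangentSpace (𝓡 6) p) : ℝ :=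
  -μ p (H.I p x)

/-- The `W₅`-part of the intrinsic torsion, as a one-form `η`. The component of `∇ψ₊` in
`W₅⁻ = T*M ⊗ ψ₋` is `-η ψ₊ = -3 (I η) ⊗ ψ₋`; since `⟨ψ₋, ψ₋⟩ = 4` this says
`⟨∇_x ψ₊, ψ₋⟩ = -12 (I η)(x)`, that is, `⟨∇_{I x} ψ₊, ψ₋⟩ = -12 η(x)`. -/
def eta (p : M) (x : TangentSpace (𝓡 6) p) : ℝ :=
  -(1 / 12) * inner3 (H.frame p) (H.nablaPsiPlus p (H.I p x)) (H.psiMinus p)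

/-- The second fundamental form `B(x, y) = ⟨II(x, y), n⟩`: the normal component of the ambient
derivative `∇_x (ι_* Y)`, where `Y` extends `y`. -/
def B (p : M) (x y : TangentSpace (𝓡 6) p) : ℝ :=
  S.g (H.incl p) (nablaAlong S.g H.incl (fun q => H.push q (coordField y q)) p x) (H.normal p)

/-- `h = ⟨H, n⟩` for the mean curvature vector `H = (1/6) Tr II`. -/
def h (p : M) : ℝ := (1 / 6) * ∑ i, H.B p (H.frame p i) (H.frame p i)

/-- `M` is a minimal variety: the mean curvature vanishes. -/
def IsMinimal : Prop := ∀ p, H.h p = 0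

/-- The pull-back `ι^* r(φ)` to `M`. -/
def pullRbar (p : M) (x y : TangentSpace (𝓡 6) p) : ℝ :=
  S.rbar (H.incl p) (H.push p x) (H.push p y)

/-- The one-form `r(φ)(ι_* ·, n)` on `M`. -/
def rbarNormal (p : M) (x : TangentSpace (𝓡 6) p) : ℝ :=
  S.rbar (H.incl p) (H.push p x) (H.normal p)

/-- `(I_{(1)} b)(x, y) = -b(I x, y)`. -/
def I1 (b : ∀ p : M, TangentSpace (𝓡 6) p → TangentSpace (𝓡 6) p → ℝ) (p : M)
    (x y : TangentSpace (𝓡 6) p) : ℝ := -b p (H.I p x) y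

/-- `(I_{(2)} b)(x, y) = -b(x, I y)`. -/
def I2 (b : ∀ p : M, TangentSpace (𝓡 6) p → TangentSpace (𝓡 6) p → ℝ) (p : M)
    (x y : TangentSpace (𝓡 6) p) : ℝ := -b p x (H.I p y)

/-- `(I b)(x, y) = b(I x, I y)`. -/
def I12 (b : ∀ p : M, TangentSpace (𝓡 6) p → TangentSpace (𝓡 6) p → ℝ) (p : M)
    (x y : TangentSpace (𝓡 6) p) : ℝ := b p (H.I p x) (H.I p y)

/-- The differential of `θ`. -/
def dTheta (p : M) (x : TangentSpace (𝓡 6) p) : ℝ := mvfderiv (𝓡 6) H.theta p x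

/-- The `SU(3)`-structure on `M` is of type `∑_{c ∈ C} W_c`: at every point `∇ω` lies in the sum of
the modules with `c ∈ C`, and `η = 0` unless `W₅` occurs. -/
def HasType (C : Finset TorsionClass) : Prop := ∀ p : M,
  (∃ β : TorsionClass → TangentSpace (𝓡 6) p → TangentSpace (𝓡 6) p → TangentSpace (𝓡 6) p → ℝ,
    (∀ c ∈ C, InModule (H.g p) (H.I p) (H.frame p) (H.psiPlus p) c (β c)) ∧
    ∀ x y z, H.nablaOmega p x y z = ∑ c ∈ C, β c x y z) ∧
  (TorsionClass.W5 ∉ C → ∀ x, H.eta p x = 0)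

end Hypersurface

end G2SU3

end

open G2SU3

open Filter Topology

noncomputable section

namespace G2SU3

/-! ### Calculus rules for the derivative of functions on a manifold -/

section Derivation

variable {k : ℕ} {M : Type*} [TopologicalSpace M] [ChartedSpace (EuclideanSpace ℝ (Fin k)) M]
  {Y Z : Type*} [NormedAddCommGroup Y] [NormedSpace ℝ Y] [NormedAddCommGroup Z] [NormedSpace ℝ Z]

/-! The whole intrinsic torsion of the hypersurface is encoded in one bilinear form and one
one-form, and the ten equivalences are read off from their components.

Ambient side. Differentiating the identity φ(x, y, P(x, z)) = |x|²⟨y, z⟩ - ⟨x, y⟩⟨x, z⟩ shows that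
each ∇_v φ satisfies a linear identity whose only solutions among three-forms are ρ ⌟ *φ
(`nablaPhi_derivation`, `derivation_form`). So ∇φ is the same as the bilinear form r = r(φ). Under
G₂, bilinear forms on ℝ⁷ split as 1 + 7 + 14 + 27 and four-forms as 1 + 7 + 27; closedness of φ
therefore leaves only the part of dimension 14, which means that r is skew and its contraction with
φ vanishes (`torsion_of_closed`, `exists_rbar`).

Hypersurface side. Since ω = -φ(n, ·, ·), the Gauss and Weingarten formulas express ∇ω through r and
B. Put R = ι^*r and C(x, y) = B(x, y) + R(x, I y). Then ∇ω corresponds under r to the form cos θ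
C(x, y) + sin θ C(x, I y) (`ofBilin_rotatedBilin`). Indeed α ↦ r(α) is an isomorphism from T* ⊗
u(3)^⊥ onto bilinear forms, with inverse `ofBilin`, and it carries the modules to familiar ones: W₁⁺
and W₁⁻ are the multiples of g and of ω, W₂⁺ and W₂⁻ the symmetric and the skew I-invariant forms
without those parts, W₃ and W₄ the symmetric and the skew forms that change sign under I
(`inModule_iff`). Hence a type is the vanishing of explicit projections of the rotated C
(`exists_decomposition_iff`).

As B is symmetric and R is skew, each projection sees only part of the data. W₁ sees the trace of B,
because the contraction condition on r kills the ω-trace of R. W₂ sees the I-invariant part of B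
together with the part of R(·, I·) of the same kind. W₃ sees B - IB and W₄ sees R - IR. In W₁ and W₂
the factors cos θ and sin θ separate plus from minus, while in W₃ and W₄ the rotation is invertible
and drops out. The contraction condition along vectors tangent to M identifies both R - IR and the
trace d^*ω with r(ι_* ·, n).

Finally, the ψ₋-component of ∇ψ₊ is r(·, n) - dθ: all other terms of ∇ψ₊ are one-forms times g or ω,
which are orthogonal to ψ₋ (`inner3_psiMinus`). This gives η and hence the W₅ conditions. -/

theorem mvfderiv_congr {F₁ F₂ : M → Y} {p : M} (h : F₁ =ᶠ[𝓝 p] F₂) :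
    mvfderiv (𝓡 k) F₁ p = mvfderiv (𝓡 k) F₂ p := by
  have h0 := h.self_of_nhds
  ext x
  simp only [mvfderiv, h.mfderiv_eq]
  rfl

theorem mdifferentiableAt_sum {ι : Type*} (s : Finset ι) {F : ι → M → Y} {p : M}
    (h : ∀ i ∈ s, MDifferentiableAt (𝓡 k) 𝓘(ℝ, Y) (F i) p) :
    MDifferentiableAt (𝓡 k) 𝓘(ℝ, Y) (fun q => ∑ i ∈ s, F i q) p := by
  classical
  induction s using Finset.induction_on with
  | empty => simpa using mdifferentiableAt_const
  | insert i s hi ih =>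
    simp only [Finset.sum_insert hi]
    exact (h i (by simp)).add (ih fun j hj => h j (by simp [hj]))

theorem mvfderiv_sum {ι : Type*} (s : Finset ι) {F : ι → M → Y} {p : M}
    (h : ∀ i ∈ s, MDifferentiableAt (𝓡 k) 𝓘(ℝ, Y) (F i) p) (x : TangentSpace (𝓡 k) p) :
    mvfderiv (𝓡 k) (fun q => ∑ i ∈ s, F i q) p x = ∑ i ∈ s, mvfderiv (𝓡 k) (F i) p x := by
  classical
  induction s using Finset.induction_on with
  | empty => simp [mvfderiv_const]
  | insert i s hi ih =>
    simp only [Finset.sum_insert hi]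
    rw [mvfderiv_fun_add (h i (by simp)) (mdifferentiableAt_sum s fun j hj => h j (by simp [hj])),
      ← ih fun j hj => h j (by simp [hj])]
    rfl

theorem mdifferentiableAt_clm (L : Y →L[ℝ] Z) {F : M → Y} {p : M}
    (h : MDifferentiableAt (𝓡 k) 𝓘(ℝ, Y) F p) :
    MDifferentiableAt (𝓡 k) 𝓘(ℝ, Z) (fun q => L (F q)) p :=
  (L.mdifferentiableAt (x := F p)).comp p h

theorem mvfderiv_clm (L : Y →L[ℝ] Z) {F : M → Y} {p : M}
    (h : MDifferentiableAt (𝓡 k) 𝓘(ℝ, Y) F p) (x : TangentSpace (𝓡 k) p) :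
    mvfderiv (𝓡 k) (fun q => L (F q)) p x = L (mvfderiv (𝓡 k) F p x) := by
  have h1 := mfderiv_comp p (L.mdifferentiableAt (x := F p)) h
  have h2 : mfderiv 𝓘(ℝ, Y) 𝓘(ℝ, Z) L (F p) = L := L.mfderiv_eq
  simp only [mvfderiv]
  have : (fun q => L (F q)) = L ∘ F := rfl
  rw [this, h1, h2]
  rfl

theorem mdifferentiableAt_mul {F₁ F₂ : M → ℝ} {p : M}
    (h₁ : MDifferentiableAt (𝓡 k) 𝓘(ℝ, ℝ) F₁ p) (h₂ : MDifferentiableAt (𝓡 k) 𝓘(ℝ, ℝ) F₂ p) :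
    MDifferentiableAt (𝓡 k) 𝓘(ℝ, ℝ) (fun q => F₁ q * F₂ q) p := h₁.mul h₂

theorem mvfderiv_mul_apply {F₁ F₂ : M → ℝ} {p : M}
    (h₁ : MDifferentiableAt (𝓡 k) 𝓘(ℝ, ℝ) F₁ p) (h₂ : MDifferentiableAt (𝓡 k) 𝓘(ℝ, ℝ) F₂ p)
    (x : TangentSpace (𝓡 k) p) :
    mvfderiv (𝓡 k) (fun q => F₁ q * F₂ q) p x =
      F₁ p * mvfderiv (𝓡 k) F₂ p x + F₂ p * mvfderiv (𝓡 k) F₁ p x := by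
  rw [mvfderiv_fun_mul h₁ h₂]
  simp

end Derivation

/-! ### Chart components of vector fields along a map -/

section Fields

variable {m k : ℕ} {N : Type*} [TopologicalSpace N] [ChartedSpace (EuclideanSpace ℝ (Fin m)) N]
  [IsManifold (𝓡 m) ∞ N] {M : Type*} [TopologicalSpace M]
  [ChartedSpace (EuclideanSpace ℝ (Fin k)) M]

/-- The components of tangent vectors at `q` in the chart at `p`. -/
def comps (p q : N) : TangentSpace (𝓡 m) q →L[ℝ] EuclideanSpace ℝ (Fin m) :=
  (trivializationAt (EuclideanSpace ℝ (Fin m)) (TangentSpace (𝓡 m) : N → Type _) p).continuousLinearMapAt ℝ q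

/-- The tangent vector at `q` with given components in the chart at `p`. -/
def ofComps (p q : N) : EuclideanSpace ℝ (Fin m) →L[ℝ] TangentSpace (𝓡 m) q :=
  (trivializationAt (EuclideanSpace ℝ (Fin m)) (TangentSpace (𝓡 m) : N → Type _) p).symmL ℝ q

theorem eventually_mem_baseSet (p : N) : ∀ᶠ q in 𝓝 p,
    q ∈ (trivializationAt (EuclideanSpace ℝ (Fin m)) (TangentSpace (𝓡 m) : N → Type _) p).baseSet :=
  (trivializationAt (EuclideanSpace ℝ (Fin m)) (TangentSpace (𝓡 m) : N → Type _)
    p).open_baseSet.mem_nhds (FiberBundle.mem_baseSet_trivializationAt' p)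

theorem comps_ofComps {p q : N} (hq : q ∈ (trivializationAt (EuclideanSpace ℝ (Fin m))
    (TangentSpace (𝓡 m) : N → Type _) p).baseSet) (w : EuclideanSpace ℝ (Fin m)) :
    comps p q (ofComps p q w) = w :=
  Bundle.Trivialization.continuousLinearMapAt_symmL _ hq w

theorem ofComps_comps {p q : N} (hq : q ∈ (trivializationAt (EuclideanSpace ℝ (Fin m))
    (TangentSpace (𝓡 m) : N → Type _) p).baseSet) (v : TangentSpace (𝓡 m) q) :
    ofComps p q (comps p q v) = v :=
  Bundle.Trivialization.symmL_continuousLinearMapAt _ hq v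

theorem comps_apply {p q : N} (hq : q ∈ (trivializationAt (EuclideanSpace ℝ (Fin m))
    (TangentSpace (𝓡 m) : N → Type _) p).baseSet) (v : TangentSpace (𝓡 m) q) :
    comps p q v = (trivializationAt (EuclideanSpace ℝ (Fin m)) (TangentSpace (𝓡 m) : N → Type _) p
      ⟨q, v⟩).2 :=
  Bundle.Trivialization.continuousLinearMapAt_apply_of_mem ℝ _ hq v

theorem coordField_eq {p q : N} (hq : q ∈ (trivializationAt (EuclideanSpace ℝ (Fin m))
    (TangentSpace (𝓡 m) : N → Type _) p).baseSet) (v : TangentSpace (𝓡 m) p) :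
    coordField v q = ofComps p q (comps p p v) := by
  rw [comps_apply (FiberBundle.mem_baseSet_trivializationAt' p)]
  exact (Bundle.Trivialization.symmL_apply (R := ℝ) _ hq _).symm

theorem coordField_self {p : N} (v : TangentSpace (𝓡 m) p) : coordField v p = v :=
  FiberBundle.extend_apply_self _ v

theorem coordField_add {p : N} (v w : TangentSpace (𝓡 m) p) : ∀ᶠ q in 𝓝 p,
    coordField (v + w) q = coordField v q + coordField w q := by
  filter_upwards [eventually_mem_baseSet (m := m) p] with q hq
  simp [coordField_eq hq]

theorem coordField_smul {p : N} (c : ℝ) (v : TangentSpace (𝓡 m) p) : ∀ᶠ q in 𝓝 p,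
    coordField (c • v) q = c • coordField v q := by
  filter_upwards [eventually_mem_baseSet (m := m) p] with q hq
  simp [coordField_eq hq]

/-- The components in the chart at `f p` of a vector field along `f`. -/
def alongComps (f : M → N) (a : ∀ q : M, TangentSpace (𝓡 m) (f q)) (p q : M) :
    EuclideanSpace ℝ (Fin m) :=
  (trivializationAt (EuclideanSpace ℝ (Fin m)) (TangentSpace (𝓡 m) : N → Type _) (f p) ⟨f q, a q⟩).2

/-- Differentiability at `p` of a vector field along a map. -/
def DiffAlong (m k : ℕ) {N : Type*} [TopologicalSpace N]
    [ChartedSpace (EuclideanSpace ℝ (Fin m)) N] [IsManifold (𝓡 m) ∞ N] {M : Type*}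
    [TopologicalSpace M] [ChartedSpace (EuclideanSpace ℝ (Fin k)) M] (f : M → N) (a : ∀ q : M, TangentSpace (𝓡 m) (f q)) (p : M) : Prop :=
  MDifferentiableAt (𝓡 k) 𝓘(ℝ, EuclideanSpace ℝ (Fin m)) (alongComps f a p) p

/-- The derivative of the components of a vector field along a map. -/
def derivAlong (f : M → N) (a : ∀ q : M, TangentSpace (𝓡 m) (f q)) (p : M)
    (x : TangentSpace (𝓡 k) p) : TangentSpace (𝓡 m) (f p) :=
  ofComps (f p) (f p) (mvfderiv (𝓡 k) (alongComps f a p) p x)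

theorem nablaAlong_eq (G : ∀ q : N, TangentSpace (𝓡 m) q → TangentSpace (𝓡 m) q → ℝ)
    (f : M → N) (a : ∀ q : M, TangentSpace (𝓡 m) (f q)) (p : M) (x : TangentSpace (𝓡 k) p) :
    nablaAlong G f a p x = derivAlong f a p x
      + christoffel G (f p) (mfderiv (𝓡 k) (𝓡 m) f p x) (a p) := by
  unfold nablaAlong derivAlong alongComps ofComps
  rw [Bundle.Trivialization.symmL_apply _ (FiberBundle.mem_baseSet_trivializationAt' _)]

theorem alongComps_eventuallyEq {f : M → N} {p : M} (hf : ContinuousAt f p)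
    (a : ∀ q : M, TangentSpace (𝓡 m) (f q)) :
    alongComps f a p =ᶠ[𝓝 p] fun q => comps (f p) (f q) (a q) := by
  filter_upwards [hf.eventually (eventually_mem_baseSet (m := m) (f p))] with q hq
  rw [comps_apply hq]
  rfl

theorem alongComps_coordField {f : M → N} {p : M} (hf : ContinuousAt f p)
    (v : TangentSpace (𝓡 m) (f p)) :
    alongComps f (fun q => coordField v (f q)) p =ᶠ[𝓝 p] fun _ => comps (f p) (f p) v := by
  filter_upwards [hf.eventually (eventually_mem_baseSet (m := m) (f p)), alongComps_eventuallyEq (m := m) hf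
    (fun q => coordField v (f q))] with q hq h
  rw [h, coordField_eq hq, comps_ofComps hq]

theorem diffAlong_coordField {f : M → N} {p : M} (hf : ContinuousAt f p)
    (v : TangentSpace (𝓡 m) (f p)) : DiffAlong m k f (fun q => coordField v (f q)) p :=
  (mdifferentiableAt_const (c := comps (f p) (f p) v)).congr_of_eventuallyEq
    (alongComps_coordField (m := m) hf v)

theorem euclidean_expand (w : EuclideanSpace ℝ (Fin m)) :
    w = ∑ i, w i • EuclideanSpace.single i (1 : ℝ) := by
  conv_lhs => rw [← (EuclideanSpace.basisFun (Fin m) ℝ).sum_repr w]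
  simp

/-- The coordinate expansion of a linear form applied to a field along a map. -/
theorem linearForm_along_expand {f : M → N} {p : M} (hf : ContinuousAt f p)
    (lam : ∀ q : M, TangentSpace (𝓡 m) (f q) →ₗ[ℝ] ℝ) (a : ∀ q : M, TangentSpace (𝓡 m) (f q)) :
    (fun q => lam q (a q)) =ᶠ[𝓝 p] fun q => ∑ i, alongComps f a p q i *
      lam q (coordField (ofComps (f p) (f p) (EuclideanSpace.single i 1)) (f q)) := by
  filter_upwards [hf.eventually (eventually_mem_baseSet (m := m) (f p)),
    alongComps_eventuallyEq (m := m) hf a] with q hq h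
  rw [h]
  simp only [coordField_eq hq, comps_ofComps (FiberBundle.mem_baseSet_trivializationAt' (f p))]
  conv_lhs => rw [← ofComps_comps hq (a q)]
  conv_lhs => rw [euclidean_expand (comps (f p) (f q) (a q))]
  simp

/-- Product rule in the coordinate frame. The first term freezes the components of the field at
their value at `p` and differentiates the form; the second differentiates the components. Only the
values of the form on coordinate fields have to be differentiable, so no smooth bundle structure is
needed. -/
theorem linearForm_along {f : M → N} {p : M} (hf : ContinuousAt f p)
    (lam : ∀ q : M, TangentSpace (𝓡 m) (f q) →ₗ[ℝ] ℝ) {a : ∀ q : M, TangentSpace (𝓡 m) (f q)}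
    (hlam : ∀ v : TangentSpace (𝓡 m) (f p),
      MDifferentiableAt (𝓡 k) 𝓘(ℝ, ℝ) (fun q => lam q (coordField v (f q))) p)
    (ha : DiffAlong m k f a p) :
    MDifferentiableAt (𝓡 k) 𝓘(ℝ, ℝ) (fun q => lam q (a q)) p ∧
    ∀ x, mvfderiv (𝓡 k) (fun q => lam q (a q)) p x =
      mvfderiv (𝓡 k) (fun q => lam q (coordField (a p) (f q))) p x
        + lam p (derivAlong f a p x) := by
  have hc : ∀ i, MDifferentiableAt (𝓡 k) 𝓘(ℝ, ℝ) (fun q => alongComps f a p q i) p := fun i =>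
    mdifferentiableAt_clm (EuclideanSpace.proj i) ha
  have hterm : ∀ i ∈ Finset.univ, MDifferentiableAt (𝓡 k) 𝓘(ℝ, ℝ) (fun q => alongComps f a p q i *
      lam q (coordField (ofComps (f p) (f p) (EuclideanSpace.single i 1)) (f q))) p :=
    fun i _ => mdifferentiableAt_mul (hc i) (hlam _)
  have e := linearForm_along_expand (m := m) hf lam a
  refine ⟨(mdifferentiableAt_sum _ hterm).congr_of_eventuallyEq e, fun x => ?_⟩
  rw [mvfderiv_congr e, mvfderiv_sum _ hterm]
  have e' := linearForm_along_expand (m := m) hf lam (fun q => coordField (a p) (f q))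
  have e0 : alongComps f a p p = comps (f p) (f p) (a p) :=
    (alongComps_eventuallyEq (m := m) hf a).self_of_nhds
  have e'' : (fun q => lam q (coordField (a p) (f q))) =ᶠ[𝓝 p] fun q => ∑ i,
      alongComps f a p p i *
      lam q (coordField (ofComps (f p) (f p) (EuclideanSpace.single i 1)) (f q)) := by
    filter_upwards [e', alongComps_coordField (m := m) hf (a p)] with q h1 h2
    rw [h1, h2, e0]
  rw [mvfderiv_congr e'', mvfderiv_sum _ fun i _ => mdifferentiableAt_mul mdifferentiableAt_const (hlam _)]
  have hd : ∀ i, mvfderiv (𝓡 k) (fun q => alongComps f a p q i) p x =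
      mvfderiv (𝓡 k) (alongComps f a p) p x i := fun i =>
    mvfderiv_clm (EuclideanSpace.proj i) ha x
  have e3 : lam p (derivAlong f a p x) = ∑ i, mvfderiv (𝓡 k) (alongComps f a p) p x i *
      lam p (ofComps (f p) (f p) (EuclideanSpace.single i 1)) := by
    unfold derivAlong
    generalize mvfderiv (𝓡 k) (alongComps f a p) p x = w
    conv_lhs => rw [euclidean_expand w]
    simp
  rw [e3, ← Finset.sum_add_distrib]
  refine Finset.sum_congr rfl fun i _ => ?_
  rw [mvfderiv_mul_apply (hc i) (hlam _), mvfderiv_mul_apply mdifferentiableAt_const (hlam _), hd,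
    mvfderiv_const, coordField_self]
  simp only [zero_apply]
  ring

end Fields

/-! ### Product rules for bilinear and trilinear forms along a map -/

section Multilinear

variable {m k : ℕ} {N : Type*} [TopologicalSpace N] [ChartedSpace (EuclideanSpace ℝ (Fin m)) N]
  [IsManifold (𝓡 m) ∞ N] {M : Type*} [TopologicalSpace M]
  [ChartedSpace (EuclideanSpace ℝ (Fin k)) M]

/-- The linear case is used twice: first in the second slot with a coordinate field frozen in the
first, then in the first slot with the actual field `b` in the second. -/
theorem bilinearForm_along {f : M → N} {p : M} (hf : ContinuousAt f p)
    (T : ∀ q : M, TangentSpace (𝓡 m) (f q) →ₗ[ℝ] TangentSpace (𝓡 m) (f q) →ₗ[ℝ] ℝ)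
    {a b : ∀ q : M, TangentSpace (𝓡 m) (f q)}
    (hT : ∀ v w : TangentSpace (𝓡 m) (f p), MDifferentiableAt (𝓡 k) 𝓘(ℝ, ℝ)
      (fun q => T q (coordField v (f q)) (coordField w (f q))) p)
    (ha : DiffAlong m k f a p) (hb : DiffAlong m k f b p) :
    MDifferentiableAt (𝓡 k) 𝓘(ℝ, ℝ) (fun q => T q (a q) (b q)) p ∧
    ∀ x, mvfderiv (𝓡 k) (fun q => T q (a q) (b q)) p x =
      mvfderiv (𝓡 k) (fun q => T q (coordField (a p) (f q)) (coordField (b p) (f q))) p x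
        + T p (derivAlong f a p x) (b p) + T p (a p) (derivAlong f b p x) := by
  have h1 := fun v => linearForm_along hf (fun q => T q (coordField v (f q))) (hT v) hb
  have h2 := linearForm_along hf (fun q => (T q).flip (b q)) (fun v => (h1 v).1) ha
  refine ⟨h2.1, fun x => ?_⟩
  have h3 := h2.2 x
  have h4 := (h1 (a p)).2 x
  simp only [LinearMap.flip_apply, coordField_self] at h3 h4
  rw [h3, h4]
  ring

theorem trilinearForm_along {f : M → N} {p : M} (hf : ContinuousAt f p)
    (T : ∀ q : M, TangentSpace (𝓡 m) (f q) →ₗ[ℝ] TangentSpace (𝓡 m) (f q) →ₗ[ℝ]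
      TangentSpace (𝓡 m) (f q) →ₗ[ℝ] ℝ)
    {a b c : ∀ q : M, TangentSpace (𝓡 m) (f q)}
    (hT : ∀ u v w : TangentSpace (𝓡 m) (f p), MDifferentiableAt (𝓡 k) 𝓘(ℝ, ℝ)
      (fun q => T q (coordField u (f q)) (coordField v (f q)) (coordField w (f q))) p)
    (ha : DiffAlong m k f a p) (hb : DiffAlong m k f b p) (hc : DiffAlong m k f c p) :
    MDifferentiableAt (𝓡 k) 𝓘(ℝ, ℝ) (fun q => T q (a q) (b q) (c q)) p ∧
    ∀ x, mvfderiv (𝓡 k) (fun q => T q (a q) (b q) (c q)) p x =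
      mvfderiv (𝓡 k) (fun q => T q (coordField (a p) (f q)) (coordField (b p) (f q))
        (coordField (c p) (f q))) p x
        + T p (derivAlong f a p x) (b p) (c p) + T p (a p) (derivAlong f b p x) (c p)
        + T p (a p) (b p) (derivAlong f c p x) := by
  have h1 := fun v => bilinearForm_along hf (fun q => T q (coordField v (f q))) (hT v) hb hc
  have h2 := linearForm_along hf (fun q => ((T q).flip (b q)).flip (c q)) (fun v => (h1 v).1) ha
  refine ⟨h2.1, fun x => ?_⟩
  have h3 := h2.2 x
  have h4 := (h1 (a p)).2 x
  simp only [LinearMap.flip_apply, coordField_self] at h3 h4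
  rw [h3, h4]
  ring

end Multilinear

/-! ### The Levi-Civita connection of a metric field -/

section Metric

theorem exists_dual_of_posDef {V : Type*} [AddCommGroup V] [Module ℝ V] [FiniteDimensional ℝ V]
    (L : V →ₗ[ℝ] V →ₗ[ℝ] ℝ) (hpos : ∀ x, x ≠ 0 → 0 < L x x) (lam : V →ₗ[ℝ] ℝ) :
    ∃ w, ∀ z, L w z = lam z := by
  have hinj : Function.Injective L := by
    rw [← LinearMap.ker_eq_bot, LinearMap.ker_eq_bot']
    intro w hw
    by_contra h
    have := hpos w h
    rw [hw] at this
    simp at this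
  have hsurj : Function.Surjective L :=
    (LinearMap.injective_iff_surjective_of_finrank_eq_finrank
      (Subspace.dual_finrank_eq (K := ℝ) (V := V)).symm).1 hinj
  obtain ⟨w, hw⟩ := hsurj lam
  exact ⟨w, fun z => by rw [hw]⟩

theorem eq_of_posDef {V : Type*} [AddCommGroup V] [Module ℝ V]
    (L : V →ₗ[ℝ] V →ₗ[ℝ] ℝ) (hpos : ∀ x, x ≠ 0 → 0 < L x x) {v w : V}
    (h : ∀ z, L v z = L w z) : v = w := by
  by_contra hne
  have := hpos (v - w) (sub_ne_zero.2 hne)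
  rw [LinearMap.map_sub (L (v - w)), map_sub L, LinearMap.sub_apply, LinearMap.sub_apply, h, h, sub_self, sub_self,
    sub_self] at this
  exact lt_irrefl _ this

variable {m : ℕ} {N : Type*} [TopologicalSpace N] [ChartedSpace (EuclideanSpace ℝ (Fin m)) N]
  [IsManifold (𝓡 m) ∞ N]

/-- A Riemannian metric with differentiable components, given by the bilinear forms `L q`. -/
structure IsMetricField
    (L : ∀ q : N, TangentSpace (𝓡 m) q →ₗ[ℝ] TangentSpace (𝓡 m) q →ₗ[ℝ] ℝ) : Prop where
  symm : ∀ q x y, L q x y = L q y x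
  pos : ∀ q x, x ≠ 0 → 0 < L q x x
  diff : ∀ (p : N) (y z : TangentSpace (𝓡 m) p), MDifferentiableAt (𝓡 m) 𝓘(ℝ, ℝ)
    (fun q => L q (coordField y q) (coordField z q)) p

instance (p : N) : FiniteDimensional ℝ (TangentSpace (𝓡 m) p) :=
  inferInstanceAs (FiniteDimensional ℝ (EuclideanSpace ℝ (Fin m)))

/-- The derivative of the components of a bilinear form, as a bilinear form. -/
theorem exists_derivComponents
    (L : ∀ q : N, TangentSpace (𝓡 m) q →ₗ[ℝ] TangentSpace (𝓡 m) q →ₗ[ℝ] ℝ) (p : N)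
    (hL : ∀ y z : TangentSpace (𝓡 m) p, MDifferentiableAt (𝓡 m) 𝓘(ℝ, ℝ)
      (fun q => L q (coordField y q) (coordField z q)) p) :
    ∃ D : TangentSpace (𝓡 m) p →ₗ[ℝ] TangentSpace (𝓡 m) p →ₗ[ℝ] TangentSpace (𝓡 m) p →ₗ[ℝ] ℝ,
      ∀ x y z, D x y z = mvfderiv (𝓡 m) (fun q => L q (coordField y q) (coordField z q)) p x := by
  have add1 : ∀ y y' z : TangentSpace (𝓡 m) p,
      mvfderiv (𝓡 m) (fun q => L q (coordField (y + y') q) (coordField z q)) p =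
      mvfderiv (𝓡 m) (fun q => L q (coordField y q) (coordField z q)) p +
      mvfderiv (𝓡 m) (fun q => L q (coordField y' q) (coordField z q)) p := fun y y' z => by
    rw [← mvfderiv_fun_add (hL y z) (hL y' z)]
    refine mvfderiv_congr ?_
    filter_upwards [coordField_add y y'] with q hq
    simp [hq]
  have smul1 : ∀ (c : ℝ) (y z : TangentSpace (𝓡 m) p),
      mvfderiv (𝓡 m) (fun q => L q (coordField (c • y) q) (coordField z q)) p =
      c • mvfderiv (𝓡 m) (fun q => L q (coordField y q) (coordField z q)) p := fun c y z => by
    ext x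
    have := mvfderiv_clm (k := m) (c • ContinuousLinearMap.id ℝ ℝ) (hL y z) x
    simp only [smul_apply, ContinuousLinearMap.id_apply] at this ⊢
    rw [← this]
    refine congrArg (fun F : TangentSpace (𝓡 m) p →L[ℝ] ℝ => F x) (mvfderiv_congr ?_)
    filter_upwards [coordField_smul c y] with q hq
    simp [hq]
  have add2 : ∀ z y y' : TangentSpace (𝓡 m) p,
      mvfderiv (𝓡 m) (fun q => L q (coordField z q) (coordField (y + y') q)) p =
      mvfderiv (𝓡 m) (fun q => L q (coordField z q) (coordField y q)) p +
      mvfderiv (𝓡 m) (fun q => L q (coordField z q) (coordField y' q)) p := fun z y y' => by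
    rw [← mvfderiv_fun_add (hL z y) (hL z y')]
    refine mvfderiv_congr ?_
    filter_upwards [coordField_add y y'] with q hq
    simp [hq]
  have smul2 : ∀ (c : ℝ) (z y : TangentSpace (𝓡 m) p),
      mvfderiv (𝓡 m) (fun q => L q (coordField z q) (coordField (c • y) q)) p =
      c • mvfderiv (𝓡 m) (fun q => L q (coordField z q) (coordField y q)) p := fun c z y => by
    ext x
    have := mvfderiv_clm (k := m) (c • ContinuousLinearMap.id ℝ ℝ) (hL z y) x
    simp only [smul_apply, ContinuousLinearMap.id_apply] at this ⊢
    rw [← this]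
    refine congrArg (fun F : TangentSpace (𝓡 m) p →L[ℝ] ℝ => F x) (mvfderiv_congr ?_)
    filter_upwards [coordField_smul c y] with q hq
    simp [hq]
  refine ⟨LinearMap.mk₂ ℝ (fun x y => 
    { toFun := fun z => mvfderiv (𝓡 m) (fun q => L q (coordField y q) (coordField z q)) p x
      map_add' := fun z z' => by rw [add2]; rfl
      map_smul' := fun c z => by rw [smul2]; rfl }) ?_ ?_ ?_ ?_, fun x y z => rfl⟩
  · intro x x' y; ext z; simp
  · intro c x y; ext z; simp
  · intro x y y'; ext z
    simp only [LinearMap.coe_mk, AddHom.coe_mk, LinearMap.add_apply]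
    rw [add1]; rfl
  · intro c x y; ext z
    simp only [LinearMap.coe_mk, AddHom.coe_mk, LinearMap.smul_apply]
    rw [smul1]; rfl

variable {L : ∀ q : N, TangentSpace (𝓡 m) q →ₗ[ℝ] TangentSpace (𝓡 m) q →ₗ[ℝ] ℝ}

/-- The right-hand side is linear in `z`, so a positive definite form represents it by a vector. The
choice made in `christoffel` is therefore a genuine solution of the Koszul equation. -/
theorem koszul (hL : IsMetricField L) (p : N) (x y z : TangentSpace (𝓡 m) p) :
    2 * L p (christoffel (fun q x y => L q x y) p x y) z =
      mvfderiv (𝓡 m) (fun q => L q (coordField y q) (coordField z q)) p x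
      + mvfderiv (𝓡 m) (fun q => L q (coordField x q) (coordField z q)) p y
      - mvfderiv (𝓡 m) (fun q => L q (coordField x q) (coordField y q)) p z := by
  obtain ⟨D, hD⟩ := exists_derivComponents L p (hL.diff p)
  obtain ⟨w, hw⟩ := exists_dual_of_posDef (L p) (hL.pos p)
    ((1 / 2 : ℝ) • (D x y + D y x - (D.flip x).flip y))
  have : ∃ w, ∀ z : TangentSpace (𝓡 m) p, 2 * L p w z =
      mvfderiv (𝓡 m) (fun q => L q (coordField y q) (coordField z q)) p x
      + mvfderiv (𝓡 m) (fun q => L q (coordField x q) (coordField z q)) p y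
      - mvfderiv (𝓡 m) (fun q => L q (coordField x q) (coordField y q)) p z :=
    ⟨w, fun z => by
      rw [hw, ← hD, ← hD, ← hD]
      simp⟩
  exact Classical.epsilon_spec this z

theorem christoffel_symm (hL : IsMetricField L) (p : N) (x y : TangentSpace (𝓡 m) p) :
    christoffel (fun q x y => L q x y) p x y = christoffel (fun q x y => L q x y) p y x := by
  refine eq_of_posDef (L p) (hL.pos p) fun z => ?_
  have h1 := koszul hL p x y z
  have h2 := koszul hL p y x z
  have : (fun q => L q (coordField y q) (coordField x q)) =
      fun q => L q (coordField x q) (coordField y q) := funext fun q => hL.symm _ _ _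
  rw [this] at h2
  linarith

theorem exists_christoffel (hL : IsMetricField L) (p : N) :
    ∃ C : TangentSpace (𝓡 m) p →ₗ[ℝ] TangentSpace (𝓡 m) p →ₗ[ℝ] TangentSpace (𝓡 m) p,
      ∀ x y, C x y = christoffel (fun q x y => L q x y) p x y := by
  obtain ⟨D, hD⟩ := exists_derivComponents L p (hL.diff p)
  have h : ∀ x y z, 2 * L p (christoffel (fun q x y => L q x y) p x y) z =
      D x y z + D y x z - D z x y := fun x y z => by rw [koszul hL, hD, hD, hD]
  refine ⟨LinearMap.mk₂ ℝ (christoffel (fun q x y => L q x y) p) ?_ ?_ ?_ ?_, fun x y => rfl⟩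
  · intro x x' y
    refine eq_of_posDef (L p) (hL.pos p) fun z => ?_
    have h1 := h (x + x') y z
    have h2 := h x y z
    have h3 := h x' y z
    simp only [map_add, LinearMap.add_apply] at *
    linarith
  · intro c x y
    refine eq_of_posDef (L p) (hL.pos p) fun z => ?_
    have h1 := h (c • x) y z
    have h2 := h x y z
    simp only [map_smul, LinearMap.smul_apply, smul_eq_mul] at *
    linear_combination (1 / 2) * h1 - c / 2 * h2
  · intro x y y'
    refine eq_of_posDef (L p) (hL.pos p) fun z => ?_
    have h1 := h x (y + y') z
    have h2 := h x y z
    have h3 := h x y' z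
    simp only [map_add, LinearMap.add_apply] at *
    linarith
  · intro c x y
    refine eq_of_posDef (L p) (hL.pos p) fun z => ?_
    have h1 := h x (c • y) z
    have h2 := h x y z
    simp only [map_smul, LinearMap.smul_apply, smul_eq_mul] at *
    linear_combination (1 / 2) * h1 - c / 2 * h2

/-- Metric compatibility: in the sum of the Koszul formulas for (x, y, z) and (x, z, y) all
derivatives but one cancel. -/
theorem mvfderiv_metric (hL : IsMetricField L) (p : N) (x y z : TangentSpace (𝓡 m) p) :
    mvfderiv (𝓡 m) (fun q => L q (coordField y q) (coordField z q)) p x =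
      L p (christoffel (fun q x y => L q x y) p x y) z
      + L p y (christoffel (fun q x y => L q x y) p x z) := by
  have h1 := koszul hL p x y z
  have h2 := koszul hL p x z y
  have : (fun q => L q (coordField z q) (coordField y q)) =
      fun q => L q (coordField y q) (coordField z q) := funext fun q => hL.symm _ _ _
  rw [this] at h2
  have h3 := hL.symm p y (christoffel (fun q x y => L q x y) p x z)
  linarith

variable {k : ℕ} {M : Type*} [TopologicalSpace M] [ChartedSpace (EuclideanSpace ℝ (Fin k)) M]

theorem metric_along (hL : IsMetricField L) {f : M → N} {p : M}
    (hf : MDifferentiableAt (𝓡 k) (𝓡 m) f p) {a b : ∀ q : M, TangentSpace (𝓡 m) (f q)}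
    (ha : DiffAlong m k f a p) (hb : DiffAlong m k f b p) :
    MDifferentiableAt (𝓡 k) 𝓘(ℝ, ℝ) (fun q => L (f q) (a q) (b q)) p ∧
    ∀ x, mvfderiv (𝓡 k) (fun q => L (f q) (a q) (b q)) p x =
      L (f p) (nablaAlong (fun q x y => L q x y) f a p x) (b p)
      + L (f p) (a p) (nablaAlong (fun q x y => L q x y) f b p x) := by
  have h := bilinearForm_along hf.continuousAt (fun q => L (f q))
    (fun v w => (hL.diff (f p) v w).comp p hf) ha hb
  refine ⟨h.1, fun x => ?_⟩
  have h2 := mvfderiv_comp_apply p (hL.diff (f p) (a p) (b p)) hf x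
  rw [h.2, nablaAlong_eq, nablaAlong_eq]
  have h3 : mvfderiv (𝓡 k) (fun q => L (f q) (coordField (a p) (f q)) (coordField (b p) (f q))) p x
    = _ := h2
  rw [h3, mvfderiv_metric hL]
  simp only [map_add, LinearMap.add_apply]
  ring

/-- The Christoffel terms in the derivatives of the three fields cancel those in the covariant
derivative of the tensor. This is why `G` may be arbitrary here. -/
theorem tensor3_along {f : M → N} {p : M}
    (T : ∀ q : N, TangentSpace (𝓡 m) q →ₗ[ℝ] TangentSpace (𝓡 m) q →ₗ[ℝ]
      TangentSpace (𝓡 m) q →ₗ[ℝ] ℝ)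
    (hT : ∀ u v w : TangentSpace (𝓡 m) (f p), MDifferentiableAt (𝓡 m) 𝓘(ℝ, ℝ)
      (fun q => T q (coordField u q) (coordField v q) (coordField w q)) (f p))
    (G : ∀ q : N, TangentSpace (𝓡 m) q → TangentSpace (𝓡 m) q → ℝ)
    (hf : MDifferentiableAt (𝓡 k) (𝓡 m) f p) {a b c : ∀ q : M, TangentSpace (𝓡 m) (f q)}
    (ha : DiffAlong m k f a p) (hb : DiffAlong m k f b p) (hc : DiffAlong m k f c p) :
    MDifferentiableAt (𝓡 k) 𝓘(ℝ, ℝ) (fun q => T (f q) (a q) (b q) (c q)) p ∧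
    ∀ x, mvfderiv (𝓡 k) (fun q => T (f q) (a q) (b q) (c q)) p x =
      nabla3 G (fun q x y z => T q x y z) (f p) (mfderiv (𝓡 k) (𝓡 m) f p x) (a p) (b p) (c p)
      + T (f p) (nablaAlong G f a p x) (b p) (c p) + T (f p) (a p) (nablaAlong G f b p x) (c p)
      + T (f p) (a p) (b p) (nablaAlong G f c p x) := by
  have h := trilinearForm_along hf.continuousAt (fun q => T (f q))
    (fun u v w => (hT u v w).comp p hf) ha hb hc
  refine ⟨h.1, fun x => ?_⟩
  have h2 := mvfderiv_comp_apply p (hT (a p) (b p) (c p)) hf x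
  have h3 : mvfderiv (𝓡 k) (fun q => T (f q) (coordField (a p) (f q)) (coordField (b p) (f q))
    (coordField (c p) (f q))) p x = _ := h2
  rw [h.2, h3]
  simp only [nablaAlong_eq, nabla3, map_add, LinearMap.add_apply]
  ring

end Metric

/-! ### Differentiability of the inverse of a matrix -/

section Inverse

variable {k : ℕ} {M : Type*} [TopologicalSpace M] [ChartedSpace (EuclideanSpace ℝ (Fin k)) M]

theorem mdifferentiableAt_prod {ι : Type*} (s : Finset ι) {F : ι → M → ℝ} {p : M}
    (h : ∀ i ∈ s, MDifferentiableAt (𝓡 k) 𝓘(ℝ, ℝ) (F i) p) :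
    MDifferentiableAt (𝓡 k) 𝓘(ℝ, ℝ) (fun q => ∏ i ∈ s, F i q) p := by
  classical
  induction s using Finset.induction_on with
  | empty => simpa using mdifferentiableAt_const
  | insert i s hi ih =>
    simp only [Finset.prod_insert hi]
    exact (h i (by simp)).mul (ih fun j hj => h j (by simp [hj]))

theorem mdifferentiableAt_det {r : ℕ} {A : M → Matrix (Fin r) (Fin r) ℝ} {p : M}
    (h : ∀ i j, MDifferentiableAt (𝓡 k) 𝓘(ℝ, ℝ) (fun q => A q i j) p) :
    MDifferentiableAt (𝓡 k) 𝓘(ℝ, ℝ) (fun q => (A q).det) p := by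
  simp only [Matrix.det_apply']
  exact mdifferentiableAt_sum _ fun σ _ => mdifferentiableAt_mul mdifferentiableAt_const
    (mdifferentiableAt_prod _ fun i _ => h _ _)

theorem mdifferentiableAt_inv_apply {r : ℕ} {A : M → Matrix (Fin r) (Fin r) ℝ} {p : M}
    (h : ∀ i j, MDifferentiableAt (𝓡 k) 𝓘(ℝ, ℝ) (fun q => A q i j) p) (hp : (A p).det ≠ 0)
    (i j : Fin r) : MDifferentiableAt (𝓡 k) 𝓘(ℝ, ℝ) (fun q => (A q)⁻¹ i j) p := by
  simp only [Matrix.inv_def, Matrix.smul_apply, Ring.inverse_eq_inv', smul_eq_mul,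
    Matrix.adjugate_apply]
  refine mdifferentiableAt_mul ((mdifferentiableAt_det h).inv hp) (mdifferentiableAt_det ?_)
  intro a b
  by_cases hab : a = j
  · subst hab
    simp only [Matrix.updateRow_self]
    exact mdifferentiableAt_const
  · simp only [Matrix.updateRow_ne hab]
    exact h a b

end Inverse

/-! ### Differentiability of fields along a map, and second derivatives of the map -/

section Along

variable {m k : ℕ} {N : Type*} [TopologicalSpace N] [ChartedSpace (EuclideanSpace ℝ (Fin m)) N]
  [IsManifold (𝓡 m) ∞ N] {M : Type*} [TopologicalSpace M]
  [ChartedSpace (EuclideanSpace ℝ (Fin k)) M]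
  {L : ∀ q : N, TangentSpace (𝓡 m) q →ₗ[ℝ] TangentSpace (𝓡 m) q →ₗ[ℝ] ℝ}

theorem gram_det_ne_zero (hL : IsMetricField L) (p : N) :
    (Matrix.of fun i j => L p (ofComps p p (EuclideanSpace.single i 1))
      (ofComps p p (EuclideanSpace.single j 1))).det ≠ 0 := by
  intro h0
  obtain ⟨v, hv, h⟩ := Matrix.exists_mulVec_eq_zero_iff.2 h0
  set w : EuclideanSpace ℝ (Fin m) := WithLp.toLp 2 v with hw
  have hexp : ofComps p p w = ∑ i, v i • ofComps p p (EuclideanSpace.single i 1) := by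
    conv_lhs => rw [euclidean_expand w]
    simp [hw]
  have hzero : L p (ofComps p p w) (ofComps p p w) = 0 := by
    have h2 : ∀ i, L p (ofComps p p (EuclideanSpace.single i 1)) (ofComps p p w) = 0 := fun i => by
      have := congrFun h i
      simp only [Matrix.mulVec, dotProduct, Matrix.of_apply, Pi.zero_apply] at this
      rw [hexp]
      simp only [map_sum, map_smul, smul_eq_mul]
      rw [← this]
      exact Finset.sum_congr rfl fun _ _ => mul_comm _ _
    have := congrArg (fun u => L p u (ofComps p p w)) hexp
    simpa [h2] using this
  have hne : ofComps p p w ≠ 0 := by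
    intro h
    apply hv
    have := comps_ofComps (FiberBundle.mem_baseSet_trivializationAt' p) w
    rw [h, map_zero] at this
    funext i
    have h3 := congrArg (fun u : EuclideanSpace ℝ (Fin m) => u i) this
    simpa [hw] using h3.symm
  exact (hL.pos p _ hne).ne' hzero

/-- A field along a map is differentiable if its inner products with coordinate fields are. -/
theorem diffAlong_of_inner (hL : IsMetricField L) {f : M → N} {p : M}
    (hf : MDifferentiableAt (𝓡 k) (𝓡 m) f p) {a : ∀ q : M, TangentSpace (𝓡 m) (f q)}
    (ha : ∀ v : TangentSpace (𝓡 m) (f p), MDifferentiableAt (𝓡 k) 𝓘(ℝ, ℝ)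
      (fun q => L (f q) (a q) (coordField v (f q))) p) : DiffAlong m k f a p := by
  set e : ∀ (i : Fin m) (q : M), TangentSpace (𝓡 m) (f q) := fun i q =>
    coordField (ofComps (f p) (f p) (EuclideanSpace.single i 1)) (f q) with he
  set A : M → Matrix (Fin m) (Fin m) ℝ := fun q => Matrix.of fun i j => L (f q) (e i q) (e j q)
    with hA
  have hAd : ∀ i j, MDifferentiableAt (𝓡 k) 𝓘(ℝ, ℝ) (fun q => A q i j) p := fun i j =>
    (hL.diff (f p) _ _).comp p hf
  have hdet : (A p).det ≠ 0 := by
    have := gram_det_ne_zero hL (f p)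
    simp only [hA, he, coordField_self]
    exact this
  have hev : ∀ᶠ q in 𝓝 p, (A q).det ≠ 0 :=
    (mdifferentiableAt_det hAd).continuousAt.eventually_ne hdet
  -- The inner products with the coordinate frame are the components multiplied by the Gram matrix;
  -- its inverse, differentiable by Cramer's rule, recovers the components.
  have hexp : ∀ᶠ q in 𝓝 p, ∀ j, L (f q) (a q) (e j q) =
      ∑ i, alongComps f a p q i * A q i j := by
    rw [Filter.eventually_all]
    intro j
    exact linearForm_along_expand hf.continuousAt (fun q => (L (f q)).flip (e j q)) a
  have hc : ∀ i, MDifferentiableAt (𝓡 k) 𝓘(ℝ, ℝ) (fun q => alongComps f a p q i) p := by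
    intro i
    have h1 : MDifferentiableAt (𝓡 k) 𝓘(ℝ, ℝ)
        (fun q => ∑ j, L (f q) (a q) (e j q) * (A q)⁻¹ j i) p :=
      mdifferentiableAt_sum _ fun j _ =>
        mdifferentiableAt_mul (ha _) (mdifferentiableAt_inv_apply hAd hdet j i)
    refine h1.congr_of_eventuallyEq ?_
    filter_upwards [hev, hexp] with q hq1 hq2
    have hv : Matrix.vecMul (alongComps f a p q).ofLp (A q) = fun j => L (f q) (a q) (e j q) := by
      funext j
      rw [hq2 j]
      rfl
    have h3 : Matrix.vecMul (fun j => L (f q) (a q) (e j q)) (A q)⁻¹ =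
        (alongComps f a p q).ofLp := by
      rw [← hv, Matrix.vecMul_vecMul, Matrix.mul_nonsing_inv _ (isUnit_iff_ne_zero.2 hq1),
        Matrix.vecMul_one]
    rw [← h3]
    rfl
  have h2 : alongComps f a p = fun q => ∑ i,
      ContinuousLinearMap.toSpanSingleton ℝ (EuclideanSpace.single i (1 : ℝ))
        (alongComps f a p q i) := by
    funext q
    conv_lhs => rw [euclidean_expand (alongComps f a p q)]
    simp [ContinuousLinearMap.toSpanSingleton_apply]
  unfold DiffAlong
  rw [h2]
  exact mdifferentiableAt_sum _ fun i _ => mdifferentiableAt_clm _ (hc i)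

variable [IsManifold (𝓡 k) ∞ M]

/-- Read in the two charts, the image of a constant field is the derivative of the local
representative of `f` applied to a fixed vector. Differentiating once more brings in the second
derivative of that representative. -/
theorem alongComps_push {f : M → N} {p : M} (hf : ContMDiffAt (𝓡 k) (𝓡 m) ∞ f p)
    (v : TangentSpace (𝓡 k) p) :
    alongComps f (fun q => mfderiv (𝓡 k) (𝓡 m) f q (coordField v q)) p =ᶠ[𝓝 p] fun q =>
      fderiv ℝ (writtenInExtChartAt (𝓡 k) (𝓡 m) p f) (extChartAt (𝓡 k) p q) (comps p p v) := by
  have hf1 : ContMDiffAt (𝓡 k) (𝓡 m) 1 f p := hf.of_le (by exact_mod_cast le_top)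
  filter_upwards [alongComps_eventuallyEq (m := m) hf.continuousAt
    (fun q => mfderiv (𝓡 k) (𝓡 m) f q (coordField v q)), eventually_mem_baseSet (m := k) p,
    hf.continuousAt.eventually (eventually_mem_baseSet (m := m) (f p)),
    (contMDiffAt_iff_contMDiffAt_nhds (by simp)).1 hf1] with q h1 h2 h3 h4
  rw [h1, coordField_eq h2]
  rw [TangentBundle.trivializationAt_baseSet] at h2 h3
  unfold comps ofComps
  rw [TangentBundle.continuousLinearMapAt_trivializationAt h3,
    TangentBundle.symmL_trivializationAt h2]
  simp only [ModelWithCorners.range_eq_univ, mfderivWithin_univ]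
  generalize (Bundle.Trivialization.continuousLinearMapAt ℝ (trivializationAt
    (EuclideanSpace ℝ (Fin k)) (TangentSpace (𝓡 k)) p) p) v = w
  have hq : (extChartAt (𝓡 k) p).symm (extChartAt (𝓡 k) p q) = q :=
    (extChartAt (𝓡 k) p).left_inv (by simpa using h2)
  have hs : MDifferentiableAt 𝓘(ℝ, EuclideanSpace ℝ (Fin k)) (𝓡 k) (extChartAt (𝓡 k) p).symm
      (extChartAt (𝓡 k) p q) := by
    have := mdifferentiableWithinAt_extChartAt_symm (I := 𝓡 k) (x := p)
      ((extChartAt (𝓡 k) p).map_source (by simpa using h2))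
    rwa [ModelWithCorners.range_eq_univ, mdifferentiableWithinAt_univ] at this
  have hfd : MDifferentiableAt (𝓡 k) (𝓡 m) f q := h4.mdifferentiableAt one_ne_zero
  have hg : MDifferentiableAt (𝓡 m) 𝓘(ℝ, EuclideanSpace ℝ (Fin m)) (extChartAt (𝓡 m) (f p)) (f q) :=
    mdifferentiableAt_extChartAt h3
  have e1 := mfderiv_comp_apply_of_eq _ hfd hs hq w
  have e2 := mfderiv_comp_apply_of_eq (extChartAt (𝓡 k) p q) hg
    (f := f ∘ (extChartAt (𝓡 k) p).symm) (hfd.comp_of_eq _ hs hq) (congrArg f hq) w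
  rw [e1] at e2
  refine Eq.trans e2.symm ?_
  rw [← mfderiv_eq_fderiv]
  rfl

theorem mvfderiv_comp_extChartAt {Y : Type*} [NormedAddCommGroup Y] [NormedSpace ℝ Y] (p : M)
    {F : EuclideanSpace ℝ (Fin k) → Y} (hF : DifferentiableAt ℝ F (extChartAt (𝓡 k) p p)) :
    MDifferentiableAt (𝓡 k) 𝓘(ℝ, Y) (fun q => F (extChartAt (𝓡 k) p q)) p ∧
    ∀ x, mvfderiv (𝓡 k) (fun q => F (extChartAt (𝓡 k) p q)) p x =
      fderiv ℝ F (extChartAt (𝓡 k) p p) (comps p p x) := by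
  have hφ : MDifferentiableAt (𝓡 k) 𝓘(ℝ, EuclideanSpace ℝ (Fin k)) (extChartAt (𝓡 k) p) p :=
    mdifferentiableAt_extChartAt (mem_chart_source _ p)
  refine ⟨hF.mdifferentiableAt.comp p hφ, fun x => ?_⟩
  have := mfderiv_comp_apply p hF.mdifferentiableAt hφ x
  rw [mfderiv_eq_fderiv] at this
  have hx : comps p p x = mfderiv (𝓡 k) 𝓘(ℝ, EuclideanSpace ℝ (Fin k)) (extChartAt (𝓡 k) p) p x := by
    unfold comps
    rw [TangentBundle.continuousLinearMapAt_trivializationAt (mem_chart_source _ p)]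
    rfl
  rw [hx]
  exact this

theorem push_coordField {f : M → N} {p : M} (hf : ContMDiffAt (𝓡 k) (𝓡 m) ∞ f p)
    (v : TangentSpace (𝓡 k) p) :
    DiffAlong m k f (fun q => mfderiv (𝓡 k) (𝓡 m) f q (coordField v q)) p ∧
    ∀ x, derivAlong f (fun q => mfderiv (𝓡 k) (𝓡 m) f q (coordField v q)) p x =
      ofComps (f p) (f p) (fderiv ℝ (fderiv ℝ (writtenInExtChartAt (𝓡 k) (𝓡 m) p f))
        (extChartAt (𝓡 k) p p) (comps p p x) (comps p p v)) := by
  have hc : ContDiffAt ℝ ∞ (writtenInExtChartAt (𝓡 k) (𝓡 m) p f) (extChartAt (𝓡 k) p p) := by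
    have := (contMDiffAt_iff.1 hf).2
    rwa [ModelWithCorners.range_eq_univ, contDiffWithinAt_univ] at this
  have hd : DifferentiableAt ℝ (fderiv ℝ (writtenInExtChartAt (𝓡 k) (𝓡 m) p f))
      (extChartAt (𝓡 k) p p) :=
    (hc.fderiv_right (m := 1) (by
      rw [one_add_one_eq_two]; exact WithTop.coe_le_coe.2 (le_top : (2 : ℕ∞) ≤ ⊤))).differentiableAt one_ne_zero
  have h := mvfderiv_comp_extChartAt p
    (F := fun y => fderiv ℝ (writtenInExtChartAt (𝓡 k) (𝓡 m) p f) y (comps p p v))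
    (hd.clm_apply (differentiableAt_const _))
  have he := alongComps_push hf v
  refine ⟨h.1.congr_of_eventuallyEq he, fun x => ?_⟩
  unfold derivAlong
  rw [mvfderiv_congr he, h.2, fderiv_clm_apply hd (differentiableAt_const _)]
  simp

/-- Symmetry of the second derivative of the local representative. Together with the symmetry of the
Christoffel terms it makes the second fundamental form symmetric. -/
theorem derivAlong_push_symm {f : M → N} {p : M} (hf : ContMDiffAt (𝓡 k) (𝓡 m) ∞ f p)
    (x y : TangentSpace (𝓡 k) p) :
    derivAlong f (fun q => mfderiv (𝓡 k) (𝓡 m) f q (coordField y q)) p x =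
    derivAlong f (fun q => mfderiv (𝓡 k) (𝓡 m) f q (coordField x q)) p y := by
  have hc : ContDiffAt ℝ ∞ (writtenInExtChartAt (𝓡 k) (𝓡 m) p f) (extChartAt (𝓡 k) p p) := by
    have := (contMDiffAt_iff.1 hf).2
    rwa [ModelWithCorners.range_eq_univ, contDiffWithinAt_univ] at this
  rw [(push_coordField hf y).2, (push_coordField hf x).2]
  congr 1
  exact hc.isSymmSndFDerivAt (by
    simp only [minSmoothness_of_isRCLikeNormedField]
    exact WithTop.coe_le_coe.2 (le_top : (2 : ℕ∞) ≤ ⊤)) _ _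

end Along

/-! ### Structure constants of φ and *φ, and the linear algebra of the torsion in a Cayley frame -/

section StructureConstants

def kd (i j : Fin 7) : ℤ := if i = j then 1 else 0

/-- The structure constants of the Cayley three-form. -/
def phiT (i j k : Fin 7) : ℤ :=
  match (j - i).val, (k - i).val with
  | 1, 3 => 1 | 2, 6 => 1 | 4, 5 => 1
  | 3, 1 => -1 | 6, 2 => -1 | 5, 4 => -1
  | _, _ => 0

/-- The structure constants of the dual four-form. -/
def starT (l i j k : Fin 7) : ℤ :=
  match (i - l).val, (j - l).val, (k - l).val with
  | 3, 5, 6 => 1 | 5, 6, 3 => 1 | 6, 3, 5 => 1 | 3, 6, 5 => -1 | 6, 5, 3 => -1 | 5, 3, 6 => -1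
  | 1, 6, 4 => 1 | 6, 4, 1 => 1 | 4, 1, 6 => 1 | 1, 4, 6 => -1 | 4, 6, 1 => -1 | 6, 1, 4 => -1
  | 1, 2, 5 => 1 | 2, 5, 1 => 1 | 5, 1, 2 => 1 | 1, 5, 2 => -1 | 5, 2, 1 => -1 | 2, 1, 5 => -1
  | 2, 4, 3 => 1 | 4, 3, 2 => 1 | 3, 2, 4 => 1 | 2, 3, 4 => -1 | 3, 4, 2 => -1 | 4, 2, 3 => -1
  | _, _, _ => 0

/-- Both tables depend only on differences of indices modulo seven. Identities among them can
therefore be checked with one index equal to zero, where a finite decision is cheap. -/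
theorem phiT_shift (l i j k : Fin 7) : phiT (i - l) (j - l) (k - l) = phiT i j k := by
  simp only [phiT, sub_sub_sub_cancel_right]

theorem starT_shift (l i j k : Fin 7) : starT 0 (i - l) (j - l) (k - l) = starT l i j k := by
  simp only [starT, sub_zero]

theorem starT_shift' (n l i j k : Fin 7) :
    starT (l - n) (i - n) (j - n) (k - n) = starT l i j k := by
  simp only [starT, sub_sub_sub_cancel_right]

theorem phiT_eq : ∀ i j k, phiT i j k =
    kd i (k + 4) * kd j (k + 5) - kd i (k + 5) * kd j (k + 4)
    + (kd i (k + 1) * kd j (k + 3) - kd i (k + 3) * kd j (k + 1))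
    + (kd i (k + 2) * kd j (k + 6) - kd i (k + 6) * kd j (k + 2)) := by decide +kernel

theorem starT_eq_zero : ∀ i j k, starT 0 i j k =
    -(∑ m, phiT 0 i m * phiT j k m) + kd 0 j * kd i k - kd 0 k * kd i j := by decide +kernel

theorem starT_eq (l i j k : Fin 7) : starT l i j k =
    -(∑ m, phiT l i m * phiT j k m) + kd l j * kd i k - kd l k * kd i j := by
  have h1 : ∑ m, phiT l i m * phiT j k m = ∑ m, phiT 0 (i - l) m * phiT (j - l) (k - l) m := by
    refine Fintype.sum_equiv (Equiv.subRight l) _ _ fun m => ?_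
    rw [Equiv.subRight_apply, phiT_shift, ← sub_self l, phiT_shift]
  rw [h1, ← starT_shift, starT_eq_zero]
  simp only [kd, eq_comm (a := (0 : Fin 7)), sub_eq_zero, sub_left_inj, eq_comm (a := l)]

theorem starT_contract_zero : ∀ m, ∑ i, ∑ j, ∑ k, starT 0 i j k * starT m i j k =
    if 0 = m then 24 else 0 := by decide +kernel

/-- The three-forms `e_l ⌟ *φ` are orthogonal of squared norm 24 / 6 = 4. This is the origin of the
factor 1/4 in r(φ). -/
theorem starT_contract (l m : Fin 7) : ∑ i, ∑ j, ∑ k, starT l i j k * starT m i j k =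
    if l = m then 24 else 0 := by
  have h := starT_contract_zero (m - l)
  simp only [eq_comm (a := (0 : Fin 7)), sub_eq_zero, eq_comm (b := l)] at h
  rw [← h]
  refine Fintype.sum_equiv (Equiv.subRight l) _ _ fun i => ?_
  refine Fintype.sum_equiv (Equiv.subRight l) _ _ fun j => ?_
  refine Fintype.sum_equiv (Equiv.subRight l) _ _ fun k => ?_
  simp only [Equiv.subRight_apply, starT_shift', starT_shift]

theorem alternating_eq_zero {r : ℕ} {A : Fin r → Fin r → Fin r → ℝ}
    (h₁ : ∀ i j k, A i j k = -A j i k) (h₂ : ∀ i j k, A i j k = -A i k j)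
    (h : ∀ i j k, i < j → j < k → A i j k = 0) (i j k : Fin r) : A i j k = 0 := by
  have e₁ : ∀ i j, A i i j = 0 := fun i j => by linarith [h₁ i i j]
  have e₂ : ∀ i j, A i j j = 0 := fun i j => by linarith [h₂ i j j]
  have e₃ : ∀ i j, A i j i = 0 := fun i j => by linarith [h₁ i j i, e₂ j i]
  rcases lt_trichotomy i j with hij | rfl | hij
  · rcases lt_trichotomy j k with hjk | rfl | hjk
    · exact h i j k hij hjk
    · exact e₂ i j
    · rcases lt_trichotomy i k with hik | rfl | hik
      · linarith [h₂ i j k, h i k j hik hjk]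
      · exact e₃ i j
      · linarith [h₂ i j k, h₁ i k j, h k i j hik hij]
  · exact e₁ i k
  · rcases lt_trichotomy j k with hjk | rfl | hjk
    · rcases lt_trichotomy i k with hik | rfl | hik
      · linarith [h₁ i j k, h j i k hij hik]
      · exact e₃ i j
      · linarith [h₁ i j k, h₂ j i k, h j k i hjk hik]
    · exact e₂ i j
    · linarith [h₁ i j k, h₂ j i k, h₁ j k i, h k j i hjk hij]

theorem starT_antisymm₁ (l i j k : Fin 7) : starT l i j k = -starT l j i k := by
  rw [← starT_shift, ← starT_shift l j]
  generalize i - l = a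
  generalize j - l = b
  generalize k - l = c
  revert a b c
  decide +kernel

theorem starT_antisymm₂ (l i j k : Fin 7) : starT l i j k = -starT l i k j := by
  rw [← starT_shift, ← starT_shift l i]
  generalize i - l = a
  generalize j - l = b
  generalize k - l = c
  revert a b c
  decide +kernel

theorem neg_fin_seven : (-1 : Fin 7) = 6 ∧ (-2 : Fin 7) = 5 ∧ (-3 : Fin 7) = 4 ∧
    (-4 : Fin 7) = 3 ∧ (-5 : Fin 7) = 2 ∧ (-6 : Fin 7) = 1 := by decide

/-- The triples of distinct indices, up to order and cyclic shifts. -/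
theorem exists_shift_of_lt : ∀ i j k : Fin 7, i < j → j < k → ∃ l : Fin 7,
    ∃ c ∈ ([(0, 1, 3), (1, 2, 5), (2, 4, 3), (3, 5, 6), (1, 6, 4)] : List (Fin 7 × Fin 7 × Fin 7)),
    (i, j, k) ∈ ([(l + c.1, l + c.2.1, l + c.2.2), (l + c.1, l + c.2.2, l + c.2.1),
      (l + c.2.1, l + c.1, l + c.2.2), (l + c.2.1, l + c.2.2, l + c.1),
      (l + c.2.2, l + c.1, l + c.2.1), (l + c.2.2, l + c.2.1, l + c.1)] :
      List (Fin 7 × Fin 7 × Fin 7)) := by decide +kernel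

/-- Translation modulo seven splits the 35 unordered triples of distinct indices into five orbits of
seven; the hypothesis contains one representative of each. -/
theorem alternating_eq_zero_of_shift {A : Fin 7 → Fin 7 → Fin 7 → ℝ}
    (h₁ : ∀ i j k, A i j k = -A j i k) (h₂ : ∀ i j k, A i j k = -A i k j)
    (h : ∀ l, A l (l + 1) (l + 3) = 0 ∧ A (l + 1) (l + 2) (l + 5) = 0 ∧
      A (l + 2) (l + 4) (l + 3) = 0 ∧ A (l + 3) (l + 5) (l + 6) = 0 ∧
      A (l + 1) (l + 6) (l + 4) = 0) (i j k : Fin 7) : A i j k = 0 := by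
  refine alternating_eq_zero h₁ h₂ (fun i j k hij hjk => ?_) i j k
  obtain ⟨l, c, hc, hm⟩ := exists_shift_of_lt i j k hij hjk
  have hz : A (l + c.1) (l + c.2.1) (l + c.2.2) = 0 := by
    obtain ⟨g1, g2, g3, g4, g5⟩ := h l
    simp only [List.mem_cons, List.not_mem_nil, or_false] at hc
    rcases hc with rfl | rfl | rfl | rfl | rfl
    · simpa using g1
    all_goals assumption
  generalize l + c.1 = a at hz hm
  generalize l + c.2.1 = b at hz hm
  generalize l + c.2.2 = d at hz hm
  simp only [List.mem_cons, List.not_mem_nil, or_false, Prod.mk.injEq] at hm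
  have q1 := h₁ a b d
  have q2 := h₂ a b d
  have q3 := h₂ b a d
  have q4 := h₁ a d b
  have q5 := h₂ d a b
  rcases hm with ⟨rfl, rfl, rfl⟩ | ⟨rfl, rfl, rfl⟩ | ⟨rfl, rfl, rfl⟩ | ⟨rfl, rfl, rfl⟩ |
    ⟨rfl, rfl, rfl⟩ | ⟨rfl, rfl, rfl⟩ <;> linarith

theorem starT_base : ∀ m, starT m 0 1 3 = 0 ∧ (starT m 1 2 5 = if m = 0 then 1 else 0) ∧
    (starT m 2 4 3 = if m = 0 then 1 else 0) ∧ (starT m 3 5 6 = if m = 0 then 1 else 0) ∧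
    (starT m 1 6 4 = if m = 0 then 1 else 0) := by decide +kernel

/-- Four instances of the identity suffice. With a = 0, b = c = 1 it says that `X` vanishes on the
line {0, 1, 3} of φ; the other three link the components with the same *φ-index. -/
theorem components_of_derivation {X : Fin 7 → Fin 7 → Fin 7 → ℝ}
    (h₁ : ∀ i j k, X i j k = -X j i k) (h₂ : ∀ i j k, X i j k = -X i k j)
    (h : ∀ a b c, ∑ k, X a b k * (phiT a c k : ℝ) + ∑ k, X a c k * (phiT a b k : ℝ) = 0) :
    X 0 1 3 = 0 ∧ X 2 4 3 = X 1 2 5 ∧ X 3 5 6 = X 1 2 5 ∧ X 1 6 4 = X 1 2 5 := by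
  have r1 := h 0 1 1
  have r2 := h 2 1 3
  have r3 := h 3 4 5
  have r4 := h 1 2 6
  simp [Fin.sum_univ_seven, phiT, neg_fin_seven] at r1 r2 r3 r4
  refine ⟨by linarith, ?_, ?_, ?_⟩
  · linarith [h₁ 2 1 5, h₂ 2 3 4]
  · linarith [h₁ 2 1 5, h₂ 2 3 4, h₂ 3 4 2, h₁ 3 2 4]
  · linarith

/-- Shifting the previous relations, the seven components on the lines of φ vanish and the remaining
28 reduce to seven numbers. The coefficient of `e_l ⌟ *φ` is read off at the triple (l + 1, l + 2, l
+ 5), where this form takes the value 1 and the others vanish. -/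
theorem starT_expand_of_derivation {X : Fin 7 → Fin 7 → Fin 7 → ℝ}
    (h₁ : ∀ i j k, X i j k = -X j i k) (h₂ : ∀ i j k, X i j k = -X i k j)
    (h : ∀ a b c, ∑ k, X a b k * (phiT a c k : ℝ) + ∑ k, X a c k * (phiT a b k : ℝ) = 0)
    (i j k : Fin 7) :
    X i j k = ∑ l, X (l + 1) (l + 2) (l + 5) * (starT l i j k : ℝ) := by
  have key : ∀ l, X l (l + 1) (l + 3) = 0 ∧ X (l + 2) (l + 4) (l + 3) = X (l + 1) (l + 2) (l + 5) ∧
      X (l + 3) (l + 5) (l + 6) = X (l + 1) (l + 2) (l + 5) ∧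
      X (l + 1) (l + 6) (l + 4) = X (l + 1) (l + 2) (l + 5) := by
    intro l
    have hs : ∀ (F : Fin 7 → ℝ) (a c : Fin 7), ∑ k, F (l + k) * (phiT a c k : ℝ) =
        ∑ k, F k * (phiT (l + a) (l + c) k : ℝ) := fun F a c => by
      refine Fintype.sum_equiv (Equiv.addLeft l) _ _ fun k => ?_
      rw [Equiv.coe_addLeft, ← phiT_shift l (l + a)]
      simp only [add_sub_cancel_left]
    have := components_of_derivation (X := fun i j k => X (l + i) (l + j) (l + k))
      (fun i j k => h₁ _ _ _) (fun i j k => h₂ _ _ _) (fun a b c => by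
        rw [hs (fun k => X (l + a) (l + b) k), hs (fun k => X (l + a) (l + c) k)]
        exact h _ _ _)
    simpa using this
  rw [← sub_eq_zero]
  refine alternating_eq_zero_of_shift (A := fun i j k => X i j k - ∑ l, X (l + 1) (l + 2) (l + 5) *
    (starT l i j k : ℝ)) ?_ ?_ ?_ i j k
  · intro i j k
    simp only [h₁ i j k, starT_antisymm₁ _ i j k, Int.cast_neg, mul_neg, Finset.sum_neg_distrib]
    ring
  · intro i j k
    simp only [h₂ i j k, starT_antisymm₂ _ i j k, Int.cast_neg, mul_neg, Finset.sum_neg_distrib]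
    ring
  · intro l
    obtain ⟨k1, k2, k3, k4⟩ := key l
    have hs : ∀ m a b c, starT m (l + a) (l + b) (l + c) = starT (m - l) a b c := fun m a b c => by
      rw [← starT_shift' l m]
      simp only [add_sub_cancel_left]
    have h0 : ∀ m, starT m l (l + 1) (l + 3) = 0 := fun m => by
      have := hs m 0 1 3
      rw [add_zero] at this
      rw [this, (starT_base _).1]
    simp only [h0, hs, (starT_base _).2.1, (starT_base _).2.2.1, (starT_base _).2.2.2.1,
      (starT_base _).2.2.2.2, sub_eq_zero, k1, k2, k3, k4]
    simp

theorem starT_values : ∀ l,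
    (starT l 0 1 2 = if l = 5 then -1 else 0) ∧ (starT l 0 1 3 = 0) ∧
    (starT l 0 1 4 = if l = 6 then 1 else 0) ∧ (starT l 0 1 5 = if l = 2 then 1 else 0) ∧
    (starT l 0 1 6 = if l = 4 then -1 else 0) ∧ (starT l 0 2 3 = if l = 4 then 1 else 0) ∧
    (starT l 0 2 4 = if l = 3 then -1 else 0) ∧ (starT l 0 2 5 = if l = 1 then -1 else 0) ∧
    (starT l 0 2 6 = 0) ∧ (starT l 0 3 4 = if l = 2 then 1 else 0) ∧
    (starT l 0 3 5 = if l = 6 then -1 else 0) ∧ (starT l 0 3 6 = if l = 5 then 1 else 0) ∧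
    (starT l 0 4 5 = 0) ∧ (starT l 0 4 6 = if l = 1 then 1 else 0) ∧
    (starT l 0 5 6 = if l = 3 then -1 else 0) ∧ (starT l 1 2 3 = if l = 6 then -1 else 0) ∧
    (starT l 1 2 4 = 0) ∧ (starT l 1 2 5 = if l = 0 then 1 else 0) ∧
    (starT l 1 2 6 = if l = 3 then 1 else 0) ∧ (starT l 1 3 4 = if l = 5 then 1 else 0) ∧
    (starT l 1 3 5 = if l = 4 then -1 else 0) ∧ (starT l 1 3 6 = if l = 2 then -1 else 0) ∧
    (starT l 1 4 5 = if l = 3 then 1 else 0) ∧ (starT l 1 4 6 = if l = 0 then -1 else 0) ∧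
    (starT l 1 5 6 = 0) ∧ (starT l 2 3 4 = if l = 0 then -1 else 0) ∧
    (starT l 2 3 5 = 0) ∧ (starT l 2 3 6 = if l = 1 then 1 else 0) ∧
    (starT l 2 4 5 = if l = 6 then 1 else 0) ∧ (starT l 2 4 6 = if l = 5 then -1 else 0) ∧
    (starT l 2 5 6 = if l = 4 then 1 else 0) ∧ (starT l 3 4 5 = if l = 1 then -1 else 0) ∧
    (starT l 3 4 6 = 0) ∧ (starT l 3 5 6 = if l = 0 then 1 else 0) ∧
    (starT l 4 5 6 = if l = 2 then -1 else 0) := by decide +kernel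

/-- The hypothesis is the vanishing of dφ in components. For each entry of r to be found, the
four-vectors (a, b, c, d) that involve it are combined so that everything else cancels. The
differences 0, 1, 2, 3 of indices represent all pairs up to order and translation. -/
theorem torsion_components {r : Fin 7 → Fin 7 → ℝ}
    (h : ∀ a b c d, ∑ l, r a l * (starT l b c d : ℝ) - ∑ l, r b l * (starT l a c d : ℝ)
      + ∑ l, r c l * (starT l a b d : ℝ) - ∑ l, r d l * (starT l a b c : ℝ) = 0) :
    r 0 0 = 0 ∧ r 0 1 + r 1 0 = 0 ∧ r 0 2 + r 2 0 = 0 ∧ r 0 3 + r 3 0 = 0 ∧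
      r 1 3 - r 3 1 + (r 2 6 - r 6 2) + (r 4 5 - r 5 4) = 0 := by
  have a1 := h 0 1 2 5
  have a2 := h 0 1 4 6
  have a3 := h 0 2 3 4
  have a4 := h 0 3 5 6
  have a5 := h 1 2 3 6
  have a6 := h 1 3 4 5
  have a7 := h 2 4 5 6
  have b1 := h 0 2 3 6
  have b2 := h 0 3 4 5
  have b3 := h 1 2 3 4
  have b4 := h 1 3 5 6
  have c1 := h 0 1 3 6
  have c2 := h 0 4 5 6
  have c3 := h 1 2 4 6
  have c4 := h 2 3 5 6
  have d1 := h 0 1 2 6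
  have d2 := h 0 1 4 5
  have d3 := h 1 2 3 5
  have d4 := h 1 3 4 6
  have e1 := h 0 1 2 4
  have e2 := h 0 1 5 6
  have e3 := h 0 2 3 5
  have e4 := h 0 3 4 6
  clear h
  simp only [starT_values, Int.cast_ite, Int.cast_one, Int.cast_zero, Int.cast_neg, mul_ite, mul_one,
    mul_zero, mul_neg, Finset.sum_ite_eq', Finset.mem_univ, if_true, Finset.sum_const_zero] at *
  refine ⟨?_, ?_, ?_, ?_, ?_⟩
  · linear_combination (a1 - a2 - a3 + a4 - a5 + a6 + a7) / 4
  · linear_combination (b1 - b2 - b3 + b4) / 2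
  · linear_combination (-c1 - c2 + c3 + c4) / 2
  · linear_combination (d1 + d2 + d3 + d4) / 2
  · linear_combination (e1 + e2 + e3 + e4) / 2

theorem exists_shift_pair : ∀ i j : Fin 7, ∃ l d : Fin 7, (d = 0 ∨ d = 1 ∨ d = 2 ∨ d = 3) ∧
    ((i = l ∧ j = l + d) ∨ (j = l ∧ i = l + d)) := by decide +kernel

theorem sum_phiT (F : Fin 7 → Fin 7 → ℝ) : ∑ j, ∑ k, (phiT 0 j k : ℝ) * F j k =
    F 1 3 - F 3 1 + (F 2 6 - F 6 2) + (F 4 5 - F 5 4) := by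
  simp only [Fin.sum_univ_seven]
  simp [phiT]
  ring

/-- The torsion of an almost parallel structure is a two-form in the Lie algebra of `G₂`. -/
theorem torsion_of_closed {r : Fin 7 → Fin 7 → ℝ}
    (h : ∀ a b c d, ∑ l, r a l * (starT l b c d : ℝ) - ∑ l, r b l * (starT l a c d : ℝ)
      + ∑ l, r c l * (starT l a b d : ℝ) - ∑ l, r d l * (starT l a b c : ℝ) = 0) :
    (∀ i j, r i j = -r j i) ∧ ∀ i, ∑ j, ∑ k, (phiT i j k : ℝ) * r j k = 0 := by
  -- The relations at the index 0 are transported to every index by translating `r`.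
  have key : ∀ l, r l l = 0 ∧ r l (l + 1) + r (l + 1) l = 0 ∧ r l (l + 2) + r (l + 2) l = 0 ∧
      r l (l + 3) + r (l + 3) l = 0 ∧ r (l + 1) (l + 3) - r (l + 3) (l + 1) +
      (r (l + 2) (l + 6) - r (l + 6) (l + 2)) + (r (l + 4) (l + 5) - r (l + 5) (l + 4)) = 0 := by
    intro l
    have hs : ∀ (F : Fin 7 → ℝ) (a b c : Fin 7), ∑ m, F (l + m) * (starT m a b c : ℝ) =
        ∑ m, F m * (starT m (l + a) (l + b) (l + c) : ℝ) := fun F a b c => by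
      refine Fintype.sum_equiv (Equiv.addLeft l) _ _ fun m => ?_
      rw [Equiv.coe_addLeft, ← starT_shift' l (l + m)]
      simp only [add_sub_cancel_left]
    have := torsion_components (r := fun i j => r (l + i) (l + j)) (fun a b c d => by
      rw [hs (r (l + a)), hs (r (l + b)), hs (r (l + c)), hs (r (l + d))]
      exact h _ _ _ _)
    simpa using this
  constructor
  · intro i j
    obtain ⟨l, d, hd, hij⟩ := exists_shift_pair i j
    obtain ⟨k0, k1, k2, k3, -⟩ := key l
    rcases hij with ⟨rfl, rfl⟩ | ⟨rfl, rfl⟩ <;> rcases hd with rfl | rfl | rfl | rfl <;>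
      (try simp only [add_zero]) <;> linarith
  · intro i
    have h1 : ∑ j, ∑ k, (phiT i j k : ℝ) * r j k =
        ∑ j, ∑ k, (phiT 0 j k : ℝ) * r (i + j) (i + k) := by
      refine (Fintype.sum_equiv (Equiv.addLeft i) _ _ fun j => ?_).symm
      refine Fintype.sum_equiv (Equiv.addLeft i) _ _ fun k => ?_
      rw [Equiv.coe_addLeft, ← phiT_shift i i]
      simp only [add_sub_cancel_left, sub_self]
    rw [h1, sum_phiT (fun j k => r (i + j) (i + k))]
    exact (key i).2.2.2.2

end StructureConstants
-- Orthonormal bases, and independence of contractions from them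
section Frames

variable {V : Type*} [AddCommGroup V] [Module ℝ V]

theorem orthonormal_linearIndependent {k : ℕ} {g : V →ₗ[ℝ] V →ₗ[ℝ] ℝ} {e : Fin k → V}
    (he : IsOrthonormal (fun x y => g x y) e) : LinearIndependent ℝ e := by
  rw [Fintype.linearIndependent_iff]
  intro c hc i
  have h := congrArg (g (e i)) hc
  have he' : ∀ j, g (e i) (e j) = if i = j then 1 else 0 := he i
  simpa [he'] using h

theorem orthonormal_expand {k : ℕ} [NeZero k] {g : V →ₗ[ℝ] V →ₗ[ℝ] ℝ} {e : Fin k → V}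
    (hk : Module.finrank ℝ V = k) (he : IsOrthonormal (fun x y => g x y) e) (x : V) :
    x = ∑ i, g (e i) x • e i := by
  set b := basisOfLinearIndependentOfCardEqFinrank (orthonormal_linearIndependent he)
    (by simp [hk]) with hb
  have hbe : ∀ i, b i = e i := fun i => by simp [hb]
  have h1 := b.sum_repr x
  simp only [hbe] at h1
  have h2 : ∀ i, g (e i) x = b.repr x i := fun i => by
    have he' : ∀ j, g (e i) (e j) = if i = j then 1 else 0 := he i
    conv_lhs => rw [← h1]
    simp [he']
  simp only [h2]
  exact h1.symm

theorem metric_expand {k : ℕ} [NeZero k] {g : V →ₗ[ℝ] V →ₗ[ℝ] ℝ} {e : Fin k → V}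
    (hk : Module.finrank ℝ V = k) (he : IsOrthonormal (fun x y => g x y) e) (x y : V) :
    g x y = ∑ i, g (e i) x * g (e i) y := by
  conv_lhs => rw [orthonormal_expand hk he x]
  simp

/-- The trace of a bilinear form does not depend on the orthonormal basis. -/
theorem trace_eq {k : ℕ} [NeZero k] {g : V →ₗ[ℝ] V →ₗ[ℝ] ℝ} {e f : Fin k → V}
    (hk : Module.finrank ℝ V = k) (he : IsOrthonormal (fun x y => g x y) e)
    (hf : IsOrthonormal (fun x y => g x y) f) (b : V →ₗ[ℝ] V →ₗ[ℝ] ℝ) :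
    ∑ i, b (e i) (e i) = ∑ i, b (f i) (f i) := by
  set A : Matrix (Fin k) (Fin k) ℝ := Matrix.of fun i j => g (f j) (e i) with hA
  have h1 : A * A.transpose = 1 := by
    ext i j
    rw [Matrix.mul_apply, Matrix.one_apply]
    have := metric_expand hk hf (e i) (e j)
    rw [show g (e i) (e j) = _ from he i j] at this
    simpa [hA] using this.symm
  have h2 : A.transpose * A = 1 := mul_eq_one_comm.1 h1
  have h3 : ∀ i, b (e i) (e i) = ∑ p, ∑ q, A i p * A i q * b (f p) (f q) := fun i => by
    conv_lhs => rw [orthonormal_expand hk hf (e i)]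
    simp only [map_sum, map_smul, LinearMap.sum_apply, LinearMap.smul_apply, smul_eq_mul,
      Finset.mul_sum]
    rw [Finset.sum_comm]
    refine Finset.sum_congr rfl fun p _ => Finset.sum_congr rfl fun q _ => ?_
    simp only [hA, Matrix.of_apply]
    ring
  simp only [h3]
  rw [Finset.sum_comm]
  refine Finset.sum_congr rfl fun p _ => ?_
  rw [Finset.sum_comm]
  have h4 : ∀ q, ∑ i, A i p * A i q = if p = q then 1 else 0 := fun q => by
    have := congrFun (congrFun h2 p) q
    rwa [Matrix.mul_apply, Matrix.one_apply] at this
  simp [← Finset.sum_mul, h4]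

/-- The frame is changed one slot at a time: with the other argument fixed, each sum is the trace of
a bilinear form. The same device gives the case of three-forms. -/
theorem inner2_eq {k : ℕ} [NeZero k] {g : V →ₗ[ℝ] V →ₗ[ℝ] ℝ} {e f : Fin k → V}
    (hk : Module.finrank ℝ V = k) (he : IsOrthonormal (fun x y => g x y) e)
    (hf : IsOrthonormal (fun x y => g x y) f) (a b : V →ₗ[ℝ] V →ₗ[ℝ] ℝ) :
    inner2 e (fun x y => a x y) (fun x y => b x y) =
    inner2 f (fun x y => a x y) (fun x y => b x y) := by
  unfold inner2
  congr 1
  have h1 : ∀ x, ∑ j, a x (e j) * b x (e j) = ∑ j, a x (f j) * b x (f j) := fun x =>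
    trace_eq hk he hf (LinearMap.mk₂ ℝ (fun u v => a x u * b x v)
      (by intros; simp; ring) (by intros; simp; ring) (by intros; simp; ring)
      (by intros; simp; ring))
  simp only [h1]
  rw [Finset.sum_comm, Finset.sum_comm (f := fun i j => a (f i) (f j) * b (f i) (f j))]
  refine Finset.sum_congr rfl fun j _ => ?_
  exact trace_eq hk he hf (LinearMap.mk₂ ℝ (fun u v => a u (f j) * b v (f j))
      (by intros; simp; ring) (by intros; simp; ring) (by intros; simp; ring)
      (by intros; simp; ring))

theorem inner3_eq {k : ℕ} [NeZero k] {g : V →ₗ[ℝ] V →ₗ[ℝ] ℝ} {e f : Fin k → V}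
    (hk : Module.finrank ℝ V = k) (he : IsOrthonormal (fun x y => g x y) e)
    (hf : IsOrthonormal (fun x y => g x y) f) (a b : V →ₗ[ℝ] V →ₗ[ℝ] V →ₗ[ℝ] ℝ) :
    inner3 e (fun x y z => a x y z) (fun x y z => b x y z) =
    inner3 f (fun x y z => a x y z) (fun x y z => b x y z) := by
  unfold inner3
  congr 1
  have h1 : ∀ x, ∑ j, ∑ l, a x (e j) (e l) * b x (e j) (e l) =
      ∑ j, ∑ l, a x (f j) (f l) * b x (f j) (f l) := fun x => by
    have := inner2_eq hk he hf (a x) (b x)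
    unfold inner2 at this
    linarith
  simp only [h1]
  have h2 : ∀ c : Fin k → V, ∑ i, ∑ j, ∑ l, a (c i) (f j) (f l) * b (c i) (f j) (f l) =
      ∑ j, ∑ l, ∑ i, a (c i) (f j) (f l) * b (c i) (f j) (f l) := fun c => by
    rw [Finset.sum_comm]
    exact Finset.sum_congr rfl fun j _ => Finset.sum_comm
  rw [h2 e, h2 f]
  refine Finset.sum_congr rfl fun j _ => Finset.sum_congr rfl fun l _ => ?_
  exact trace_eq hk he hf (LinearMap.mk₂ ℝ (fun u v => a u (f j) (f l) * b v (f j) (f l))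
      (by intros; simp; ring) (by intros; simp; ring) (by intros; simp; ring)
      (by intros; simp; ring))

end Frames

/-! ### Identities of the cross product and of the four-form -/

section Cayley

variable {W : Type*} [AddCommGroup W] [Module ℝ W]

/-- A seven-dimensional vector space with metric `g`, three-form `φ`, cross product `P` and
Cayley frame `e`. -/
structure CayleySpace (g : W →ₗ[ℝ] W →ₗ[ℝ] ℝ) (φ : W →ₗ[ℝ] W →ₗ[ℝ] W →ₗ[ℝ] ℝ)
    (P : W →ₗ[ℝ] W →ₗ[ℝ] W) (e : Fin 7 → W) : Prop where
  finrank : Module.finrank ℝ W = 7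
  symm : ∀ x y, g x y = g y x
  frame : IsCayleyFrame (fun x y => g x y) (fun x y z => φ x y z) e
  cross : ∀ x y z, g (P x y) z = φ x y z

variable {g : W →ₗ[ℝ] W →ₗ[ℝ] ℝ} {φ : W →ₗ[ℝ] W →ₗ[ℝ] W →ₗ[ℝ] ℝ}
    {P : W →ₗ[ℝ] W →ₗ[ℝ] W} {e : Fin 7 → W}

/-- The components of the cross product of two vectors of `ℝ⁷`. -/
def crossComp (x y : Fin 7 → ℝ) (k : Fin 7) : ℝ :=
  (x (k + 4) * y (k + 5) - x (k + 5) * y (k + 4))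
    + (x (k + 1) * y (k + 3) - x (k + 3) * y (k + 1))
    + (x (k + 2) * y (k + 6) - x (k + 6) * y (k + 2))

theorem cayleyThree_eq (g : W →ₗ[ℝ] W →ₗ[ℝ] ℝ) (e : Fin 7 → W) (x y z : W) :
    cayleyThree (fun x y => g x y) e x y z =
    ∑ k, crossComp (fun i => g (e i) x) (fun i => g (e i) y) k * g (e k) z := by
  simp only [cayleyThree, wedge, Matrix.det_fin_three, Fin.sum_univ_seven, crossComp]
  simp
  ring

omit [AddCommGroup W] [Module ℝ W] in
theorem wedge_four (a b c d : W → ℝ) (x y z u : W) : wedge ![a, b, c, d] ![x, y, z, u] =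
    (a x * b y - a y * b x) * (c z * d u - c u * d z)
    - (a x * b z - a z * b x) * (c y * d u - c u * d y)
    + (a x * b u - a u * b x) * (c y * d z - c z * d y)
    + (a y * b z - a z * b y) * (c x * d u - c u * d x)
    - (a y * b u - a u * b y) * (c x * d z - c z * d x)
    + (a z * b u - a u * b z) * (c x * d y - c y * d x) := by
  unfold wedge
  rw [Matrix.det_succ_row_zero, Fin.sum_univ_four]
  simp only [Matrix.det_fin_three, Matrix.submatrix_apply, Matrix.of_apply]
  simp [Fin.succAbove]
  ring

/-- A polynomial identity in the coordinates. It trades the four-form for the cross product and the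
metric, so that no further computation with *φ in components is needed. -/
theorem cayleyFour_eq (g : W →ₗ[ℝ] W →ₗ[ℝ] ℝ) (e : Fin 7 → W) (x y z u : W) :
    cayleyFour (fun x y => g x y) e x y z u =
    -(∑ k, crossComp (fun i => g (e i) x) (fun i => g (e i) y) k *
        crossComp (fun i => g (e i) z) (fun i => g (e i) u) k)
      + (∑ k, g (e k) x * g (e k) z) * (∑ k, g (e k) y * g (e k) u)
      - (∑ k, g (e k) x * g (e k) u) * (∑ k, g (e k) y * g (e k) z) := by
  simp only [cayleyFour, wedge_four, Fin.sum_univ_seven, crossComp, Fin.reduceAdd, zero_add]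
  ring

/-- The identity |x × y|² = |x|²|y|² - ⟨x, y⟩², polarised in `y`. -/
theorem crossComp_sum_sq (x y z : Fin 7 → ℝ) : ∑ k, crossComp x y k * crossComp x z k =
    (∑ k, x k * x k) * (∑ k, y k * z k) - (∑ k, x k * y k) * (∑ k, x k * z k) := by
  simp only [Fin.sum_univ_seven, crossComp]
  simp
  ring


theorem phi_eq (hC : CayleySpace g φ P e) (x y z : W) : φ x y z =
    ∑ k, crossComp (fun i => g (e i) x) (fun i => g (e i) y) k * g (e k) z :=
  (hC.frame.2 x y z).trans (cayleyThree_eq g e x y z)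

theorem metric_frame (hC : CayleySpace g φ P e) (i j : Fin 7) : g (e i) (e j) = (kd i j : ℝ) := by
  refine (hC.frame.1 i j).trans ?_
  simp [kd]

theorem cross_component (hC : CayleySpace g φ P e) (x y : W) (k : Fin 7) :
    g (e k) (P x y) = crossComp (fun i => g (e i) x) (fun i => g (e i) y) k := by
  rw [hC.symm, hC.cross, phi_eq hC]
  simp [metric_frame hC, kd]

theorem metric_components (hC : CayleySpace g φ P e) (x y : W) :
    g x y = ∑ i, g (e i) x * g (e i) y := metric_expand hC.finrank hC.frame.1 x y

theorem metric_cross_cross (hC : CayleySpace g φ P e) (x y z : W) :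
    g (P x y) (P x z) = g x x * g y z - g x y * g x z := by
  rw [metric_components hC (P x y)]
  simp only [cross_component hC]
  rw [crossComp_sum_sq, ← metric_components hC, ← metric_components hC, ← metric_components hC,
    ← metric_components hC]

theorem phi_swap₁ (hC : CayleySpace g φ P e) (x y z : W) : φ x y z = -φ y x z := by
  rw [phi_eq hC, phi_eq hC, ← Finset.sum_neg_distrib]
  refine Finset.sum_congr rfl fun k _ => ?_
  simp only [crossComp]
  ring

theorem phi_swap₂ (hC : CayleySpace g φ P e) (x y z : W) : φ x y z = -φ x z y := by
  rw [phi_eq hC, phi_eq hC]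
  simp only [Fin.sum_univ_seven, crossComp, Fin.reduceAdd, zero_add]
  ring

theorem phi_self₁ (hC : CayleySpace g φ P e) (x y : W) : φ x x y = 0 := by
  linarith [phi_swap₁ hC x x y]

theorem phi_self₂ (hC : CayleySpace g φ P e) (x y : W) : φ x y y = 0 := by
  linarith [phi_swap₂ hC x y y]

theorem metric_pos (hC : CayleySpace g φ P e) {x : W} (hx : x ≠ 0) : 0 < g x x := by
  rw [metric_components hC]
  refine lt_of_le_of_ne (Finset.sum_nonneg fun i _ => mul_self_nonneg _) fun h => hx ?_
  rw [eq_comm, Finset.sum_eq_zero_iff_of_nonneg fun i _ => mul_self_nonneg _] at h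
  rw [orthonormal_expand hC.finrank hC.frame.1 x]
  exact Finset.sum_eq_zero fun i hi => by rw [mul_self_eq_zero.1 (h i hi), zero_smul]

theorem eq_of_metric (hC : CayleySpace g φ P e) {x y : W} (h : ∀ z, g x z = g y z) : x = y :=
  eq_of_posDef g (fun _ => metric_pos hC) h

theorem cross_swap (hC : CayleySpace g φ P e) (x y : W) : P x y = -P y x := by
  refine eq_of_metric hC fun z => ?_
  rw [map_neg, LinearMap.neg_apply, hC.cross, hC.cross, phi_swap₁ hC]

theorem cross_cross (hC : CayleySpace g φ P e) (x y : W) :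
    P x (P x y) = g x y • x - g x x • y := by
  refine eq_of_metric hC fun z => ?_
  rw [hC.cross, phi_swap₂ hC, ← hC.cross, metric_cross_cross hC, map_sub, LinearMap.sub_apply,
    map_smul, map_smul, LinearMap.smul_apply, LinearMap.smul_apply, hC.symm z y]
  simp only [smul_eq_mul]
  ring

/-- Polarisation in the repeated argument. On mutually orthogonal vectors it says that the operators
P(x, ·) and P(y, ·) anticommute, which drives the construction of adapted frames. -/
theorem cross_cross_polar (hC : CayleySpace g φ P e) (x y z : W) :
    P x (P y z) + P y (P x z) = g x z • y + g y z • x - (2 * g x y) • z := by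
  have h := cross_cross hC (x + y) z
  simp only [map_add, LinearMap.add_apply, cross_cross hC, hC.symm y x] at h
  have h' : P x (P y z) + P y (P x z) = (g x z • x - g x x • z + P y (P x z) +
      (P x (P y z) + (g y z • y - g y y • z))) - (g x z • x - g x x • z)
      - (g y z • y - g y y • z) := by abel
  rw [h', h]
  module

/-- The right-hand side involves only the metric and the cross product, so the four-form does not
depend on the Cayley frame used to define it. -/
theorem star_eq (hC : CayleySpace g φ P e) (x y z u : W) :
    cayleyFour (fun x y => g x y) e x y z u =
    -g (P x y) (P z u) + g x z * g y u - g x u * g y z := by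
  rw [cayleyFour_eq, metric_components hC (P x y)]
  simp only [cross_component hC]
  rw [← metric_components hC, ← metric_components hC, ← metric_components hC,
    ← metric_components hC]

/-- The contraction of the four-form with `n` in terms of the cross product, on `n^⊥`. -/
theorem star_perp (hC : CayleySpace g φ P e) {n y z u : W} (hz : g n z = 0) (hu : g n u = 0) :
    cayleyFour (fun x y => g x y) e n y z u = -φ (P n y) z u := by
  rw [star_eq hC, hz, hu, hC.symm, hC.cross]
  have h1 := phi_swap₁ hC (P n y) z u
  have h2 := phi_swap₂ hC z (P n y) u
  linarith

theorem phi_frame (hC : CayleySpace g φ P e) (i j k : Fin 7) :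
    φ (e i) (e j) (e k) = (phiT i j k : ℝ) := by
  have kd_comm : ∀ i j, kd i j = kd j i := fun i j => by simp only [kd, eq_comm]
  rw [← hC.cross, hC.symm, cross_component hC, phiT_eq]
  simp only [metric_frame hC, crossComp]
  push_cast
  simp only [kd_comm i, kd_comm j]

theorem star_frame (hC : CayleySpace g φ P e) (l i j k : Fin 7) :
    cayleyFour (fun x y => g x y) e (e l) (e i) (e j) (e k) = (starT l i j k : ℝ) := by
  have h : ∀ m x y, g (e m) (P x y) = φ x y (e m) := fun m x y => by rw [hC.symm, hC.cross]
  rw [star_eq hC, starT_eq, metric_components hC]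
  simp only [h, phi_frame hC, metric_frame hC]
  push_cast
  rfl

theorem exists_trilinear {V : Type*} [AddCommGroup V] [Module ℝ V] {f : V → V → V → ℝ}
    (a₁ : ∀ x x' y z, f (x + x') y z = f x y z + f x' y z)
    (s₁ : ∀ (c : ℝ) x y z, f (c • x) y z = c * f x y z)
    (a₂ : ∀ x y y' z, f x (y + y') z = f x y z + f x y' z)
    (s₂ : ∀ (c : ℝ) x y z, f x (c • y) z = c * f x y z)
    (a₃ : ∀ x y z z', f x y (z + z') = f x y z + f x y z')
    (s₃ : ∀ (c : ℝ) x y z, f x y (c • z) = c * f x y z) :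
    ∃ L : V →ₗ[ℝ] V →ₗ[ℝ] V →ₗ[ℝ] ℝ, ∀ x y z, L x y z = f x y z := by
  refine ⟨LinearMap.mk₂ ℝ (fun x y => (⟨⟨f x y, a₃ x y⟩, fun c z => s₃ c x y z⟩ : V →ₗ[ℝ] ℝ))
    ?_ ?_ ?_ ?_, fun x y z => rfl⟩
  · exact fun x x' y => LinearMap.ext fun z => a₁ x x' y z
  · exact fun c x y => LinearMap.ext fun z => s₁ c x y z
  · exact fun x y y' => LinearMap.ext fun z => a₂ x y y' z
  · exact fun c x y => LinearMap.ext fun z => s₂ c x y z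

theorem exists_star (hC : CayleySpace g φ P e) (x : W) :
    ∃ L : W →ₗ[ℝ] W →ₗ[ℝ] W →ₗ[ℝ] ℝ, ∀ y z u, L y z u =
      cayleyFour (fun x y => g x y) e x y z u := by
  refine exists_trilinear ?_ ?_ ?_ ?_ ?_ ?_ <;> intros <;>
    simp only [star_eq hC, map_add, map_smul, LinearMap.add_apply, LinearMap.smul_apply,
      smul_eq_mul] <;> ring

theorem trilinear_expand {T : W →ₗ[ℝ] W →ₗ[ℝ] W →ₗ[ℝ] ℝ} (hC : CayleySpace g φ P e)
    (x y z : W) : T x y z = ∑ i, ∑ j, ∑ k, g (e i) x * g (e j) y * g (e k) z *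
      T (e i) (e j) (e k) := by
  conv_lhs => rw [orthonormal_expand hC.finrank hC.frame.1 x,
    orthonormal_expand hC.finrank hC.frame.1 y, orthonormal_expand hC.finrank hC.frame.1 z]
  simp only [map_sum, map_smul, LinearMap.sum_apply, LinearMap.smul_apply, smul_eq_mul,
    Finset.mul_sum]
  rw [Finset.sum_congr rfl fun i _ => Finset.sum_comm, Finset.sum_comm]
  rw [Finset.sum_congr rfl fun i _ => Finset.sum_congr rfl fun j _ => rfl]
  rw [Finset.sum_congr rfl fun i _ => Finset.sum_comm]
  refine Finset.sum_congr rfl fun i _ => Finset.sum_congr rfl fun j _ =>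
    Finset.sum_congr rfl fun k _ => ?_
  ring

theorem trilinear_ext (hC : CayleySpace g φ P e) {T T' : W →ₗ[ℝ] W →ₗ[ℝ] W →ₗ[ℝ] ℝ}
    (h : ∀ i j k, T (e i) (e j) (e k) = T' (e i) (e j) (e k)) (x y z : W) :
    T x y z = T' x y z := by
  rw [trilinear_expand hC, trilinear_expand hC]
  simp only [h]

/-- A three-form on which the cross product acts as on the covariant derivative of `φ` is of the
form `ρ ⌟ *φ`, and `ρ` is found by contraction with `*φ`. -/
theorem derivation_form (hC : CayleySpace g φ P e) (X : W →ₗ[ℝ] W →ₗ[ℝ] W →ₗ[ℝ] ℝ)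
    (h₁ : ∀ x y z, X x y z = -X y x z) (h₂ : ∀ x y z, X x y z = -X x z y)
    (h : ∀ x y z, X x y (P x z) + X x z (P x y) = 0) {f : Fin 7 → W}
    (hf : IsOrthonormal (fun x y => g x y) f) (x y z : W) :
    X x y z = ∑ l, 1 / 4 * inner3 f (fun x y z => X x y z)
      (cayleyFour (fun x y => g x y) e (e l)) * cayleyFour (fun x y => g x y) e (e l) x y z := by
  -- The cross product of frame vectors is expanded by the structure constants; this turns the
  -- hypothesis on `X` into the one on components.
  have hP : ∀ a b, P (e a) (e b) = ∑ k, (phiT a b k : ℝ) • e k := fun a b => by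
    refine (orthonormal_expand hC.finrank hC.frame.1 (P (e a) (e b))).trans ?_
    refine Finset.sum_congr rfl fun k _ => ?_
    rw [hC.symm, hC.cross, phi_frame hC]
  obtain ⟨c, hX⟩ : ∃ c : Fin 7 → ℝ, ∀ i j k, X (e i) (e j) (e k) = ∑ l, c l *
      (starT l i j k : ℝ) := by
    refine ⟨_, starT_expand_of_derivation (X := fun i j k => X (e i) (e j) (e k))
      (fun i j k => h₁ _ _ _) (fun i j k => h₂ _ _ _) fun a b c => ?_⟩
    have := h (e a) (e b) (e c)
    rw [hP, hP] at this
    simpa [mul_comm] using this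
  choose St hSt using exists_star hC
  -- Contraction with `e_l ⌟ *φ` isolates the coefficient `c l`, since these forms are orthogonal of
  -- squared norm 4. The frame `f` is first exchanged for `e`.
  have hin : ∀ l, 1 / 4 * inner3 f (fun x y z => X x y z)
      (cayleyFour (fun x y => g x y) e (e l)) = c l := by
    intro l
    have h3 : cayleyFour (fun x y => g x y) e (e l) = fun y z u => St (e l) y z u :=
      funext fun y => funext fun z => funext fun u => (hSt _ _ _ _).symm
    rw [h3, inner3_eq hC.finrank hf hC.frame.1]
    unfold inner3
    simp only [hSt, star_frame hC, hX]
    have h4 : ∀ i j k : Fin 7, (∑ m, c m *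
        (starT m i j k : ℝ)) * (starT l i j k : ℝ) =
        ∑ m, c m * ((starT m i j k * starT l i j k : ℤ) : ℝ) :=
      fun i j k => by
        rw [Finset.sum_mul]
        exact Finset.sum_congr rfl fun m _ => by push_cast; ring
    simp only [h4]
    have h5 : ∀ F : Fin 7 → Fin 7 → Fin 7 → Fin 7 → ℝ, ∑ i, ∑ j, ∑ k, ∑ m, F i j k m =
        ∑ m, ∑ i, ∑ j, ∑ k, F i j k m := fun F => by
      rw [Finset.sum_congr rfl fun i _ => Finset.sum_congr rfl fun j _ => Finset.sum_comm,
        Finset.sum_congr rfl fun i _ => Finset.sum_comm, Finset.sum_comm]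
    rw [h5]
    simp only [← Finset.mul_sum, ← Int.cast_sum, starT_contract]
    simp
    ring
  simp only [hin]
  simp only [← hSt]
  have h6 := trilinear_ext hC (T := X)
    (T' := ∑ l, c l • St (e l)) (fun i j k => by
      rw [hX]
      simp [hSt, star_frame hC]) x y z
  rw [h6]
  simp

end Cayley

/-! ### Cayley frames adapted to a unit vector, and the torsion tensor -/

section Adapted

variable {W : Type*} [AddCommGroup W] [Module ℝ W] {g : W →ₗ[ℝ] W →ₗ[ℝ] ℝ}
  {φ : W →ₗ[ℝ] W →ₗ[ℝ] W →ₗ[ℝ] ℝ} {P : W →ₗ[ℝ] W →ₗ[ℝ] W} {e : Fin 7 → W}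

theorem exists_unit_perp (hC : CayleySpace g φ P e) {k : ℕ} (hk : k < 7) (v : Fin k → W) :
    ∃ u, g u u = 1 ∧ ∀ i, g (v i) u = 0 := by
  have : FiniteDimensional ℝ W := Module.finite_of_finrank_pos (by rw [hC.finrank]; norm_num)
  have hker := LinearMap.ker_ne_bot_of_finrank_lt (f := LinearMap.pi fun i => g (v i))
    (by rw [hC.finrank]; simpa using hk)
  obtain ⟨u, hu, hu0⟩ := Submodule.exists_mem_ne_zero_of_ne_bot hker
  have hpos := metric_pos hC hu0
  refine ⟨(Real.sqrt (g u u))⁻¹ • u, ?_, fun i => ?_⟩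
  · simp only [map_smul, LinearMap.smul_apply, smul_eq_mul]
    rw [← mul_assoc, ← mul_inv, Real.mul_self_sqrt hpos.le, inv_mul_cancel₀ hpos.ne']
  · have := congrFun (LinearMap.mem_ker.1 hu) i
    simp only [LinearMap.pi_apply, Pi.zero_apply] at this
    rw [map_smul, this, smul_zero]

/-- The seven lines e_i × e_{i+1} = e_{i+3} with their cyclic permutations, and skew-symmetry for
the reversed order, give the cross product of every pair. So φ has the standard components. -/
theorem isCayleyFrame_of_table (hC : CayleySpace g φ P e) {f : Fin 7 → W}
    (hf : IsOrthonormal (fun x y => g x y) f)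
    (h : ∀ i, P (f i) (f (i + 1)) = f (i + 3) ∧ P (f (i + 1)) (f (i + 3)) = f i ∧
      P (f (i + 3)) (f i) = f (i + 1)) : CayleySpace g φ P f := by
  have hg : ∀ i j, g (f i) (f j) = (kd i j : ℝ) := fun i j => (hf i j).trans (by simp [kd])
  have hself : ∀ x, P x x = 0 := fun x => by
    refine eq_of_metric hC fun z => ?_
    rw [hC.cross, phi_self₁ hC, map_zero, LinearMap.zero_apply]
  refine ⟨hC.finrank, hC.symm, ⟨hf, fun x y z => ?_⟩, hC.cross⟩
  rw [cayleyThree_eq]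
  change φ x y z = _
  rw [← hC.cross, metric_expand hC.finrank hf]
  refine Finset.sum_congr rfl fun k _ => ?_
  congr 1
  conv_lhs => rw [orthonormal_expand hC.finrank hf x, orthonormal_expand hC.finrank hf y]
  have h0 := h 0
  have h1 := h 1
  have h2 := h 2
  have h3 := h 3
  have h4 := h 4
  have h5 := h 5
  have h6 := h 6
  simp only [Fin.reduceAdd, zero_add] at h0 h1 h2 h3 h4 h5 h6
  have s := fun i j => cross_swap hC (f i) (f j)
  have t : P (f 1) (f 0) = -f 3 ∧ P (f 2) (f 0) = -f 6 ∧ P (f 4) (f 0) = -f 5 ∧ 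
      P (f 0) (f 3) = -f 1 ∧ P (f 0) (f 6) = - f 2 ∧ P (f 0) (f 5) = - f 4 ∧ 
      P (f 2) (f 1) = - f 4 ∧ P (f 3) (f 1) = - f 0 ∧ P (f 1) (f 4) = - f 2 ∧ 
      P (f 1) (f 6) = - f 5 ∧ P (f 5) (f 1) = - f 6 ∧ P (f 3) (f 2) = - f 5 ∧ 
      P (f 4) (f 2) = - f 1 ∧ P (f 2) (f 5) = - f 3 ∧ P (f 6) (f 2) = - f 0 ∧ P (f 4) (f 3) = - f 6 ∧ 
      P (f 5) (f 3) = - f 2 ∧ P (f 3) (f 6) = - f 4 ∧ P (f 5) (f 4) = - f 0 ∧ P (f 6) (f 4) = - f 3 ∧ 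
      P (f 6) (f 5) = - f 1 := by
    refine ⟨?_, ?_, ?_, ?_, ?_, ?_, ?_, ?_, ?_, ?_, ?_, ?_, ?_, ?_, ?_, ?_, ?_, ?_, ?_, ?_, ?_⟩ <;>
      rw [s] <;> simp only [h0, h1, h2, h3, h4, h5, h6]
  obtain ⟨t1, t2, t3, t4, t5, t6, t7, t8, t9, t10, t11, t12, t13, t14, t15, t16, t17, t18, t19, t20,
    t21⟩ := t
  simp only [Fin.sum_univ_seven, map_add, map_smul, LinearMap.add_apply, LinearMap.smul_apply, h0,
    h1, h2, h3, h4, h5, h6, hself, hg, t1, t2, t3, t4, t5, t6, t7, t8, t9, t10, t11, t12, t13,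
    t14, t15, t16, t17, t18, t19, t20, t21, map_neg, smul_eq_mul, crossComp]
  fin_cases k <;> simp [kd] <;> ring

/-- Every unit vector is the first vector of a Cayley frame. -/
theorem exists_adapted_frame (hC : CayleySpace g φ P e) {n : W} (hn : g n n = 1) :
    ∃ f : Fin 7 → W, CayleySpace g φ P f ∧ f 0 = n := by
  obtain ⟨a, ha, ha'⟩ := exists_unit_perp hC (by norm_num : 1 < 7) ![n]
  -- Besides `n` and `a`, the vector `b` has to avoid their product; orthogonality to all three
  -- makes the products below anticommute as in the octonions.
  obtain ⟨b, hb, hb'⟩ := exists_unit_perp hC (by norm_num : 3 < 7) ![n, a, P n a]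
  have hna : g n a = 0 := ha' 0
  have hnb : g n b = 0 := hb' 0
  have hab : g a b = 0 := hb' 1
  have hcb : g (P n a) b = 0 := hb' 2
  have han := (hC.symm a n).trans hna
  have hbn := (hC.symm b n).trans hnb
  have hba := (hC.symm b a).trans hab
  have s := cross_swap hC
  have cyc : ∀ x y, g x x = 1 → g y y = 1 → g x y = 0 →
      P y (P x y) = x ∧ P (P x y) x = y ∧ g (P x y) (P x y) = 1 := fun x y hx hy hxy => by
    have hyx := (hC.symm y x).trans hxy
    refine ⟨?_, ?_, ?_⟩
    · rw [s x y, map_neg, cross_cross hC, hy, hyx]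
      simp
    · rw [s, cross_cross hC, hx, hxy]
      simp
    · rw [metric_cross_cross hC, hx, hy, hxy]
      simp
  have swap : ∀ x y z, g x y = 0 → g x z = 0 → g y z = 0 → P x (P y z) = -P y (P x z) :=
    fun x y z h1 h2 h3 => by
      have := cross_cross_polar hC x y z
      rw [h1, h2, h3] at this
      simp only [zero_smul, mul_zero, add_zero, sub_zero] at this
      exact eq_neg_of_add_eq_zero_left this
  have perp : ∀ x y, g (P x y) x = 0 ∧ g (P x y) y = 0 := fun x y => by
    rw [hC.cross, hC.cross, phi_self₂ hC, phi_swap₂ hC, phi_self₁ hC]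
    simp
  obtain ⟨c1, c2, c3⟩ := cyc n a hn ha hna
  obtain ⟨d1, d2, d3⟩ := cyc a b ha hb hab
  obtain ⟨z1, z2, z3⟩ := cyc n b hn hb hnb
  have hbc := (hC.symm b _).trans hcb
  obtain ⟨w1, w2, w3⟩ := cyc b (P n a) hb c3 hbc
  have hac := (hC.symm a _).trans (perp n a).2
  have e1 : P a (P b (P n a)) = P n b := by
    rw [swap _ _ _ hab hac hbc, c1, s b n, neg_neg]
  have e2 : P (P n a) (P a b) = P n b := by
    rw [swap _ _ _ (perp n a).2 hcb hab, s (P n a) b, map_neg, neg_neg, e1]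
  have hdb := (perp a b).2
  have hdc : g (P a b) (P n a) = 0 := by
    rw [s n a, map_neg, metric_cross_cross hC, hab, hbn]
    simp
  have e3 : P (P a b) (P b (P n a)) = n := by
    rw [swap _ _ _ hdb hdc hbc, s (P a b) (P n a), map_neg, neg_neg, e2, z1]
  obtain ⟨u1, u2, -⟩ := cyc (P n a) (P a b) c3 d3 ((hC.symm _ _).trans hdc)
  have hdw : g (P a b) (P b (P n a)) = 0 := by
    rw [s a b, map_neg, LinearMap.neg_apply, metric_cross_cross hC, hac, hba]
    simp
  obtain ⟨v1, v2, -⟩ := cyc (P a b) (P b (P n a)) d3 w3 hdw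
  have haw : g a (P b (P n a)) = 0 := by
    rw [hC.symm, hC.cross, phi_swap₁ hC, phi_swap₂ hC, ← hC.cross, s _ a, c1, map_neg,
      LinearMap.neg_apply, hnb]
    simp
  obtain ⟨t1, t2, -⟩ := cyc a (P b (P n a)) ha w3 haw
  rw [e1] at t1 t2
  rw [e2] at u1 u2
  rw [e3] at v1 v2
  -- The order is forced: after the first three vectors, the entry i + 3 is the product of the
  -- entries i and i + 1.
  refine ⟨![n, a, b, P n a, P a b, P b (P n a), P n b], ?_, rfl⟩
  have h : ∀ i, P (![n, a, b, P n a, P a b, P b (P n a), P n b] i)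
      (![n, a, b, P n a, P a b, P b (P n a), P n b] (i + 1)) =
        ![n, a, b, P n a, P a b, P b (P n a), P n b] (i + 3) ∧
      P (![n, a, b, P n a, P a b, P b (P n a), P n b] (i + 1))
        (![n, a, b, P n a, P a b, P b (P n a), P n b] (i + 3)) =
        ![n, a, b, P n a, P a b, P b (P n a), P n b] i ∧
      P (![n, a, b, P n a, P a b, P b (P n a), P n b] (i + 3))
        (![n, a, b, P n a, P a b, P b (P n a), P n b] i) =
        ![n, a, b, P n a, P a b, P b (P n a), P n b] (i + 1) := by
    intro i
    fin_cases i
    · exact ⟨rfl, c1, c2⟩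
    · exact ⟨rfl, d1, d2⟩
    · exact ⟨rfl, w1, w2⟩
    · exact ⟨e2, u1, u2⟩
    · exact ⟨e3, v1, v2⟩
    · exact ⟨t1, t2, e1⟩
    · exact ⟨z2, rfl, z1⟩
  refine isCayleyFrame_of_table hC ?_ h
  have h012 : g (![n, a, b, P n a, P a b, P b (P n a), P n b] 0)
      (![n, a, b, P n a, P a b, P b (P n a), P n b] 0) = 1 ∧
      g (![n, a, b, P n a, P a b, P b (P n a), P n b] 1)
      (![n, a, b, P n a, P a b, P b (P n a), P n b] 1) = 1 ∧
      g (![n, a, b, P n a, P a b, P b (P n a), P n b] 2)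
      (![n, a, b, P n a, P a b, P b (P n a), P n b] 2) = 1 := ⟨hn, ha, hb⟩
  generalize ![n, a, b, P n a, P a b, P b (P n a), P n b] = f at h h012
  -- Any two indices differ by 1, 2 or 3 up to order, and in each case some line of the table makes
  -- one of the two vectors a product having the other as a factor.
  have h1 : ∀ i, g (f i) (f (i + 1)) = 0 := fun i => by rw [← (h i).2.1]; exact (perp _ _).1
  have h2 : ∀ i, g (f i) (f (i + 2)) = 0 := fun i => by
    have := (perp (f (i - 1)) (f (i - 1 + 1))).2
    rw [(h (i - 1)).1, hC.symm] at this
    rwa [(by decide : ∀ i : Fin 7, i - 1 + 1 = i) i, (by decide : ∀ i : Fin 7, i - 1 + 3 = i + 2) i] at this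
  have h3 : ∀ i, g (f i) (f (i + 3)) = 0 := fun i => by
    rw [hC.symm, ← (h i).1]; exact (perp _ _).1
  have hunit : ∀ i, g (f i) (f i) = 1 := by
    have step : ∀ i, g (f i) (f i) = 1 → g (f (i + 1)) (f (i + 1)) = 1 →
        g (f (i + 3)) (f (i + 3)) = 1 := fun i hi hj => by
      rw [← (h i).1, metric_cross_cross hC, hi, hj, h1]
      simp
    obtain ⟨g0, g1, g2⟩ := h012
    have g3 := step 0 g0 g1
    have g4 := step 1 g1 g2
    have g5 := step 2 g2 g3
    have g6 := step 3 g3 g4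
    intro i
    fin_cases i
    exacts [g0, g1, g2, g3, g4, g5, g6]
  intro i j
  change g (f i) (f j) = _
  by_cases hij : i = j
  · subst hij
    rw [if_pos rfl, hunit]
  rw [if_neg hij]
  obtain ⟨l, d, hd, hp⟩ := exists_shift_pair i j
  rcases hp with ⟨rfl, rfl⟩ | ⟨rfl, rfl⟩ <;> rcases hd with rfl | rfl | rfl | rfl <;>
    first
      | exact absurd (add_zero _).symm hij
      | exact absurd (add_zero _) hij
      | exact h1 _
      | exact h2 _
      | exact h3 _
      | exact (hC.symm _ _).trans (h1 _)
      | exact (hC.symm _ _).trans (h2 _)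
      | exact (hC.symm _ _).trans (h3 _)

/-- The torsion of an almost parallel `G₂`-structure at a point: `D v` is a three-form on which the
cross product acts as on `∇_v φ`, and the alternation of `D` vanishes. -/
structure IsTorsion (P : W →ₗ[ℝ] W →ₗ[ℝ] W) (D : W →ₗ[ℝ] W →ₗ[ℝ] W →ₗ[ℝ] W →ₗ[ℝ] ℝ) : Prop where
  swap₁ : ∀ v x y z, D v x y z = -D v y x z
  swap₂ : ∀ v x y z, D v x y z = -D v x z y
  derivation : ∀ v x y z, D v x y (P x z) + D v x z (P x y) = 0
  closed : ∀ x y z u, D x y z u - D y x z u + D z x y u - D u x y z = 0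

theorem star_eq_star {f : Fin 7 → W} (hC : CayleySpace g φ P e) (hf : CayleySpace g φ P f) :
    cayleyFour (fun x y => g x y) e = cayleyFour (fun x y => g x y) f := by
  funext x y z u
  rw [star_eq hC, star_eq hf]

/-- The expansion of a derivation-like three-form is applied to each `D v`; the closedness of `D` is
then the hypothesis of `torsion_of_closed`, whose skew-symmetry extends from the frame by
bilinearity. The frame `f` of the inner product is kept apart from the Cayley frame `e` because r(φ)
is computed in an unrelated orthonormal basis. -/
theorem torsion_tensor {D : W →ₗ[ℝ] W →ₗ[ℝ] W →ₗ[ℝ] W →ₗ[ℝ] ℝ} (hC : CayleySpace g φ P e)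
    (hD : IsTorsion P D) {f : Fin 7 → W} (hf : IsOrthonormal (fun x y => g x y) f) :
    ∃ r : W →ₗ[ℝ] W →ₗ[ℝ] ℝ,
      (∀ x y, r x y = 1 / 4 * inner3 f (fun y z u => D x y z u)
        (cayleyFour (fun x y => g x y) e y)) ∧
      (∀ x y, r x y = -r y x) ∧
      (∀ x y z u, D x y z u = ∑ l, r x (e l) * cayleyFour (fun x y => g x y) e (e l) y z u) ∧
      ∀ i, ∑ j, ∑ k, (phiT i j k : ℝ) * r (e j) (e k) = 0 := by
  have hadd : ∀ x y, cayleyFour (fun x y => g x y) e (x + y) = fun z u v =>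
      cayleyFour (fun x y => g x y) e x z u v + cayleyFour (fun x y => g x y) e y z u v := by
    intro x y
    funext z u v
    simp only [star_eq hC, map_add, LinearMap.add_apply]
    ring
  have hsmul : ∀ (c : ℝ) x, cayleyFour (fun x y => g x y) e (c • x) = fun z u v =>
      c * cayleyFour (fun x y => g x y) e x z u v := by
    intro c x
    funext z u v
    simp only [star_eq hC, map_smul, LinearMap.smul_apply, smul_eq_mul]
    ring
  set r : W →ₗ[ℝ] W →ₗ[ℝ] ℝ := LinearMap.mk₂ ℝ (fun x y => 1 / 4 * inner3 f
      (fun y z u => D x y z u) (cayleyFour (fun x y => g x y) e y))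
    (fun x x' y => by
      simp only [inner3, map_add, LinearMap.add_apply, add_mul, Finset.sum_add_distrib, mul_add])
    (fun c x y => by
      simp only [inner3, map_smul, LinearMap.smul_apply, smul_eq_mul, Finset.mul_sum]
      refine Finset.sum_congr rfl fun i _ => Finset.sum_congr rfl fun j _ =>
        Finset.sum_congr rfl fun k _ => ?_
      ring)
    (fun x y y' => by
      rw [hadd]
      simp only [inner3, mul_add, Finset.sum_add_distrib])
    (fun c x y => by
      rw [hsmul]
      simp only [inner3, smul_eq_mul, Finset.mul_sum]
      refine Finset.sum_congr rfl fun i _ => Finset.sum_congr rfl fun j _ =>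
        Finset.sum_congr rfl fun k _ => ?_
      ring) with hr
  have hexp : ∀ x y z u, D x y z u =
      ∑ l, r x (e l) * cayleyFour (fun x y => g x y) e (e l) y z u := fun x y z u =>
    derivation_form hC (D x) (hD.swap₁ x) (hD.swap₂ x) (hD.derivation x) hf y z u
  obtain ⟨h1, h2⟩ := torsion_of_closed (r := fun i j => r (e i) (e j)) (fun a b c d => by
    have := hD.closed (e a) (e b) (e c) (e d)
    simp only [hexp, star_frame hC] at this
    exact this)
  refine ⟨r, fun x y => rfl, fun x y => ?_, hexp, h2⟩


  have hxy : ∀ (r : W →ₗ[ℝ] W →ₗ[ℝ] ℝ) x y, r x y =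
      ∑ i, ∑ j, g (e i) x * g (e j) y * r (e i) (e j) := fun r x y => by
    conv_lhs => rw [orthonormal_expand hC.finrank hC.frame.1 x,
      orthonormal_expand hC.finrank hC.frame.1 y]
    simp only [map_sum, map_smul, LinearMap.sum_apply, LinearMap.smul_apply, smul_eq_mul,
      Finset.mul_sum]
    rw [Finset.sum_comm]
    refine Finset.sum_congr rfl fun i _ => Finset.sum_congr rfl fun j _ => ?_
    ring
  rw [hxy r x y, hxy r y x, Finset.sum_comm, ← Finset.sum_neg_distrib]
  refine Finset.sum_congr rfl fun i _ => ?_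
  rw [← Finset.sum_neg_distrib]
  refine Finset.sum_congr rfl fun j _ => ?_
  linear_combination g (e j) x * g (e i) y * h1 j i

end Adapted

/-! ### Multilinearity of the covariant derivative of a three-tensor -/

section Nabla3

variable {m : ℕ} {N : Type*} [TopologicalSpace N] [ChartedSpace (EuclideanSpace ℝ (Fin m)) N]
  [IsManifold (𝓡 m) ∞ N]

theorem exists_derivComponents₃
    (T : ∀ q : N, TangentSpace (𝓡 m) q →ₗ[ℝ] TangentSpace (𝓡 m) q →ₗ[ℝ]
      TangentSpace (𝓡 m) q →ₗ[ℝ] ℝ) (p : N)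
    (hT : ∀ u v w : TangentSpace (𝓡 m) p, MDifferentiableAt (𝓡 m) 𝓘(ℝ, ℝ)
      (fun q => T q (coordField u q) (coordField v q) (coordField w q)) p) :
    ∃ D : TangentSpace (𝓡 m) p →ₗ[ℝ] TangentSpace (𝓡 m) p →ₗ[ℝ] TangentSpace (𝓡 m) p →ₗ[ℝ]
        TangentSpace (𝓡 m) p →ₗ[ℝ] ℝ,
      ∀ x y z u, D x y z u = mvfderiv (𝓡 m)
        (fun q => T q (coordField y q) (coordField z q) (coordField u q)) p x := by
  choose D hD using fun u => exists_derivComponents (fun q => T q (coordField u q)) p (hT u)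
  refine ⟨LinearMap.mk₂ ℝ (fun x u => D u x) (fun x x' u => map_add _ _ _)
    (fun c x u => map_smul _ _ _) (fun x u u' => ?_) (fun c x u => ?_), fun x y z u => hD _ _ _ _⟩
  · refine LinearMap.ext fun y => LinearMap.ext fun z => ?_
    rw [LinearMap.add_apply, LinearMap.add_apply, hD, hD, hD]
    rw [← add_apply, ← mvfderiv_fun_add (hT u y z) (hT u' y z)]
    refine congrArg (fun F : TangentSpace (𝓡 m) p →L[ℝ] ℝ => F x) (mvfderiv_congr ?_)
    filter_upwards [coordField_add u u'] with q hq
    simp [hq]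
  · refine LinearMap.ext fun y => LinearMap.ext fun z => ?_
    rw [LinearMap.smul_apply, LinearMap.smul_apply, hD, hD]
    have := mvfderiv_clm (k := m) (c • ContinuousLinearMap.id ℝ ℝ) (hT u y z) x
    simp only [smul_apply, ContinuousLinearMap.id_apply] at this ⊢
    rw [← this]
    refine congrArg (fun F : TangentSpace (𝓡 m) p →L[ℝ] ℝ => F x) (mvfderiv_congr ?_)
    filter_upwards [coordField_smul c u] with q hq
    simp [hq]

theorem exists_nabla3 {L : ∀ q : N, TangentSpace (𝓡 m) q →ₗ[ℝ] TangentSpace (𝓡 m) q →ₗ[ℝ] ℝ}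
    (hL : IsMetricField L)
    (T : ∀ q : N, TangentSpace (𝓡 m) q →ₗ[ℝ] TangentSpace (𝓡 m) q →ₗ[ℝ]
      TangentSpace (𝓡 m) q →ₗ[ℝ] ℝ) (p : N)
    (hT : ∀ u v w : TangentSpace (𝓡 m) p, MDifferentiableAt (𝓡 m) 𝓘(ℝ, ℝ)
      (fun q => T q (coordField u q) (coordField v q) (coordField w q)) p) :
    ∃ D : TangentSpace (𝓡 m) p →ₗ[ℝ] TangentSpace (𝓡 m) p →ₗ[ℝ] TangentSpace (𝓡 m) p →ₗ[ℝ]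
        TangentSpace (𝓡 m) p →ₗ[ℝ] ℝ,
      ∀ x y z u, D x y z u = nabla3 (fun q x y => L q x y) (fun q x y z => T q x y z) p x y z u := by
  obtain ⟨D, hD⟩ := exists_derivComponents₃ T p hT
  obtain ⟨C, hC⟩ := exists_christoffel hL p
  refine ⟨LinearMap.mk₂ ℝ (fun x y => D x y - T p (C x y) - (T p y).comp (C x) -
    (T p y).compl₂ (C x)) ?_ ?_ ?_ ?_, fun x y z u => ?_⟩
  · intro x x' y
    refine LinearMap.ext fun z => LinearMap.ext fun u => ?_
    simp
    ring
  · intro c x y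
    refine LinearMap.ext fun z => LinearMap.ext fun u => ?_
    simp
    ring
  · intro x y y'
    refine LinearMap.ext fun z => LinearMap.ext fun u => ?_
    simp
    ring
  · intro c x y
    refine LinearMap.ext fun z => LinearMap.ext fun u => ?_
    simp
    ring
  · simp only [LinearMap.mk₂_apply, LinearMap.sub_apply, LinearMap.comp_apply,
      LinearMap.compl₂_apply, hC, hD]
    rfl

end Nabla3

/-! ### The fields of a G₂-structure as multilinear maps, and their derivatives -/

namespace G2Structure

variable {N : Type*} [TopologicalSpace N] [ChartedSpace (EuclideanSpace ℝ (Fin 7)) N]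
  [IsManifold (𝓡 7) ∞ N] (S : G2Structure N)

/-- The metric as a field of bilinear maps. -/
def gL (p : N) : TangentSpace (𝓡 7) p →ₗ[ℝ] TangentSpace (𝓡 7) p →ₗ[ℝ] ℝ :=
  LinearMap.mk₂ ℝ (S.g p)
    (fun x x' y => by simp [g]) (fun c x y => by simp [g])
    (fun x y y' => by simp [g]) (fun c x y => by simp [g])

theorem isMetricField : IsMetricField S.gL where
  symm p x y := S.metric.symm p x y
  pos p x hx := S.metric.pos p x hx
  diff p y z := by
    have h := ContMDiffAt.clm_bundle_apply₂ (F₁ := EuclideanSpace ℝ (Fin 7))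
      (F₂ := EuclideanSpace ℝ (Fin 7)) (F₃ := ℝ) (E₃ := Bundle.Trivial N ℝ)
      (S.metric.contMDiff.contMDiffAt (x := p))
      (FiberBundle.contMDiffAt_extend (𝓡 7) (EuclideanSpace ℝ (Fin 7)) y)
      (FiberBundle.contMDiffAt_extend (𝓡 7) (EuclideanSpace ℝ (Fin 7)) z)
    have h2 := (Bundle.contMDiffAt_totalSpace.1 h).2
    exact h2.mdifferentiableAt (by simp)

omit [IsManifold (𝓡 7) ∞ N] in
theorem finrank_tangent (p : N) : Module.finrank ℝ (TangentSpace (𝓡 7) p) = 7 :=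
  finrank_euclideanSpace_fin

/-- The three-form is given as a bare function of three vectors; its multilinearity comes from the
Cayley frame alone. -/
theorem exists_form3 (p : N) : ∃ T : TangentSpace (𝓡 7) p →ₗ[ℝ] TangentSpace (𝓡 7) p →ₗ[ℝ]
    TangentSpace (𝓡 7) p →ₗ[ℝ] ℝ, ∀ x y z, T x y z = S.form3 p x y z := by
  obtain ⟨e, -, he⟩ := S.cayley p
  have h : ∀ x y z, S.form3 p x y z = _ := fun x y z =>
    (he x y z).trans (cayleyThree_eq (S.gL p) e x y z)
  refine exists_trilinear ?_ ?_ ?_ ?_ ?_ ?_ <;> intros <;>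
    simp only [h, map_add, map_smul, smul_eq_mul, mul_add, Finset.sum_add_distrib, Finset.mul_sum]
  · rw [← Finset.sum_add_distrib]
    refine Finset.sum_congr rfl fun k _ => ?_
    simp only [crossComp]
    ring
  · refine Finset.sum_congr rfl fun k _ => ?_
    simp only [crossComp]
    ring
  · rw [← Finset.sum_add_distrib]
    refine Finset.sum_congr rfl fun k _ => ?_
    simp only [crossComp]
    ring
  · refine Finset.sum_congr rfl fun k _ => ?_
    simp only [crossComp]
    ring
  · refine Finset.sum_congr rfl fun k _ => ?_
    ring

/-- The three-form as a field of trilinear maps. -/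
def phiL (p : N) : TangentSpace (𝓡 7) p →ₗ[ℝ] TangentSpace (𝓡 7) p →ₗ[ℝ]
    TangentSpace (𝓡 7) p →ₗ[ℝ] ℝ := (S.exists_form3 p).choose

theorem phiL_apply (p : N) (x y z : TangentSpace (𝓡 7) p) : S.phiL p x y z = S.form3 p x y z :=
  (S.exists_form3 p).choose_spec x y z

theorem form3_eq : S.form3 = fun q x y z => S.phiL q x y z :=
  funext fun q => funext fun x => funext fun y => funext fun z => (S.phiL_apply q x y z).symm

theorem phiL_diff (p : N) (u v w : TangentSpace (𝓡 7) p) : MDifferentiableAt (𝓡 7) 𝓘(ℝ, ℝ)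
    (fun q => S.phiL q (coordField u q) (coordField v q) (coordField w q)) p := by
  simp only [phiL_apply]
  exact (S.smooth_form3 p u v w).mdifferentiableAt (by simp)

theorem cross_spec (p : N) (x y z : TangentSpace (𝓡 7) p) :
    S.g p (S.cross p x y) z = S.form3 p x y z := by
  obtain ⟨w, hw⟩ := exists_dual_of_posDef (S.gL p) (S.isMetricField.pos p) (S.phiL p x y)
  exact Classical.epsilon_spec (p := fun w => ∀ z, S.g p w z = S.form3 p x y z)
    ⟨w, fun z => (hw z).trans (S.phiL_apply p x y z)⟩ z

theorem exists_cross (p : N) : ∃ P : TangentSpace (𝓡 7) p →ₗ[ℝ] TangentSpace (𝓡 7) p →ₗ[ℝ]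
    TangentSpace (𝓡 7) p, ∀ x y, P x y = S.cross p x y := by
  have h : ∀ x y z, S.gL p (S.cross p x y) z = S.phiL p x y z := fun x y z =>
    (S.cross_spec p x y z).trans (S.phiL_apply p x y z).symm
  have ext := fun {x y} => eq_of_posDef (S.gL p) (S.isMetricField.pos p) (v := x) (w := y)
  refine ⟨LinearMap.mk₂ ℝ (S.cross p) (fun x x' y => ext fun z => ?_)
    (fun c x y => ext fun z => ?_) (fun x y y' => ext fun z => ?_)
    (fun c x y => ext fun z => ?_), fun x y => rfl⟩ <;>
  simp only [h, map_add, map_smul, LinearMap.add_apply, LinearMap.smul_apply]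

/-- The cross product as a field of bilinear maps. -/
def crossL (p : N) : TangentSpace (𝓡 7) p →ₗ[ℝ] TangentSpace (𝓡 7) p →ₗ[ℝ]
    TangentSpace (𝓡 7) p := (S.exists_cross p).choose

theorem crossL_apply (p : N) (x y : TangentSpace (𝓡 7) p) : S.crossL p x y = S.cross p x y :=
  (S.exists_cross p).choose_spec x y

theorem crossL_spec (p : N) (x y z : TangentSpace (𝓡 7) p) :
    S.gL p (S.crossL p x y) z = S.phiL p x y z := by
  rw [crossL_apply, phiL_apply]
  exact S.cross_spec p x y z

theorem cayleySpace_iff {p : N} {e : Fin 7 → TangentSpace (𝓡 7) p} :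
    IsCayleyFrame (S.g p) (S.form3 p) e ↔ CayleySpace (S.gL p) (S.phiL p) (S.crossL p) e := by
  refine ⟨fun h => ⟨finrank_tangent p, S.isMetricField.symm p, ⟨h.1, fun x y z =>
    (S.phiL_apply p x y z).trans (h.2 x y z)⟩, S.crossL_spec p⟩, fun h => ⟨h.frame.1, fun x y z =>
    (S.phiL_apply p x y z).symm.trans (h.frame.2 x y z)⟩⟩

theorem exists_cayleySpace (p : N) :
    ∃ e, CayleySpace (S.gL p) (S.phiL p) (S.crossL p) e :=
  (S.cayley p).imp fun _ h => S.cayleySpace_iff.1 h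

theorem starPhi_eq {p : N} {e : Fin 7 → TangentSpace (𝓡 7) p}
    (hC : CayleySpace (S.gL p) (S.phiL p) (S.crossL p) e) :
    S.starPhi p = cayleyFour (fun x y => S.gL p x y) e := by
  have h : IsCayleyFrame (S.g p) (S.form3 p)
      (Classical.epsilon fun e => IsCayleyFrame (S.g p) (S.form3 p) e) :=
    Classical.epsilon_spec (S.cayley p)
  unfold starPhi
  generalize (Classical.epsilon fun e => IsCayleyFrame (S.g p) (S.form3 p) e) = f at h
  rw [star_eq_star hC (S.cayleySpace_iff.1 h)]
  rfl

section Along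

variable {k : ℕ} {M : Type*} [TopologicalSpace M] [ChartedSpace (EuclideanSpace ℝ (Fin k)) M]

theorem phi_along {f : M → N} {p : M} (hf : MDifferentiableAt (𝓡 k) (𝓡 7) f p)
    {a b c : ∀ q : M, TangentSpace (𝓡 7) (f q)} (ha : DiffAlong 7 k f a p)
    (hb : DiffAlong 7 k f b p) (hc : DiffAlong 7 k f c p) :
    MDifferentiableAt (𝓡 k) 𝓘(ℝ, ℝ) (fun q => S.phiL (f q) (a q) (b q) (c q)) p ∧
    ∀ x, mvfderiv (𝓡 k) (fun q => S.phiL (f q) (a q) (b q) (c q)) p x =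
      S.nablaPhi (f p) (mfderiv (𝓡 k) (𝓡 7) f p x) (a p) (b p) (c p)
      + S.phiL (f p) (nablaAlong S.g f a p x) (b p) (c p)
      + S.phiL (f p) (a p) (nablaAlong S.g f b p x) (c p)
      + S.phiL (f p) (a p) (b p) (nablaAlong S.g f c p x) := by
  have h := tensor3_along S.phiL (S.phiL_diff _) S.g hf ha hb hc
  rw [← form3_eq] at h
  exact h

/-- The cross product is defined by duality, so its differentiability is tested against coordinate
fields. The formula compares the two Leibniz rules for g(P(a, b), z) = φ(a, b, z), in which the
terms with the derivative of `z` cancel. -/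
theorem cross_along {f : M → N} {p : M} (hf : MDifferentiableAt (𝓡 k) (𝓡 7) f p)
    {a b : ∀ q : M, TangentSpace (𝓡 7) (f q)} (ha : DiffAlong 7 k f a p)
    (hb : DiffAlong 7 k f b p) :
    DiffAlong 7 k f (fun q => S.crossL (f q) (a q) (b q)) p ∧
    ∀ x z, S.gL (f p) (nablaAlong S.g f (fun q => S.crossL (f q) (a q) (b q)) p x) z =
      S.nablaPhi (f p) (mfderiv (𝓡 k) (𝓡 7) f p x) (a p) (b p) z
      + S.phiL (f p) (nablaAlong S.g f a p x) (b p) z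
      + S.phiL (f p) (a p) (nablaAlong S.g f b p x) z := by
  have hd : DiffAlong 7 k f (fun q => S.crossL (f q) (a q) (b q)) p := by
    refine diffAlong_of_inner S.isMetricField hf fun v => ?_
    simp only [crossL_spec]
    exact (S.phi_along hf ha hb (diffAlong_coordField hf.continuousAt v)).1
  refine ⟨hd, fun x z => ?_⟩
  have hz : DiffAlong 7 k f (fun q => coordField z (f q)) p := diffAlong_coordField hf.continuousAt z
  have h1 := (metric_along (k := k) S.isMetricField hf hd hz).2 x
  have h2 := (S.phi_along hf ha hb hz).2 x
  simp only [crossL_spec, coordField_self] at h1 h2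
  have h3 := h1.symm.trans h2
  have h4 : nablaAlong (k := k) S.g f = nablaAlong (fun q x y => S.gL q x y) f := rfl
  rw [← h4] at h3
  linarith

end Along

theorem exists_nablaPhi (p : N) : ∃ D : TangentSpace (𝓡 7) p →ₗ[ℝ] TangentSpace (𝓡 7) p →ₗ[ℝ]
    TangentSpace (𝓡 7) p →ₗ[ℝ] TangentSpace (𝓡 7) p →ₗ[ℝ] ℝ,
    ∀ x y z u, D x y z u = S.nablaPhi p x y z u := by
  obtain ⟨D, hD⟩ := exists_nabla3 S.isMetricField S.phiL p (S.phiL_diff p)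
  rw [← form3_eq] at hD
  exact ⟨D, hD⟩

/-- Covariant derivative of φ(x, y, P(x, z)) = ⟨x, x⟩⟨y, z⟩ - ⟨x, y⟩⟨x, z⟩. The right-hand side is
built from the parallel metric, so only the terms with ∇φ survive once the derivatives of the
arguments are removed. -/
theorem nablaPhi_derivation (p : N) (v x y z : TangentSpace (𝓡 7) p) :
    S.nablaPhi p v x y (S.crossL p x z) + S.nablaPhi p v x z (S.crossL p x y) = 0 := by
  obtain ⟨e, hC⟩ := S.exists_cayleySpace p
  -- The rules for fields along a map are used for the identity of the manifold.
  have hid : MDifferentiableAt (𝓡 7) (𝓡 7) (fun q : N => q) p := mdifferentiableAt_id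
  have hcf : ∀ w : TangentSpace (𝓡 7) p, DiffAlong 7 7 (fun q : N => q)
      (fun q => coordField w q) p := fun w => diffAlong_coordField continuousAt_id w
  have hxz := S.cross_along hid (hcf x) (hcf z)
  have h1 := (S.phi_along hid (hcf x) (hcf y) hxz.1).2 v
  have hid' : mfderiv (𝓡 7) (𝓡 7) (fun q : N => q) p v = v := by
    change mfderiv (𝓡 7) (𝓡 7) id p v = v
    rw [mfderiv_id]
    rfl
  have h2 := hxz.2 v (S.crossL p x y)
  have hm := fun a b => metric_along S.isMetricField hid (hcf a) (hcf b)
  have hfun : (fun q => S.phiL q (coordField x q) (coordField y q)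
      (S.crossL q (coordField x q) (coordField z q))) = fun q =>
      S.gL q (coordField x q) (coordField x q) * S.gL q (coordField y q) (coordField z q) -
      S.gL q (coordField x q) (coordField y q) * S.gL q (coordField x q) (coordField z q) := by
    funext q
    obtain ⟨f, hf⟩ := S.exists_cayleySpace q
    rw [← crossL_spec, metric_cross_cross hf]
  rw [hfun, mvfderiv_fun_sub (mdifferentiableAt_mul (hm x x).1 (hm y z).1)
    (mdifferentiableAt_mul (hm x y).1 (hm x z).1), sub_apply,
    mvfderiv_mul_apply (hm x x).1 (hm y z).1, mvfderiv_mul_apply (hm x y).1 (hm x z).1,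
    (hm x x).2, (hm x y).2, (hm x z).2, (hm y z).2] at h1
  simp only [coordField_self] at h1 h2
  have hg : nablaAlong (k := 7) (fun q x y => S.gL q x y) (fun q : N => q) =
    nablaAlong S.g (fun q : N => q) := rfl
  rw [hg] at h1
  generalize nablaAlong S.g (fun q : N => q) (fun q => coordField x q) p v = a at h1 h2
  generalize nablaAlong S.g (fun q : N => q) (fun q => coordField y q) p v = b at h1 h2
  generalize nablaAlong S.g (fun q : N => q) (fun q => coordField z q) p v = c at h1 h2
  rw [hid'] at h1 h2
  rw [← crossL_spec S p x y, S.isMetricField.symm p (S.crossL p x y), h2] at h1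
  simp only [← crossL_spec] at h1 ⊢
  -- The terms in which the derivative falls on an argument satisfy the same identity, polarised in
  -- the first slot for `x` and taken as it stands for `y` and `z`.
  have q1 := metric_cross_cross hC (a + x) y z
  have q2 := metric_cross_cross hC a y z
  have q3 := metric_cross_cross hC x y z
  have q4 := metric_cross_cross hC x b z
  have q5 := metric_cross_cross hC x c y
  have s := S.isMetricField.symm p
  simp only [map_add, LinearMap.add_apply] at q1
  rw [s (S.crossL p x y)] at q1
  rw [s x a] at *
  rw [s c y] at q5
  linarith

end G2Structure

/-! ### Symmetries of ∇φ and the torsion r(φ) -/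

namespace G2Structure

variable {N : Type*} [TopologicalSpace N] [ChartedSpace (EuclideanSpace ℝ (Fin 7)) N]
  [IsManifold (𝓡 7) ∞ N] (S : G2Structure N)

theorem form3_swap₁ (p : N) (x y z : TangentSpace (𝓡 7) p) :
    S.form3 p x y z = -S.form3 p y x z := by
  obtain ⟨e, hC⟩ := S.exists_cayleySpace p
  rw [← phiL_apply, ← phiL_apply, phi_swap₁ hC]

theorem form3_swap₂ (p : N) (x y z : TangentSpace (𝓡 7) p) :
    S.form3 p x y z = -S.form3 p x z y := by
  obtain ⟨e, hC⟩ := S.exists_cayleySpace p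
  rw [← phiL_apply, ← phiL_apply, phi_swap₂ hC]

theorem nablaPhi_swap₁ (p : N) (v x y z : TangentSpace (𝓡 7) p) :
    S.nablaPhi p v x y z = -S.nablaPhi p v y x z := by
  unfold nablaPhi nabla3
  have h : (fun q => S.form3 q (coordField x q) (coordField y q) (coordField z q)) =
      -fun q => S.form3 q (coordField y q) (coordField x q) (coordField z q) :=
    funext fun q => S.form3_swap₁ q _ _ _
  rw [h, mvfderiv_neg, neg_apply, S.form3_swap₁ p _ y, S.form3_swap₁ p x, S.form3_swap₁ p x y]
  ring

theorem nablaPhi_swap₂ (p : N) (v x y z : TangentSpace (𝓡 7) p) :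
    S.nablaPhi p v x y z = -S.nablaPhi p v x z y := by
  unfold nablaPhi nabla3
  have h : (fun q => S.form3 q (coordField x q) (coordField y q) (coordField z q)) =
      -fun q => S.form3 q (coordField x q) (coordField z q) (coordField y q) :=
    funext fun q => S.form3_swap₂ q _ _ _
  rw [h, mvfderiv_neg, neg_apply, S.form3_swap₂ p _ y, S.form3_swap₂ p x _ z, S.form3_swap₂ p x y]
  ring

theorem orthoFrame_spec {V : Type*} [AddCommGroup V] [Module ℝ V] {k : ℕ}
    {G : V → V → ℝ} (h : ∃ e : Fin k → V, IsOrthonormal G e) :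
    IsOrthonormal G (orthoFrame k G) := Classical.epsilon_spec h

/-- The torsion `r(φ)` of an almost parallel structure as a skew bilinear form. -/
theorem exists_rbar (hS : S.IsTypeX2) (p : N) : ∃ r : TangentSpace (𝓡 7) p →ₗ[ℝ]
    TangentSpace (𝓡 7) p →ₗ[ℝ] ℝ, (∀ x y, r x y = S.rbar p x y) ∧ (∀ x y, r x y = -r y x) ∧
    ∀ e, CayleySpace (S.gL p) (S.phiL p) (S.crossL p) e →
      (∀ x y z u, S.nablaPhi p x y z u = ∑ l, r x (e l) * S.starPhi p (e l) y z u) ∧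
      ∀ i, ∑ j, ∑ k, (phiT i j k : ℝ) * r (e j) (e k) = 0 := by
  obtain ⟨D, hD⟩ := S.exists_nablaPhi p
  have hT : IsTorsion (S.crossL p) D := by
    refine ⟨fun v x y z => ?_, fun v x y z => ?_, fun v x y z => ?_, fun x y z u => ?_⟩ <;>
      simp only [hD]
    · exact S.nablaPhi_swap₁ p v x y z
    · exact S.nablaPhi_swap₂ p v x y z
    · exact S.nablaPhi_derivation p v x y z
    · exact hS p x y z u
  obtain ⟨e, hC⟩ := S.exists_cayleySpace p
  have hf : IsOrthonormal (S.g p) (orthoFrame 7 (S.g p)) := orthoFrame_spec ⟨e, hC.frame.1⟩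
  have hr : ∀ e, CayleySpace (S.gL p) (S.phiL p) (S.crossL p) e → ∃ r : TangentSpace (𝓡 7) p →ₗ[ℝ]
      TangentSpace (𝓡 7) p →ₗ[ℝ] ℝ, (∀ x y, r x y = S.rbar p x y) ∧ (∀ x y, r x y = -r y x) ∧
      (∀ x y z u, S.nablaPhi p x y z u = ∑ l, r x (e l) * S.starPhi p (e l) y z u) ∧
      ∀ i, ∑ j, ∑ k, (phiT i j k : ℝ) * r (e j) (e k) = 0 := fun e hC => by
    obtain ⟨r, h1, h2, h3, h4⟩ := torsion_tensor hC hT hf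
    refine ⟨r, fun x y => ?_, h2, fun x y z u => ?_, h4⟩
    · rw [h1, rbar, S.starPhi_eq hC]
      simp only [hD]
    · rw [← hD, h3, S.starPhi_eq hC]
  obtain ⟨r, h1, h2, -⟩ := hr e hC
  refine ⟨r, h1, h2, fun e' hC' => ?_⟩
  obtain ⟨r', h1', h2', h3', h4'⟩ := hr e' hC'
  -- The form obtained from another Cayley frame has the same values, those of r(φ); hence one `r`
  -- serves all frames.
  have : r = r' := LinearMap.ext₂ fun x y => (h1 x y).trans (h1' x y).symm
  subst this
  exact ⟨h3', h4'⟩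

end G2Structure

/-! ### SU(3)-structures on a vector space -/

section SU3

variable {V : Type*} [AddCommGroup V] [Module ℝ V]

/-- The linear algebra of an `SU(3)`-structure: `ψ` is the real part of a complex volume form
compatible with the metric `g` and the almost complex structure `I`; `u` is an orthonormal basis. -/
structure SU3Space (g : V →ₗ[ℝ] V →ₗ[ℝ] ℝ) (I : V →ₗ[ℝ] V) (ψ : V →ₗ[ℝ] V →ₗ[ℝ] V →ₗ[ℝ] ℝ)
    (u : Fin 6 → V) : Prop where
  finrank : Module.finrank ℝ V = 6
  symm : ∀ x y, g x y = g y x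
  orth : IsOrthonormal (fun x y => g x y) u
  sq : ∀ x, I (I x) = -x
  isom : ∀ x y, g (I x) (I y) = g x y
  swap₁ : ∀ x y z, ψ x y z = -ψ y x z
  swap₂ : ∀ x y z, ψ x y z = -ψ x z y
  move : ∀ x y z, ψ (I x) y z = ψ x (I y) z
  contraction : ∀ y z v w, ∑ j, ψ (u j) y z * ψ (u j) v w =
    g y v * g z w - g y w * g z v - g y (I v) * g z (I w) + g y (I w) * g z (I v)

end SU3

/-! ### The SU(3)-structure induced on a hyperplane -/

section Hyperplane

variable {W : Type*} [AddCommGroup W] [Module ℝ W] {g : W →ₗ[ℝ] W →ₗ[ℝ] ℝ}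
  {φ : W →ₗ[ℝ] W →ₗ[ℝ] W →ₗ[ℝ] ℝ} {P : W →ₗ[ℝ] W →ₗ[ℝ] W} {e : Fin 7 → W}

/-- On n^⊥ the four-form is -½ ω ∧ ω with ω = -φ(n, ·, ·). This is checked in a Cayley frame
beginning with `n`. -/
theorem star_perp_perp (hC : CayleySpace g φ P e) {n : W} (hn : g n n = 1) {y z v w : W}
    (hy : g n y = 0) (hz : g n z = 0) (hv : g n v = 0) (hw : g n w = 0) :
    cayleyFour (fun x y => g x y) e y z v w =
      -(φ n y z * φ n v w) + φ n y v * φ n z w - φ n y w * φ n z v := by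
  obtain ⟨f, hf, rfl⟩ := exists_adapted_frame hC hn
  rw [star_eq_star hC hf, cayleyFour_eq]
  simp only [phi_eq hf, metric_frame hf, Fin.sum_univ_seven, crossComp, Fin.reduceAdd, zero_add, hy,
    hz, hv, hw]
  simp [kd]
  ring

variable {V : Type*} [AddCommGroup V] [Module ℝ V]

/-- A hyperplane `J : V → W` with unit normal `n` in a space with cross product, with its induced
metric and almost complex structure. -/
structure IsHyperplane (g : W →ₗ[ℝ] W →ₗ[ℝ] ℝ) (φ : W →ₗ[ℝ] W →ₗ[ℝ] W →ₗ[ℝ] ℝ)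
    (P : W →ₗ[ℝ] W →ₗ[ℝ] W) (e : Fin 7 → W) (n : W) (J : V →ₗ[ℝ] W) (gV : V →ₗ[ℝ] V →ₗ[ℝ] ℝ)
    (I : V →ₗ[ℝ] V) : Prop where
  cayley : CayleySpace g φ P e
  unit : g n n = 1
  perp : ∀ x, g n (J x) = 0
  metric : ∀ x y, gV x y = g (J x) (J y)
  range : ∀ w, g n w = 0 → ∃ x, J x = w
  map_I : ∀ x, J (I x) = P n (J x)
  finrank : Module.finrank ℝ V = 6
  inj : ∀ x y, J x = J y → x = y

variable {n : W} {J : V →ₗ[ℝ] W} {gV : V →ₗ[ℝ] V →ₗ[ℝ] ℝ} {I : V →ₗ[ℝ] V}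

/-- The three-form `φ((a + b I) ·, ·, ·)` on the hyperplane. -/
def rotatedForm (φ : W →ₗ[ℝ] W →ₗ[ℝ] W →ₗ[ℝ] ℝ) (J : V →ₗ[ℝ] W) (I : V →ₗ[ℝ] V) (a b : ℝ) :
    V →ₗ[ℝ] V →ₗ[ℝ] V →ₗ[ℝ] ℝ :=
  LinearMap.mk₂ ℝ (fun x y => ((φ (J (a • x + b • I x))) (J y)).comp J)
    (fun x x' y => by ext z; simp; ring) (fun c x y => by ext z; simp; ring)
    (fun x y y' => by ext z; simp; ring) (fun c x y => by ext z; simp; ring)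

theorem rotatedForm_apply (φ : W →ₗ[ℝ] W →ₗ[ℝ] W →ₗ[ℝ] ℝ) (J : V →ₗ[ℝ] W) (I : V →ₗ[ℝ] V)
    (a b : ℝ) (x y z : V) :
    rotatedForm φ J I a b x y z = φ (J (a • x + b • I x)) (J y) (J z) := rfl

theorem rotatedForm_eq (φ : W →ₗ[ℝ] W →ₗ[ℝ] W →ₗ[ℝ] ℝ) (J : V →ₗ[ℝ] W) (I : V →ₗ[ℝ] V)
    (a b : ℝ) (x y z : V) : rotatedForm φ J I a b x y z =
      a * φ (J x) (J y) (J z) + b * φ (J (I x)) (J y) (J z) := by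
  rw [rotatedForm_apply]
  simp

namespace IsHyperplane

variable (h : IsHyperplane g φ P e n J gV I)
include h

theorem symm (x y : V) : gV x y = gV y x := by rw [h.metric, h.metric, h.cayley.symm]

theorem I_sq (x : V) : I (I x) = -x := by
  refine h.inj _ _ ?_
  rw [h.map_I, h.map_I, cross_cross h.cayley, h.perp, h.unit, map_neg]
  simp

theorem I_isom (x y : V) : gV (I x) (I y) = gV x y := by
  rw [h.metric, h.metric, h.map_I, h.map_I, metric_cross_cross h.cayley, h.perp, h.unit]
  ring

theorem phi_normal (x y : V) : φ n (J x) (J y) = -gV x (I y) := by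
  rw [← h.cayley.cross, ← h.map_I, ← h.metric, ← h.I_isom, h.I_sq, map_neg, LinearMap.neg_apply]

/-- The restriction of φ to n^⊥ has type (3,0) + (0,3). The reason is that P(n, ·) anticommutes with
P(y, ·) up to a multiple of `n`, which pairs to zero with tangent vectors. -/
theorem phi_move (x y z : V) : φ (J (I x)) (J y) (J z) = φ (J x) (J (I y)) (J z) := by
  have h1 := cross_cross_polar h.cayley n (J y) (J x)
  rw [h.perp, h.perp] at h1
  have h2 := congrArg (fun w => g w (J z)) h1
  have h3 := cross_cross_polar h.cayley n (J x) (J y)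
  rw [h.perp, h.perp] at h3
  have h4 := congrArg (fun w => g w (J z)) h3
  simp only [map_add, map_sub, map_smul, LinearMap.add_apply, LinearMap.sub_apply,
    LinearMap.smul_apply, h.perp, smul_eq_mul, ← h.map_I, h.cayley.cross] at h2 h4
  rw [cross_swap h.cayley (J x), map_neg, LinearMap.neg_apply] at h4
  have h5 := phi_swap₁ h.cayley (J y) (J (I x)) (J z)
  linarith

/-- The tangential part of the cross product. -/
theorem exists_tangential_cross (y z : V) : ∃ w, P (J y) (J z) = J w + (φ n (J y) (J z)) • n := by
  obtain ⟨w, hw⟩ := h.range (P (J y) (J z) - (φ n (J y) (J z)) • n) (by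
    rw [map_sub, map_smul, h.unit, h.cayley.symm, h.cayley.cross]
    rw [phi_swap₂ h.cayley, phi_swap₁ h.cayley (J y), smul_eq_mul]
    ring)
  exact ⟨w, by rw [hw]; abel⟩

/-- For the contraction, write rotatedForm(x, y, z) = ⟨x, (a - bI)p⟩ with `p` the tangential part of
P(y, z). As a² + b² = 1, the map a - bI is an isometry, so the sum equals ⟨p, q⟩. It is found by
comparing the two expressions `star_eq` and `star_perp_perp` of the four-form. -/
theorem su3Space {a b : ℝ} (hab : a ^ 2 + b ^ 2 = 1) {u : Fin 6 → V}
    (hu : IsOrthonormal (fun x y => gV x y) u) : SU3Space gV I (rotatedForm φ J I a b) u := by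
  have hIg : ∀ x y, gV (I x) y = -gV x (I y) := fun x y => by
    rw [← h.I_isom x, h.I_sq, map_neg, neg_neg]
  refine ⟨h.finrank, h.symm, hu, h.I_sq, h.I_isom, fun x y z => ?_, fun x y z => ?_,
    fun x y z => ?_, fun y z v w => ?_⟩
  · rw [rotatedForm_eq, rotatedForm_eq, h.phi_move, phi_swap₁ h.cayley (J x),
      phi_swap₁ h.cayley (J x) (J (I y))]
    ring
  · rw [rotatedForm_apply, rotatedForm_apply, phi_swap₂ h.cayley]
  · rw [rotatedForm_eq, rotatedForm_eq, h.phi_move, h.phi_move]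
  · obtain ⟨p, hp⟩ := h.exists_tangential_cross y z
    obtain ⟨q, hq⟩ := h.exists_tangential_cross v w
    have h1 : ∀ x, rotatedForm φ J I a b x y z = gV x (a • p - b • I p) := fun x => by
      rw [rotatedForm_apply, phi_swap₁ h.cayley, phi_swap₂ h.cayley, neg_neg, ← h.cayley.cross, hp,
        map_add, map_smul, LinearMap.add_apply, LinearMap.smul_apply, h.perp, ← h.metric, h.symm]
      simp [hIg]
      ring
    have h2 : ∀ x, rotatedForm φ J I a b x v w = gV x (a • q - b • I q) := fun x => by
      rw [rotatedForm_apply, phi_swap₁ h.cayley, phi_swap₂ h.cayley, neg_neg, ← h.cayley.cross, hq,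
        map_add, map_smul, LinearMap.add_apply, LinearMap.smul_apply, h.perp, ← h.metric, h.symm]
      simp [hIg]
      ring
    simp only [h1, h2]
    rw [← metric_expand h.finrank hu]
    have h3 : gV (a • p - b • I p) (a • q - b • I q) = gV p q := by
      simp only [map_sub, map_smul, LinearMap.sub_apply, LinearMap.smul_apply, h.I_isom, hIg,
        smul_eq_mul]
      linear_combination gV p q * hab
    have h4 : g (P (J y) (J z)) (P (J v) (J w)) = gV p q + φ n (J y) (J z) * φ n (J v) (J w) := by
      rw [hp, hq]
      simp only [map_add, map_smul, LinearMap.add_apply, LinearMap.smul_apply, h.perp, ← h.metric,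
        h.unit, h.cayley.symm _ n, smul_eq_mul]
      ring
    have h5 := star_eq h.cayley (J y) (J z) (J v) (J w)
    rw [star_perp_perp h.cayley h.unit (h.perp _) (h.perp _) (h.perp _) (h.perp _), h4] at h5
    simp only [h.phi_normal, ← h.metric] at h5
    rw [h3]
    linarith

end IsHyperplane

end Hyperplane

/-! ### Bilinear forms and the Gray-Hervella modules -/

section Modules

variable {V : Type*} [AddCommGroup V] [Module ℝ V]

namespace SU3Space

variable {g : V →ₗ[ℝ] V →ₗ[ℝ] ℝ} {I : V →ₗ[ℝ] V} {ψ : V →ₗ[ℝ] V →ₗ[ℝ] V →ₗ[ℝ] ℝ} {u : Fin 6 → V}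
  (h : SU3Space g I ψ u)
include h

theorem g_frame (i j : Fin 6) : g (u i) (u j) = if i = j then 1 else 0 := h.orth i j

theorem g_I (x y : V) : g (I x) y = -g x (I y) := by
  rw [← h.isom x, h.sq, map_neg, neg_neg]

theorem g_I_self (x : V) : g x (I x) = 0 := by
  have := h.g_I x x
  rw [h.symm] at this
  linarith

theorem move₂ (x y z : V) : ψ x (I y) z = ψ x y (I z) := by
  rw [← h.move, h.swap₂, h.move, h.swap₂]
  ring

theorem psi_II (x y z : V) : ψ x (I y) (I z) = -ψ x y z := by
  rw [h.move₂, h.sq, map_neg]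

/-- Contraction of a linear form with the orthonormal frame. -/
theorem sum_frame (f : V →ₗ[ℝ] ℝ) (x : V) : ∑ i, g x (u i) * f (u i) = f x := by
  conv_rhs => rw [orthonormal_expand h.finrank h.orth x]
  simp only [map_sum, map_smul, smul_eq_mul, h.symm]

theorem sum_frame' (f : V →ₗ[ℝ] ℝ) (x : V) : ∑ i, g (u i) x * f (u i) = f x := by
  simp only [h.symm _ x, h.sum_frame]

theorem sum_frame_I (f : V →ₗ[ℝ] ℝ) (x : V) : ∑ i, g x (I (u i)) * f (u i) = -f (I x) := by
  have := h.sum_frame f (I x)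
  simp only [h.g_I, neg_mul, Finset.sum_neg_distrib] at this
  linarith

theorem sum_unit : ∑ i, g (u i) (u i) = 6 := by
  simp [h.g_frame]

omit h in
/-- The tensor `∑ Z(x, u_j) ψ(u_j, y, z)` with the symmetries of `∇ω`. -/
def ofBilin (ψ : V →ₗ[ℝ] V →ₗ[ℝ] V →ₗ[ℝ] ℝ) (u : Fin 6 → V) (Z : V →ₗ[ℝ] V →ₗ[ℝ] ℝ)
    (x y z : V) : ℝ := ∑ j, Z x (u j) * ψ (u j) y z

theorem isNablaOmegaType_ofBilin (Z : V →ₗ[ℝ] V →ₗ[ℝ] ℝ) :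
    IsNablaOmegaType I (ofBilin ψ u Z) := by
  refine ⟨?_, fun x y z => ?_, fun x y z => ?_⟩
  · obtain ⟨L, hL⟩ : ∃ L : V →ₗ[ℝ] V →ₗ[ℝ] V →ₗ[ℝ] ℝ, ∀ x y z, L x y z = ofBilin ψ u Z x y z := by
      refine exists_trilinear ?_ ?_ ?_ ?_ ?_ ?_ <;> intros <;> simp only [ofBilin, map_add, map_smul,
        LinearMap.add_apply, LinearMap.smul_apply, smul_eq_mul, add_mul, mul_add,
        Finset.sum_add_distrib, Finset.mul_sum, mul_assoc, mul_left_comm]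
    exact ⟨L, fun x y z => (hL x y z).symm⟩
  · simp only [ofBilin, ← Finset.sum_neg_distrib]
    exact Finset.sum_congr rfl fun j _ => by rw [h.swap₂]; ring
  · simp only [ofBilin, ← Finset.sum_neg_distrib]
    exact Finset.sum_congr rfl fun j _ => by rw [h.psi_II]; ring

/-- Full contraction of `ψ(y, ·, ·)` with itself. -/
theorem psi_norm (x y : V) : ∑ i, ∑ j, ψ x (u i) (u j) * ψ y (u i) (u j) = 4 * g x y := by
  have h1 : ∀ i, ∑ j, ψ x (u i) (u j) * ψ y (u i) (u j) = g x y - g x (u i) * g (u i) y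
      + g x (I (u i)) * g (u i) (I y) := fun i => by
    have := h.contraction x (u i) y (u i)
    have e : ∀ x j, ψ (u j) x (u i) = ψ x (u i) (u j) := fun x j => by
      rw [h.swap₁, h.swap₂, neg_neg]
    simp only [e] at this
    rw [this, h.g_I_self, h.g_frame, if_pos rfl]
    ring
  simp only [h1, Finset.sum_add_distrib, Finset.sum_sub_distrib]
  have h2 := h.sum_frame (g.flip y) x
  have h3 := h.sum_frame_I (g.flip (I y)) x
  simp only [LinearMap.flip_apply] at h2 h3
  rw [h2, h3, h.isom]
  simp
  ring

/-- The factors ½ in `rForm` and in `inner2` are cancelled by ψ(x, ·, ·) · ψ(y, ·, ·) = 4⟨x, y⟩. So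
r is a left inverse of `ofBilin`. -/
theorem rForm_ofBilin (Z : V →ₗ[ℝ] V →ₗ[ℝ] ℝ) (x y : V) :
    rForm u (fun x y z => ψ x y z) (ofBilin ψ u Z) x y = Z x y := by
  have h1 : ∑ i, ∑ j, ofBilin ψ u Z x (u i) (u j) * ψ y (u i) (u j) = 4 * Z x y := by
    simp only [ofBilin, Finset.sum_mul, mul_assoc]
    rw [Finset.sum_congr rfl fun i _ => Finset.sum_comm, Finset.sum_comm]
    simp only [← Finset.mul_sum, h.psi_norm]
    have := h.sum_frame' (Z x) y
    rw [← this, Finset.mul_sum]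
    exact Finset.sum_congr rfl fun i _ => by ring
  simp only [rForm, inner2, h1]
  ring

/-- A two-form with `a(I·, I·) = -a` is recovered from its contraction with `ψ`. -/
theorem twoForm_eq {a : V →ₗ[ℝ] V →ₗ[ℝ] ℝ} (h₁ : ∀ y z, a y z = -a z y)
    (h₂ : ∀ y z, a y z = -a (I y) (I z)) (y z : V) :
    ∑ j, (1 / 4 * ∑ k, ∑ l, a (u k) (u l) * ψ (u j) (u k) (u l)) * ψ (u j) y z = a y z := by
  have h3 : ∀ j, (1 / 4 * ∑ k, ∑ l, a (u k) (u l) * ψ (u j) (u k) (u l)) * ψ (u j) y z =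
      ∑ k, ∑ l, 1 / 4 * a (u k) (u l) * (ψ (u j) (u k) (u l) * ψ (u j) y z) := fun j => by
    simp only [Finset.mul_sum, Finset.sum_mul]
    exact Finset.sum_congr rfl fun k _ => Finset.sum_congr rfl fun l _ => by ring
  simp only [h3]
  rw [Finset.sum_comm, Finset.sum_congr rfl fun k _ => Finset.sum_comm]
  simp only [← Finset.mul_sum, h.contraction]
  have h4 : ∀ k, ∑ l, 1 / 4 * a (u k) (u l) * (g (u k) y * g (u l) z - g (u k) z * g (u l) y -
      g (u k) (I y) * g (u l) (I z) + g (u k) (I z) * g (u l) (I y)) =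
      1 / 4 * (g (u k) y * a (u k) z - g (u k) z * a (u k) y - g (u k) (I y) * a (u k) (I z)
        + g (u k) (I z) * a (u k) (I y)) := fun k => by
    rw [← h.sum_frame' (a (u k)) y, ← h.sum_frame' (a (u k)) z, ← h.sum_frame' (a (u k)) (I y),
      ← h.sum_frame' (a (u k)) (I z)]
    simp only [Finset.mul_sum, ← Finset.sum_add_distrib, ← Finset.sum_sub_distrib]
    exact Finset.sum_congr rfl fun l _ => by ring
  simp only [h4, ← Finset.mul_sum, Finset.sum_add_distrib, Finset.sum_sub_distrib]
  have h5 := fun v w => h.sum_frame' (a.flip w) v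
  simp only [LinearMap.flip_apply] at h5
  rw [h5, h5, h5, h5]
  linarith [h₁ y z, h₂ y z, h₂ z y]

/-- A tensor with the symmetries of `∇ω` is determined by `r`. -/
theorem ofBilin_rForm {α : V → V → V → ℝ} (hα : IsNablaOmegaType I α) :
    ∃ Z : V →ₗ[ℝ] V →ₗ[ℝ] ℝ, (∀ x y, Z x y = rForm u (fun x y z => ψ x y z) α x y) ∧
      ∀ x y z, α x y z = ofBilin ψ u Z x y z := by
  obtain ⟨⟨L, hL⟩, h1, h2⟩ := hα
  have hr : ∀ x y, rForm u (fun x y z => ψ x y z) α x y =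
      1 / 4 * ∑ k, ∑ l, L x (u k) (u l) * ψ y (u k) (u l) := fun x y => by
    simp only [rForm, inner2, hL]
    ring
  simp only [hL] at h1 h2
  refine ⟨LinearMap.mk₂ ℝ (fun x y => 1 / 4 * ∑ k, ∑ l, L x (u k) (u l) * ψ y (u k) (u l))
    ?_ ?_ ?_ ?_, fun x y => (hr x y).symm, fun x y z => ?_⟩
  · intro x x' y
    simp only [map_add, LinearMap.add_apply, add_mul, Finset.sum_add_distrib, mul_add]
  · intro c x y
    simp only [map_smul, LinearMap.smul_apply, smul_eq_mul, Finset.mul_sum]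
    exact Finset.sum_congr rfl fun i _ => Finset.sum_congr rfl fun j _ => by ring
  · intro x x' y
    simp only [map_add, LinearMap.add_apply, Finset.sum_add_distrib, mul_add]
  · intro c x y
    simp only [map_smul, LinearMap.smul_apply, smul_eq_mul, Finset.mul_sum]
    exact Finset.sum_congr rfl fun i _ => Finset.sum_congr rfl fun j _ => by ring
  · rw [hL, ← h.twoForm_eq (h1 x) (h2 x)]
    rfl

/-- This second contraction pairs ψ with two slots that include the derivative direction. Compared
with r, which pairs it with the last two, it detects alternation (W₁) and vanishing of the cyclic
sum (W₂). -/
theorem ofBilin_contraction (Z : V →ₗ[ℝ] V →ₗ[ℝ] ℝ) (x y : V) :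
    ∑ i, ∑ j, ofBilin ψ u Z (u i) (u j) x * ψ y (u i) (u j) =
      (∑ i, Z (u i) (u i)) * g x y - (∑ i, Z (u i) (I (u i))) * g x (I y)
        - Z x y - Z (I x) (I y) := by
  have h1 : ∀ i, ∑ j, ofBilin ψ u Z (u i) (u j) x * ψ y (u i) (u j) =
      Z (u i) (u i) * g x y - Z (u i) (I (u i)) * g x (I y) - g x (u i) * Z (u i) y
        + g x (I (u i)) * Z (u i) (I y) := fun i => by
    simp only [ofBilin, Finset.sum_mul]
    rw [Finset.sum_comm]
    have h2 : ∀ k, ∑ j, Z (u i) (u k) * ψ (u k) (u j) x * ψ y (u i) (u j) = Z (u i) (u k) *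
        (g x y * g (u k) (u i) - g x (u i) * g (u k) y - g x (I y) * g (u k) (I (u i))
          + g x (I (u i)) * g (u k) (I y)) := fun k => by
      rw [← h.contraction, Finset.mul_sum]
      refine Finset.sum_congr rfl fun j _ => ?_
      rw [h.swap₁ (u j) x, h.swap₂ x, h.swap₁ x, h.swap₂ (u k), h.swap₁ (u j) y, h.swap₂ y]
      ring
    simp only [h2]
    rw [← h.sum_frame' (Z (u i)) (u i), ← h.sum_frame' (Z (u i)) y,
      ← h.sum_frame' (Z (u i)) (I (u i)), ← h.sum_frame' (Z (u i)) (I y)]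
    simp only [Finset.sum_mul, Finset.mul_sum, ← Finset.sum_add_distrib, ← Finset.sum_sub_distrib]
    exact Finset.sum_congr rfl fun k _ => by ring
  simp only [h1, Finset.sum_add_distrib, Finset.sum_sub_distrib, ← Finset.sum_mul]
  have h3 := h.sum_frame (Z.flip y) x
  have h4 := h.sum_frame_I (Z.flip (I y)) x
  simp only [LinearMap.flip_apply] at h3 h4
  rw [h3, h4]
  ring

/-- `I` is skew for the metric, so it passes from one slot of a trace to the other with a change of
sign. -/
theorem trace_I (b : V →ₗ[ℝ] V →ₗ[ℝ] ℝ) :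
    ∑ i, b (u i) (I (u i)) = -∑ i, b (I (u i)) (u i) := by
  have h1 : ∀ i, b (u i) (I (u i)) = ∑ k, -(g (I (u k)) (u i) * b (u i) (u k)) := fun i => by
    rw [← h.sum_frame' (b (u i)) (I (u i))]
    exact Finset.sum_congr rfl fun k _ => by rw [h.g_I]; ring
  simp only [h1]
  rw [Finset.sum_comm, ← Finset.sum_neg_distrib]
  refine Finset.sum_congr rfl fun k _ => ?_
  rw [Finset.sum_neg_distrib]
  have := h.sum_frame (b.flip (u k)) (I (u k))
  simp only [LinearMap.flip_apply] at this
  rw [this]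

/-- The `I` on the second argument moves to the summed slot of ψ, and from there onto `Z` with a
sign by `trace_I`. So the symmetry of the tensor under `I` is that of `Z` up to sign: invariance of
`Z` belongs to W₁ + W₂, anti-invariance to W₃ + W₄. -/
theorem ofBilin_I (Z : V →ₗ[ℝ] V →ₗ[ℝ] ℝ) (x y z : V) :
    ofBilin ψ u Z (I x) (I y) z = -ofBilin ψ u (Z.compl₁₂ I I) x y z := by
  have := h.trace_I ((LinearMap.mul ℝ ℝ).compl₁₂ (Z (I x)) ((ψ.flip y).flip z))
  simp only [LinearMap.compl₁₂_apply, LinearMap.mul_apply', LinearMap.flip_apply, h.move] at this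
  simpa only [ofBilin, LinearMap.compl₁₂_apply] using this

theorem ofBilin_injective {Z Z' : V →ₗ[ℝ] V →ₗ[ℝ] ℝ}
    (hZ : ∀ x y z, ofBilin ψ u Z x y z = ofBilin ψ u Z' x y z) : Z = Z' := by
  have : ofBilin ψ u Z = ofBilin ψ u Z' :=
    funext fun x => funext fun y => funext fun z => hZ x y z
  refine LinearMap.ext₂ fun x y => ?_
  rw [← h.rForm_ofBilin, this, h.rForm_ofBilin]

theorem invariant_iff {Z : V →ₗ[ℝ] V →ₗ[ℝ] ℝ} :
    (∀ x y z, ofBilin ψ u Z (I x) (I y) z = -ofBilin ψ u Z x y z) ↔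
      ∀ x y, Z (I x) (I y) = Z x y := by
  simp only [h.ofBilin_I, neg_inj]
  constructor
  · intro hZ x y
    exact congrArg (fun L : V →ₗ[ℝ] V →ₗ[ℝ] ℝ => L x y) (h.ofBilin_injective hZ)
  · intro hZ x y z
    have : Z.compl₁₂ I I = Z := LinearMap.ext₂ hZ
    rw [this]

theorem anti_iff {Z : V →ₗ[ℝ] V →ₗ[ℝ] ℝ} :
    (∀ x y z, ofBilin ψ u Z x y z = ofBilin ψ u Z (I x) (I y) z) ↔
      ∀ x y, Z (I x) (I y) = -Z x y := by
  have hneg : ∀ x y z, ofBilin ψ u (-Z) x y z = -ofBilin ψ u Z x y z := fun x y z => by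
    simp [ofBilin]
  simp only [h.ofBilin_I]
  constructor
  · intro hZ x y
    refine congrArg (fun L : V →ₗ[ℝ] V →ₗ[ℝ] ℝ => L x y) (h.ofBilin_injective (Z := Z.compl₁₂ I I)
      (Z' := -Z) fun x y z => ?_)
    rw [hneg, hZ, neg_neg]
  · intro hZ x y z
    have : Z.compl₁₂ I I = -Z := LinearMap.ext₂ hZ
    rw [this, hneg, neg_neg]

theorem type_move {α : V → V → V → ℝ} (hα : IsNablaOmegaType I α) (x y z : V) :
    α x (I y) z = α x y (I z) := by
  obtain ⟨⟨L, hL⟩, h1, h2⟩ := hα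
  rw [h2 x (I y) z, hL, h.sq, map_neg, LinearMap.neg_apply, neg_neg, hL]

/-- An alternating tensor makes the two contractions with ψ agree, and the resulting equation
determines `Z` by its two traces. Conversely, g and ω give the alternating tensors ψ and ψ(I·, ·,
·), up to sign. -/
theorem isW1_iff {Z : V →ₗ[ℝ] V →ₗ[ℝ] ℝ} : IsW1 I (ofBilin ψ u Z) ↔
    ∀ x y, 6 * Z x y = (∑ i, Z (u i) (u i)) * g x y - (∑ i, Z (u i) (I (u i))) * g x (I y) := by
  have ht := h.isNablaOmegaType_ofBilin Z
  constructor
  · rintro ⟨-, hW⟩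
    have hα : ∀ x y z, ofBilin ψ u Z x y z = -ofBilin ψ u Z y x z := fun x y z => by
      obtain ⟨L, hL⟩ := ht.1
      simp only [hL] at hW ⊢
      have := hW (x + y) z
      simp only [map_add, LinearMap.add_apply, hW] at this
      linarith
    have hinv := h.invariant_iff.1 fun x y z => by
      rw [h.type_move ht, hα, ← neg_neg (ofBilin ψ u Z y (I x) (I z)), ← ht.2.2, neg_neg, hα]
    intro x y
    have h1 := h.ofBilin_contraction Z x y
    have h2 := h.rForm_ofBilin Z x y
    simp only [rForm, inner2] at h2
    have h3 : ∀ i j, ofBilin ψ u Z x (u i) (u j) = ofBilin ψ u Z (u i) (u j) x := fun i j => by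
      rw [hα, ht.2.1 (u i) x, neg_neg]
    simp only [h3, h1, hinv] at h2
    linarith
  · intro hZ
    refine ⟨ht, fun x y => ?_⟩
    have h1 := h.sum_frame ((ψ.flip x).flip y) x
    have h2 := h.sum_frame_I ((ψ.flip x).flip y) x
    simp only [LinearMap.flip_apply] at h1 h2
    have h3 : 6 * ofBilin ψ u Z x x y = (∑ i, Z (u i) (u i)) * ψ x x y
        + (∑ i, Z (u i) (I (u i))) * ψ (I x) x y := by
      rw [← h1, ← neg_neg (ψ (I x) x y), ← h2]
      simp only [ofBilin, Finset.mul_sum, ← mul_assoc, hZ, ← Finset.sum_neg_distrib,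
        ← Finset.sum_add_distrib]
      exact Finset.sum_congr rfl fun j _ => by ring
    have h4 := h.swap₁ x x y
    have h5 := h.move x x y
    have h6 := h.swap₁ x (I x) y
    have h7 : ψ x x y = 0 := by linarith
    have h8 : ψ (I x) x y = 0 := by linarith
    rw [h7, h8] at h3
    linarith

/-- The contraction that detects the cyclic sum. -/
theorem cyclic_contraction (Z : V →ₗ[ℝ] V →ₗ[ℝ] ℝ) (x y : V) :
    ∑ i, ∑ j, (ofBilin ψ u Z x (u i) (u j) + ofBilin ψ u Z (u i) (u j) x
      + ofBilin ψ u Z (u j) x (u i)) * ψ y (u i) (u j) =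
      4 * Z x y + 2 * ((∑ i, Z (u i) (u i)) * g x y - (∑ i, Z (u i) (I (u i))) * g x (I y)
        - Z x y - Z (I x) (I y)) := by
  have h1 := h.ofBilin_contraction Z x y
  have h2 := h.rForm_ofBilin Z x y
  simp only [rForm, inner2] at h2
  have h3 : ∑ i, ∑ j, ofBilin ψ u Z (u j) x (u i) * ψ y (u i) (u j) =
      ∑ i, ∑ j, ofBilin ψ u Z (u i) (u j) x * ψ y (u i) (u j) := by
    rw [Finset.sum_comm]
    refine Finset.sum_congr rfl fun i _ => Finset.sum_congr rfl fun j _ => ?_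
    rw [(h.isNablaOmegaType_ofBilin Z).2.1, h.swap₂]
    ring
  simp only [add_mul, Finset.sum_add_distrib]
  rw [h3, h1]
  linarith

theorem trace_g_I : ∑ i, g (u i) (I (u i)) = 0 := by simp [h.g_I_self]

/-- If the cyclic sum vanishes, so does its contraction with ψ, which for invariant `Z` consists of
the two trace terms. For the converse, the cyclic sum has the symmetries of ∇ω again, hence is
determined by its r, and that is the contraction just mentioned. -/
theorem isW2_iff {Z : V →ₗ[ℝ] V →ₗ[ℝ] ℝ} : IsW2 I (ofBilin ψ u Z) ↔
    (∀ x y, Z (I x) (I y) = Z x y) ∧ ∑ i, Z (u i) (u i) = 0 ∧ ∑ i, Z (u i) (I (u i)) = 0 := by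
  have ht := h.isNablaOmegaType_ofBilin Z
  have hm := h.type_move ht
  constructor
  · rintro ⟨-, hW⟩
    have hinv := h.invariant_iff.1 fun x y z => by
      -- The cyclic identity with `I` inserted in every pair of arguments; the type conditions turn
      -- the four instances into a linear system for the values of the tensor.
      have e1 := hW (I x) (I y) z
      have e2 := hW x (I y) (I z)
      have e3 := hW (I x) y (I z)
      have e4 := hW x y z
      have t1 := ht.2.2 x y z
      have t2 := ht.2.2 y z x
      have t3 := ht.2.2 z x y
      have m1 := hm (I x) y z
      have m2 := hm (I y) z x
      have m3 := hm (I z) x y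
      linarith
    have h1 : ∀ x y, (∑ i, Z (u i) (u i)) * g x y - (∑ i, Z (u i) (I (u i))) * g x (I y) = 0 :=
      fun x y => by
        have := h.cyclic_contraction Z x y
        simp only [hW, zero_mul, Finset.sum_const_zero, hinv] at this
        linarith
    -- Pairing with g and with ω separates the two traces.
    have h2 := Finset.sum_congr rfl fun i (_ : i ∈ Finset.univ) => h1 (u i) (u i)
    have h3 := Finset.sum_congr rfl fun i (_ : i ∈ Finset.univ) => h1 (u i) (I (u i))
    simp only [Finset.sum_sub_distrib, ← Finset.mul_sum, h.trace_g_I, h.sum_unit, h.sq, map_neg,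
      Finset.sum_neg_distrib, Finset.sum_const_zero] at h2 h3
    exact ⟨hinv, by linarith, by linarith⟩
  · rintro ⟨hinv, htr, hta⟩
    refine ⟨ht, ?_⟩
    have hi := h.invariant_iff.2 hinv
    have hS : IsNablaOmegaType I fun x y z => ofBilin ψ u Z x y z + ofBilin ψ u Z y z x
        + ofBilin ψ u Z z x y := by
      refine ⟨?_, fun x y z => ?_, fun x y z => ?_⟩
      · obtain ⟨L, hL⟩ := ht.1
        obtain ⟨L', hL'⟩ := exists_trilinear (f := fun x y z => L x y z + L y z x + L z x y)
          (by intros; simp only [map_add, LinearMap.add_apply]; ring)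
          (by intros; simp only [map_smul, LinearMap.smul_apply, smul_eq_mul]; ring)
          (by intros; simp only [map_add, LinearMap.add_apply]; ring)
          (by intros; simp only [map_smul, LinearMap.smul_apply, smul_eq_mul]; ring)
          (by intros; simp only [map_add, LinearMap.add_apply]; ring)
          (by intros; simp only [map_smul, LinearMap.smul_apply, smul_eq_mul]; ring)
        exact ⟨L', fun x y z => by simp only [hL', hL]⟩
      · linarith [ht.2.1 x y z, ht.2.1 y z x, ht.2.1 z x y]
      · linarith [ht.2.2 x y z, hi y z x, hi z x y, hm (I y) z x, hm z x (I y), hi z x (I y),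
          hm (I z) x y]
    obtain ⟨Z', hZ', hS'⟩ := h.ofBilin_rForm hS
    have h0 : Z' = 0 := LinearMap.ext₂ fun x y => by
      rw [hZ']
      simp only [rForm, inner2, h.cyclic_contraction, htr, hta, hinv]
      simp
      ring
    intro x y z
    rw [hS', h0]
    simp [ofBilin]

end SU3Space

end Modules

/-! ### Projections onto the irreducible modules -/

section Modules

variable {V : Type*} [AddCommGroup V] [Module ℝ V]

/-- The bilinear forms `r(α)` for `α` in the irreducible modules. -/
def BilinModule (g : V →ₗ[ℝ] V →ₗ[ℝ] ℝ) (I : V →ₗ[ℝ] V) (u : Fin 6 → V) :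
    TorsionClass → (V →ₗ[ℝ] V →ₗ[ℝ] ℝ) → Prop
  | .W1p, Z => ∃ a : ℝ, ∀ x y, Z x y = a * g x y
  | .W1m, Z => ∃ a : ℝ, ∀ x y, Z x y = a * g x (I y)
  | .W2p, Z => (∀ x y, Z x y = Z y x) ∧ (∀ x y, Z (I x) (I y) = Z x y) ∧ ∑ i, Z (u i) (u i) = 0
  | .W2m, Z => (∀ x y, Z x y = -Z y x) ∧ (∀ x y, Z (I x) (I y) = Z x y) ∧
      ∑ i, Z (u i) (I (u i)) = 0
  | .W3, Z => (∀ x y, Z x y = Z y x) ∧ ∀ x y, Z (I x) (I y) = -Z x y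
  | .W4, Z => (∀ x y, Z x y = -Z y x) ∧ ∀ x y, Z (I x) (I y) = -Z x y
  | .W5, Z => ∀ x y, Z x y = 0

/-- The value at `(x, y)` of the component of `Z` in an irreducible module. -/
def projBilin (g : V →ₗ[ℝ] V →ₗ[ℝ] ℝ) (I : V →ₗ[ℝ] V) (u : Fin 6 → V)
    (Z : V →ₗ[ℝ] V →ₗ[ℝ] ℝ) (x y : V) : TorsionClass → ℝ
  | .W1p => (∑ i, Z (u i) (u i)) / 6 * g x y
  | .W1m => -(∑ i, Z (u i) (I (u i))) / 6 * g x (I y)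
  | .W2p => (Z x y + Z y x + Z (I x) (I y) + Z (I y) (I x)) / 4 - (∑ i, Z (u i) (u i)) / 6 * g x y
  | .W2m => (Z x y - Z y x + Z (I x) (I y) - Z (I y) (I x)) / 4
      + (∑ i, Z (u i) (I (u i))) / 6 * g x (I y)
  | .W3 => (Z x y + Z y x - Z (I x) (I y) - Z (I y) (I x)) / 4
  | .W4 => (Z x y - Z y x - Z (I x) (I y) + Z (I y) (I x)) / 4
  | .W5 => 0

namespace SU3Space

variable {g : V →ₗ[ℝ] V →ₗ[ℝ] ℝ} {I : V →ₗ[ℝ] V} {ψ : V →ₗ[ℝ] V →ₗ[ℝ] V →ₗ[ℝ] ℝ} {u : Fin 6 → V}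
  (h : SU3Space g I ψ u)
include h

theorem trace_symm_I {Z : V →ₗ[ℝ] V →ₗ[ℝ] ℝ} (hZ : ∀ x y, Z x y = Z y x) :
    ∑ i, Z (u i) (I (u i)) = 0 := by
  have h1 := h.trace_I Z
  have h2 : ∑ i, Z (I (u i)) (u i) = ∑ i, Z (u i) (I (u i)) :=
    Finset.sum_congr rfl fun i _ => hZ _ _
  linarith

omit h in
theorem trace_skew {Z : V →ₗ[ℝ] V →ₗ[ℝ] ℝ} (hZ : ∀ x y, Z x y = -Z y x) :
    ∑ i, Z (u i) (u i) = 0 :=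
  Finset.sum_eq_zero fun i _ => by linarith [hZ (u i) (u i)]

theorem trace_anti {Z : V →ₗ[ℝ] V →ₗ[ℝ] ℝ} (hZ : ∀ x y, Z (I x) (I y) = -Z x y) :
    ∑ i, Z (u i) (u i) = 0 := by
  have h1 := h.trace_I (Z.compl₁₂ LinearMap.id I)
  simp only [LinearMap.compl₁₂_apply, LinearMap.id_apply, h.sq, map_neg, hZ,
    Finset.sum_neg_distrib] at h1
  linarith

theorem trace_anti_I {Z : V →ₗ[ℝ] V →ₗ[ℝ] ℝ} (hZ : ∀ x y, Z (I x) (I y) = -Z x y) :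
    ∑ i, Z (u i) (I (u i)) = 0 := by
  have h1 := h.trace_I Z
  have h2 : ∑ i, Z (I (u i)) (u i) = ∑ i, Z (u i) (I (u i)) :=
    Finset.sum_congr rfl fun i _ => by
      have := hZ (u i) (I (u i))
      rw [h.sq, map_neg] at this
      linarith
  linarith

/-- The contraction of the tensor is minus the contraction of `Z` with ψ, which sees only the skew
part. For anti-invariant `Z` that part is recovered from its contraction with ψ. -/
theorem contract_eq_zero_iff {Z : V →ₗ[ℝ] V →ₗ[ℝ] ℝ} (hZ : ∀ x y, Z (I x) (I y) = -Z x y) :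
    (∀ z, contract u (ofBilin ψ u Z) z = 0) ↔ ∀ x y, Z x y = Z y x := by
  have hc : ∀ z, contract u (ofBilin ψ u Z) z = -∑ i, ∑ j, Z (u i) (u j) * ψ z (u i) (u j) :=
    fun z => by
      simp only [contract, ofBilin, ← Finset.sum_neg_distrib]
      refine Finset.sum_congr rfl fun i _ => Finset.sum_congr rfl fun j _ => ?_
      rw [h.swap₁, h.swap₂, h.swap₁]
      ring
  have hs : ∀ z, ∑ i, ∑ j, Z (u j) (u i) * ψ z (u i) (u j) =
      -∑ i, ∑ j, Z (u i) (u j) * ψ z (u i) (u j) := fun z => by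
    rw [Finset.sum_comm]
    simp only [← Finset.sum_neg_distrib]
    refine Finset.sum_congr rfl fun i _ => Finset.sum_congr rfl fun j _ => ?_
    rw [h.swap₂]
    ring
  constructor
  · intro h0 x y
    have h1 := h.twoForm_eq (a := Z - Z.flip)
      (fun y z => by simp) (fun y z => by simp [hZ]; ring) x y
    simp only [LinearMap.sub_apply, LinearMap.flip_apply, sub_mul, Finset.sum_sub_distrib, hs] at h1
    have h2 : ∀ z, ∑ i, ∑ j, Z (u i) (u j) * ψ z (u i) (u j) = 0 := fun z => by
      have := h0 z
      rw [hc] at this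
      linarith
    simp only [h2] at h1
    simp at h1
    linarith
  · intro h0 z
    have h1 := hs z
    simp only [h0 (u _) (u _)] at h1
    have h2 : ∑ i, ∑ j, Z (u i) (u j) * ψ z (u i) (u j) =
        ∑ i, ∑ j, Z (u j) (u i) * ψ z (u i) (u j) :=
      Finset.sum_congr rfl fun i _ => Finset.sum_congr rfl fun j _ => by rw [h0]
    rw [hc]
    have h3 := hs z
    linarith

/-- For Z = ψ(w, ·, ·) the tensor has exactly the shape prescribed for W₄; its trace is -4⟨w, ·⟩. -/
theorem ofBilin_psi (w x y z : V) : ofBilin ψ u (ψ w) x y z =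
    g w y * g x z - g w z * g x y - g w (I y) * g x (I z) + g w (I z) * g x (I y) := by
  rw [← h.contraction]
  refine Finset.sum_congr rfl fun j _ => ?_
  rw [h.swap₁ (u j) w, h.swap₂ w (u j), neg_neg]

theorem contract_psi (w z : V) : contract u (ofBilin ψ u (ψ w)) z = -4 * g w z := by
  simp only [contract, h.ofBilin_psi, h.g_I_self, Finset.sum_add_distrib, Finset.sum_sub_distrib,
    ← Finset.mul_sum, h.sum_unit, mul_zero, Finset.sum_const_zero]
  have h1 := h.sum_frame (g.flip z) w
  have h2 := h.sum_frame_I (g.flip (I z)) w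
  simp only [LinearMap.flip_apply] at h1 h2
  rw [h1, h2, h.isom]
  ring

/-- The skew anti-invariant forms are the ψ(w, ·, ·): one direction takes `w` from the trace of the
tensor, the other from the contraction of `Z` with ψ. -/
theorem isW4_iff {Z : V →ₗ[ℝ] V →ₗ[ℝ] ℝ} : IsW4 (fun x y => g x y) I u (ofBilin ψ u Z) ↔
    (∀ x y, Z x y = -Z y x) ∧ ∀ x y, Z (I x) (I y) = -Z x y := by
  constructor
  · rintro ⟨⟨⟨L, hL⟩, -⟩, hW⟩
    set w : V := -(1 / 4 : ℝ) • ∑ j, contract u (ofBilin ψ u Z) (u j) • u j with hw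
    have hc : ∀ z, contract u (ofBilin ψ u Z) z = -4 * g w z := fun z => by
      have h1 := h.sum_frame' (∑ i, L (u i) (u i)) z
      have h2 : ∀ z, (∑ i, L (u i) (u i)) z = contract u (ofBilin ψ u Z) z := fun z => by
        simp [contract, hL]
      simp only [h2] at h1
      rw [← h1, hw]
      simp only [map_smul, map_neg, map_sum, LinearMap.smul_apply, LinearMap.sum_apply,
        LinearMap.neg_apply, smul_eq_mul, Finset.mul_sum, neg_smul]
      rw [← Finset.sum_neg_distrib, Finset.mul_sum]
      exact Finset.sum_congr rfl fun i _ => by ring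
    have hZ : Z = ψ w := h.ofBilin_injective fun x y z => by
      rw [hW, hc, hc, hc, hc, h.ofBilin_psi]
      ring
    rw [hZ]
    exact ⟨h.swap₂ w, h.psi_II w⟩
  · rintro ⟨h1, h2⟩
    have hZ : Z = ψ (∑ j, (1 / 4 * ∑ k, ∑ l, Z (u k) (u l) * ψ (u j) (u k) (u l)) • u j) :=
      LinearMap.ext₂ fun x y => by
        rw [← h.twoForm_eq h1 (fun y z => by rw [h2, neg_neg]) x y]
        simp
    generalize (∑ j, (1 / 4 * ∑ k, ∑ l, Z (u k) (u l) * ψ (u j) (u k) (u l)) • u j) = w at hZ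
    rw [hZ]
    refine ⟨h.isNablaOmegaType_ofBilin _, fun x y z => ?_⟩
    simp only [h.contract_psi, h.ofBilin_psi]
    ring

theorem inModule_iff (c : TorsionClass) (Z : V →ₗ[ℝ] V →ₗ[ℝ] ℝ) :
    InModule (fun x y => g x y) I u (fun x y z => ψ x y z) c (ofBilin ψ u Z) ↔
      BilinModule g I u c Z := by
  cases c <;> simp only [InModule, BilinModule, h.rForm_ofBilin]
  · rw [h.isW1_iff]
    constructor
    · rintro ⟨h1, h2⟩
      refine ⟨(∑ i, Z (u i) (u i)) / 6, fun x y => ?_⟩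
      have := h1 x y
      rw [h.trace_symm_I h2] at this
      linarith
    · rintro ⟨a, ha⟩
      have h2 : ∀ x y, Z x y = Z y x := fun x y => by rw [ha, ha, h.symm]
      refine ⟨fun x y => ?_, h2⟩
      rw [h.trace_symm_I h2]
      simp only [ha, ← Finset.mul_sum, h.sum_unit]
      ring
  · rw [h.isW1_iff]
    constructor
    · rintro ⟨h1, h2⟩
      refine ⟨-(∑ i, Z (u i) (I (u i))) / 6, fun x y => ?_⟩
      have := h1 x y
      rw [trace_skew h2] at this
      linarith
    · rintro ⟨a, ha⟩
      have h2 : ∀ x y, Z x y = -Z y x := fun x y => by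
        rw [ha, ha, h.symm y, h.g_I]
        ring
      refine ⟨fun x y => ?_, h2⟩
      rw [trace_skew h2]
      simp only [ha, ← Finset.mul_sum, h.sum_unit, h.sq, map_neg, Finset.sum_neg_distrib]
      ring
  · rw [h.isW2_iff]
    exact ⟨fun h1 => ⟨h1.2, h1.1.1, h1.1.2.1⟩, fun h1 => ⟨⟨h1.2.1, h1.2.2, h.trace_symm_I h1.1⟩, h1.1⟩⟩
  · rw [h.isW2_iff]
    exact ⟨fun h1 => ⟨h1.2, h1.1.1, h1.1.2.2⟩, fun h1 => ⟨⟨h1.2.1, trace_skew h1.1, h1.2.2⟩, h1.1⟩⟩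
  · unfold IsW3
    rw [h.anti_iff]
    exact ⟨fun h1 => ⟨(h.contract_eq_zero_iff h1.2.1).1 h1.2.2, h1.2.1⟩, fun h1 =>
      ⟨h.isNablaOmegaType_ofBilin Z, h1.2, (h.contract_eq_zero_iff h1.2).2 h1.1⟩⟩
  · exact h.isW4_iff
  · constructor
    · intro h0 x y
      have : Z = 0 := h.ofBilin_injective fun x y z => by rw [h0]; simp [ofBilin]
      simp [this]
    · intro h0 x y z
      simp [ofBilin, h0]

/-- The projections are the identity on their own module and zero on the others. With the fact that
all seven add up to `Z`, this gives the direct sum decomposition. -/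
theorem projBilin_self {c : TorsionClass} {Z : V →ₗ[ℝ] V →ₗ[ℝ] ℝ} (hZ : BilinModule g I u c Z)
    (d : TorsionClass) (x y : V) : projBilin g I u Z x y d = if d = c then Z x y else 0 := by
  have hgI : ∀ x y, g y (I x) = -g x (I y) := fun x y => by rw [h.symm, h.g_I]
  cases c
  · obtain ⟨a, ha⟩ := hZ
    have hτ := h.trace_symm_I (Z := Z) fun x y => by rw [ha, ha, h.symm]
    have htr : ∑ i, Z (u i) (u i) = 6 * a := by
      simp only [ha, ← Finset.mul_sum, h.sum_unit]
      ring
    cases d <;> simp only [projBilin, hτ, htr, reduceCtorEq, if_true, if_false] <;>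
      (try simp only [ha, h.isom, h.symm y x]) <;> ring
  · obtain ⟨a, ha⟩ := hZ
    have htr := trace_skew (u := u) (Z := Z) fun x y => by rw [ha, ha, hgI]; ring
    have hτ : ∑ i, Z (u i) (I (u i)) = -6 * a := by
      simp only [ha, ← Finset.mul_sum, h.sq, map_neg, Finset.sum_neg_distrib, h.sum_unit]
      ring
    cases d <;> simp only [projBilin, hτ, htr, reduceCtorEq, if_true, if_false] <;>
      (try simp only [ha, h.isom, hgI x y]) <;> ring
  · obtain ⟨h1, h2, h3⟩ := hZ
    have hτ := h.trace_symm_I h1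
    cases d <;> simp only [projBilin, hτ, h3, h2, h1 y x, reduceCtorEq, if_true, if_false] <;> ring
  · obtain ⟨h1, h2, h3⟩ := hZ
    have htr := trace_skew (u := u) h1
    cases d <;> simp only [projBilin, htr, h3, h2, h1 y x, reduceCtorEq, if_true, if_false] <;> ring
  · obtain ⟨h1, h2⟩ := hZ
    have htr := h.trace_anti h2
    have hτ := h.trace_anti_I h2
    cases d <;> simp only [projBilin, htr, hτ, h2, h1 y x, reduceCtorEq, if_true, if_false] <;> ring
  · obtain ⟨h1, h2⟩ := hZ
    have htr := h.trace_anti h2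
    have hτ := h.trace_anti_I h2
    cases d <;> simp only [projBilin, htr, hτ, h2, h1 y x, reduceCtorEq, if_true, if_false] <;> ring
  · have hZ' : ∀ x y, Z x y = 0 := hZ
    cases d <;> simp [projBilin, hZ']

theorem exists_projBilin (c : TorsionClass) (Z : V →ₗ[ℝ] V →ₗ[ℝ] ℝ) :
    ∃ Y, BilinModule g I u c Y ∧ ∀ x y, Y x y = projBilin g I u Z x y c := by
  have hgI : ∀ x y, g (I x) y = -g x (I y) := h.g_I
  have hY : ∃ Y : V →ₗ[ℝ] V →ₗ[ℝ] ℝ, ∀ x y, Y x y = projBilin g I u Z x y c := by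
    refine ⟨LinearMap.mk₂ ℝ (fun x y => projBilin g I u Z x y c) ?_ ?_ ?_ ?_, fun x y => rfl⟩ <;>
    cases c <;> intros <;> simp only [projBilin, map_add, map_smul, LinearMap.add_apply,
      LinearMap.smul_apply, smul_eq_mul] <;> ring
  obtain ⟨Y, hY⟩ := hY
  have hII : ∑ i, Z (I (u i)) (I (u i)) = ∑ i, Z (u i) (u i) := by
    have h1 := h.trace_I (Z.compl₁₂ LinearMap.id I)
    simp only [LinearMap.compl₁₂_apply, LinearMap.id_apply, h.sq, map_neg,
      Finset.sum_neg_distrib] at h1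
    linarith
  have hI := h.trace_I Z
  refine ⟨Y, ?_, hY⟩
  cases c <;> simp only [BilinModule, hY, projBilin]
  · exact ⟨_, fun x y => rfl⟩
  · exact ⟨_, fun x y => rfl⟩
  · refine ⟨fun x y => ?_, fun x y => ?_, ?_⟩
    · rw [h.symm x y]
      ring
    · simp only [h.sq, map_neg, LinearMap.neg_apply, h.isom]
      ring
    · simp only [Finset.sum_sub_distrib, ← Finset.sum_div, Finset.sum_add_distrib, ← Finset.mul_sum,
        h.sum_unit, hII]
      ring
  · refine ⟨fun x y => ?_, fun x y => ?_, ?_⟩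
    · rw [h.symm x, hgI]
      ring
    · simp only [h.sq, map_neg, LinearMap.neg_apply, hgI]
      ring
    · simp only [Finset.sum_sub_distrib, ← Finset.sum_div, Finset.sum_add_distrib, ← Finset.mul_sum,
        h.sq, map_neg, LinearMap.neg_apply, Finset.sum_neg_distrib, h.sum_unit, hI]
      ring
  · refine ⟨fun x y => ?_, fun x y => ?_⟩
    · ring
    · simp only [h.sq, map_neg, LinearMap.neg_apply]
      ring
  · refine ⟨fun x y => ?_, fun x y => ?_⟩
    · ring
    · simp only [h.sq, map_neg, LinearMap.neg_apply]
      ring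
  · simp

theorem exists_bilin_of_inModule {c : TorsionClass} {α : V → V → V → ℝ}
    (hα : InModule (fun x y => g x y) I u (fun x y z => ψ x y z) c α) :
    ∃ Z, BilinModule g I u c Z ∧ ∀ x y z, α x y z = ofBilin ψ u Z x y z := by
  -- W₅ is treated apart: its membership condition is the vanishing of the tensor and does not
  -- contain the type condition.
  have key : IsNablaOmegaType I α →
      ∃ Z, BilinModule g I u c Z ∧ ∀ x y z, α x y z = ofBilin ψ u Z x y z := fun ht => by
    obtain ⟨Z, -, hZ⟩ := h.ofBilin_rForm ht
    obtain rfl : α = ofBilin ψ u Z := funext fun x => funext fun y => funext fun z => hZ x y z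
    exact ⟨Z, (h.inModule_iff c Z).1 hα, fun _ _ _ => rfl⟩
  cases c
  · exact key hα.1.1
  · exact key hα.1.1
  · exact key hα.1.1
  · exact key hα.1.1
  · exact key hα.1
  · exact key hα.1
  · have h0 : ∀ x y z, α x y z = 0 := hα
    exact ⟨0, fun x y => rfl, fun x y z => by simp [h0, ofBilin]⟩

omit h in
theorem projBilin_sum {C : Finset TorsionClass} (Y : TorsionClass → V →ₗ[ℝ] V →ₗ[ℝ] ℝ) (x y : V)
    (d : TorsionClass) :
    projBilin g I u (∑ c ∈ C, Y c) x y d = ∑ c ∈ C, projBilin g I u (Y c) x y d := by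
  induction C using Finset.induction_on with
  | empty => cases d <;> simp [projBilin]
  | insert c C hc ih =>
    rw [Finset.sum_insert hc, Finset.sum_insert hc, ← ih]
    cases d <;> simp only [projBilin, LinearMap.add_apply, Finset.sum_add_distrib] <;> ring

omit h in
theorem sum_projBilin (Z : V →ₗ[ℝ] V →ₗ[ℝ] ℝ) {C : Finset TorsionClass} (x y : V)
    (hC : ∀ c ∉ C, projBilin g I u Z x y c = 0) :
    ∑ c ∈ C, projBilin g I u Z x y c = Z x y := by
  rw [Finset.sum_subset (s₂ := {.W1p, .W1m, .W2p, .W2m, .W3, .W4, .W5})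
    (fun c _ => by cases c <;> simp) fun c _ hc => hC c hc]
  simp [projBilin]
  ring

/-- `∇ω` lies in a sum of modules if and only if its other components vanish. -/
theorem exists_decomposition_iff (C : Finset TorsionClass) (Z : V →ₗ[ℝ] V →ₗ[ℝ] ℝ) :
    (∃ β : TorsionClass → V → V → V → ℝ,
      (∀ c ∈ C, InModule (fun x y => g x y) I u (fun x y z => ψ x y z) c (β c)) ∧
      ∀ x y z, ofBilin ψ u Z x y z = ∑ c ∈ C, β c x y z) ↔
    ∀ c ∉ C, ∀ x y, projBilin g I u Z x y c = 0 := by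
  have hsum : ∀ (Y : TorsionClass → V →ₗ[ℝ] V →ₗ[ℝ] ℝ) x y z,
      ofBilin ψ u (∑ c ∈ C, Y c) x y z = ∑ c ∈ C, ofBilin ψ u (Y c) x y z := fun Y x y z => by
    simp only [ofBilin, LinearMap.sum_apply, Finset.sum_mul]
    exact Finset.sum_comm
  constructor
  · rintro ⟨β, h1, h2⟩ d hd x y
    -- Nothing is known about β outside `C`; the value 0 there is a dummy that never enters the sum.
    have hY : ∀ c, ∃ Y, c ∈ C → BilinModule g I u c Y ∧ ∀ x y z, β c x y z = ofBilin ψ u Y x y z :=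
      fun c => by
        by_cases hc : c ∈ C
        · obtain ⟨Y, hY⟩ := h.exists_bilin_of_inModule (h1 c hc)
          exact ⟨Y, fun _ => hY⟩
        · exact ⟨0, fun h => absurd h hc⟩
    choose Y hY using hY
    have hZ : Z = ∑ c ∈ C, Y c := h.ofBilin_injective fun x y z => by
      rw [h2, hsum]
      exact Finset.sum_congr rfl fun c hc => (hY c hc).2 x y z
    rw [hZ, projBilin_sum]
    refine Finset.sum_eq_zero fun c hc => ?_
    rw [h.projBilin_self (hY c hc).1, if_neg]
    rintro rfl
    exact hd hc
  · intro hC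
    choose Y hY using fun c => h.exists_projBilin c Z
    refine ⟨fun c => ofBilin ψ u (Y c), fun c _ => (h.inModule_iff c (Y c)).2 (hY c).1,
      fun x y z => ?_⟩
    rw [← hsum]
    congr 1
    refine LinearMap.ext₂ fun x y => ?_
    simp only [LinearMap.sum_apply, (hY _).2]
    exact (sum_projBilin Z x y fun c hc => hC c hc x y).symm

end SU3Space

end Modules

/-! ### Gauss and Weingarten formulas, and the derivative of ω -/

namespace Hypersurface

variable {N : Type*} [TopologicalSpace N] [ChartedSpace (EuclideanSpace ℝ (Fin 7)) N]
  [IsManifold (𝓡 7) ∞ N] {S : G2Structure N} {M : Type*} [TopologicalSpace M]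
  [ChartedSpace (EuclideanSpace ℝ (Fin 6)) M] [IsManifold (𝓡 6) ∞ M] (H : Hypersurface S M)

/-- The push-forward as a linear map. -/
def pushL (p : M) : TangentSpace (𝓡 6) p →ₗ[ℝ] TangentSpace (𝓡 7) (H.incl p) :=
  (mfderiv (𝓡 6) (𝓡 7) H.incl p).toLinearMap

/-- The induced metric as a field of bilinear maps. -/
def gL (p : M) : TangentSpace (𝓡 6) p →ₗ[ℝ] TangentSpace (𝓡 6) p →ₗ[ℝ] ℝ :=
  (S.gL (H.incl p)).compl₁₂ (H.pushL p) (H.pushL p)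

theorem gL_apply (p : M) (x y : TangentSpace (𝓡 6) p) :
    H.gL p x y = S.gL (H.incl p) (H.pushL p x) (H.pushL p y) := rfl

theorem mdifferentiableAt_incl (p : M) : MDifferentiableAt (𝓡 6) (𝓡 7) H.incl p :=
  (H.smooth_incl p).mdifferentiableAt (by simp)

theorem diffAlong_push (p : M) (v : TangentSpace (𝓡 6) p) :
    DiffAlong 7 6 H.incl (fun q => H.push q (coordField v q)) p :=
  (push_coordField (H.smooth_incl p) v).1

theorem diffAlong_normal (p : M) : DiffAlong 7 6 H.incl H.normal p := by
  have h := (Bundle.contMDiffAt_totalSpace.1 (H.smooth_normal p)).2.mdifferentiableAt (by simp)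
  exact h

theorem isMetricField : IsMetricField H.gL where
  symm p x y := S.isMetricField.symm _ _ _
  pos p x hx := S.isMetricField.pos _ _ fun h0 => hx (H.immersion p (by
    rw [map_zero]
    exact h0))
  diff p y z := (metric_along S.isMetricField (H.mdifferentiableAt_incl p) (H.diffAlong_push p y)
    (H.diffAlong_push p z)).1

/-- The ambient derivative of a tangential coordinate field. -/
def nablaPush (p : M) (x y : TangentSpace (𝓡 6) p) : TangentSpace (𝓡 7) (H.incl p) :=
  nablaAlong S.g H.incl (fun q => H.push q (coordField y q)) p x

/-- The ambient connection is torsion-free and the coordinate fields on M commute: the second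
derivatives of the immersion and the Christoffel terms are each symmetric. -/
theorem nablaPush_symm (p : M) (x y : TangentSpace (𝓡 6) p) :
    H.nablaPush p x y = H.nablaPush p y x := by
  unfold nablaPush
  rw [nablaAlong_eq, nablaAlong_eq]
  have h1 := derivAlong_push_symm (H.smooth_incl p) x y
  have h2 := christoffel_symm S.isMetricField (H.incl p) (mfderiv (𝓡 6) (𝓡 7) H.incl p x)
    (mfderiv (𝓡 6) (𝓡 7) H.incl p y)
  simp only [coordField_self]
  exact congrArg₂ (· + ·) h1 h2

/-- By metric compatibility and symmetry, the tangential parts of the ambient derivatives satisfy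
the Koszul formula of the induced metric. -/
theorem christoffel_tangential (p : M) (x y z : TangentSpace (𝓡 6) p) :
    S.gL (H.incl p) (H.nablaPush p x y) (H.pushL p z) = H.gL p (christoffel H.g p x y) z := by
  have hd : ∀ x y z : TangentSpace (𝓡 6) p,
      mvfderiv (𝓡 6) (fun q => H.gL q (coordField y q) (coordField z q)) p x =
      S.gL (H.incl p) (H.nablaPush p x y) (H.pushL p z)
      + S.gL (H.incl p) (H.nablaPush p x z) (H.pushL p y) := fun x y z => by
    have h1 := (metric_along S.isMetricField (H.mdifferentiableAt_incl p) (H.diffAlong_push p y)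
      (H.diffAlong_push p z)).2 x
    simp only [coordField_self] at h1
    rw [S.isMetricField.symm _ (H.push p y)] at h1
    exact h1
  have h1 := koszul H.isMetricField p x y z
  rw [hd, hd, hd, H.nablaPush_symm p y x, H.nablaPush_symm p z x, H.nablaPush_symm p z y] at h1
  have h2 : christoffel (fun q x y => H.gL q x y) p x y = christoffel H.g p x y := rfl
  rw [h2] at h1
  linarith

theorem normal_perp' (p : M) (x : TangentSpace (𝓡 6) p) :
    S.gL (H.incl p) (H.normal p) (H.pushL p x) = 0 := H.normal_perp p x

/-- The immersion maps a space of dimension 6 injectively into n^⊥, which has dimension 7 - 1. -/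
theorem exists_push (p : M) {w : TangentSpace (𝓡 7) (H.incl p)}
    (hw : S.gL (H.incl p) (H.normal p) w = 0) : ∃ x, H.pushL p x = w := by
  set K := LinearMap.ker (S.gL (H.incl p) (H.normal p))
  have hK : Module.finrank ℝ K = 6 := by
    have h1 := LinearMap.finrank_range_add_finrank_ker (S.gL (H.incl p) (H.normal p))
    have h2 : LinearMap.range (S.gL (H.incl p) (H.normal p)) = ⊤ :=
      LinearMap.range_eq_top.2 fun c => ⟨c • H.normal p, by
        rw [map_smul]
        exact (congrArg (c • ·) (H.normal_unit p)).trans (mul_one c)⟩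
    rw [h2, finrank_top, Module.finrank_self, G2Structure.finrank_tangent] at h1
    change 1 + Module.finrank ℝ K = 7 at h1
    omega
  have hV : Module.finrank ℝ (TangentSpace (𝓡 6) p) = 6 := finrank_euclideanSpace_fin
  set F : TangentSpace (𝓡 6) p →ₗ[ℝ] K := (H.pushL p).codRestrict K fun x => H.normal_perp' p x
  have hF : Function.Injective F := fun x y hxy => H.immersion p (congrArg Subtype.val hxy)
  obtain ⟨x, hx⟩ := (LinearMap.injective_iff_surjective_of_finrank_eq_finrank (hV.trans hK.symm)).1 hF
    ⟨w, hw⟩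
  exact ⟨x, congrArg Subtype.val hx⟩

/-- The Gauss formula. -/
theorem nablaPush_eq (p : M) (x y : TangentSpace (𝓡 6) p) :
    H.nablaPush p x y = H.pushL p (christoffel H.g p x y) + H.B p x y • H.normal p := by
  set w := H.nablaPush p x y - H.B p x y • H.normal p with hw
  have h1 : S.gL (H.incl p) (H.normal p) w = 0 := by
    rw [hw, map_sub, map_smul, S.isMetricField.symm _ _ (H.nablaPush p x y)]
    have h2 : S.gL (H.incl p) (H.normal p) (H.normal p) = 1 := H.normal_unit p
    have h3 : S.gL (H.incl p) (H.nablaPush p x y) (H.normal p) = H.B p x y := rfl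
    rw [h2, h3, smul_eq_mul]
    ring
  obtain ⟨v, hv⟩ := H.exists_push p h1
  have h4 : v = christoffel H.g p x y := by
    refine eq_of_posDef (H.gL p) (H.isMetricField.pos p) fun z => ?_
    rw [← christoffel_tangential, gL_apply, hv, hw, map_sub, LinearMap.sub_apply, map_smul,
      LinearMap.smul_apply, normal_perp', smul_zero, sub_zero]
  rw [← h4, hv, hw]
  abel

theorem B_eq (p : M) (x y : TangentSpace (𝓡 6) p) :
    H.B p x y = S.gL (H.incl p) (H.nablaPush p x y) (H.normal p) := rfl

theorem B_symm (p : M) (x y : TangentSpace (𝓡 6) p) : H.B p x y = H.B p y x := by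
  rw [B_eq, B_eq, nablaPush_symm]

/-- The ambient derivative of the normal field. -/
def nablaNormal (p : M) (x : TangentSpace (𝓡 6) p) : TangentSpace (𝓡 7) (H.incl p) :=
  nablaAlong S.g H.incl H.normal p x

theorem nablaNormal_normal (p : M) (x : TangentSpace (𝓡 6) p) :
    S.gL (H.incl p) (H.normal p) (H.nablaNormal p x) = 0 := by
  have h1 := (metric_along S.isMetricField (H.mdifferentiableAt_incl p) (H.diffAlong_normal p)
    (H.diffAlong_normal p)).2 x
  have h2 : (fun q => S.gL (H.incl q) (H.normal q) (H.normal q)) = fun _ => (1 : ℝ) :=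
    funext fun q => H.normal_unit q
  rw [h2, mvfderiv_const, zero_apply] at h1
  have h3 : nablaAlong (fun q x y => S.gL q x y) H.incl H.normal p x = H.nablaNormal p x := rfl
  rw [h3, S.isMetricField.symm _ (H.nablaNormal p x)] at h1
  linarith

/-- The Weingarten formula. -/
theorem nablaNormal_push (p : M) (x y : TangentSpace (𝓡 6) p) :
    S.gL (H.incl p) (H.nablaNormal p x) (H.pushL p y) = -H.B p x y := by
  have h1 := (metric_along S.isMetricField (H.mdifferentiableAt_incl p) (H.diffAlong_normal p)
    (H.diffAlong_push p y)).2 x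
  have h2 : (fun q => S.gL (H.incl q) (H.normal q) (H.push q (coordField y q))) = fun _ => (0 : ℝ) :=
    funext fun q => H.normal_perp q _
  rw [h2, mvfderiv_const, zero_apply] at h1
  simp only [coordField_self] at h1
  rw [S.isMetricField.symm _ (H.normal p)] at h1
  have h3 : S.gL (H.incl p) (H.nablaNormal p x) (H.pushL p y) + H.B p x y = 0 := h1.symm
  linarith

theorem nablaAlong_add (a : ∀ q : M, TangentSpace (𝓡 7) (H.incl q)) (p : M)
    (x y : TangentSpace (𝓡 6) p) : nablaAlong S.g H.incl a p (x + y) =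
      nablaAlong S.g H.incl a p x + nablaAlong S.g H.incl a p y := by
  obtain ⟨C, hC⟩ := exists_christoffel S.isMetricField (H.incl p)
  have hC' : ∀ x y, christoffel S.g (H.incl p) x y = C x y := fun x y => (hC x y).symm
  rw [nablaAlong_eq, nablaAlong_eq, nablaAlong_eq, hC', hC', hC', map_add, map_add,
    LinearMap.add_apply]
  unfold derivAlong
  rw [map_add, map_add]
  abel

theorem nablaAlong_smul (a : ∀ q : M, TangentSpace (𝓡 7) (H.incl q)) (p : M) (c : ℝ)
    (x : TangentSpace (𝓡 6) p) : nablaAlong S.g H.incl a p (c • x) =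
      c • nablaAlong S.g H.incl a p x := by
  obtain ⟨C, hC⟩ := exists_christoffel S.isMetricField (H.incl p)
  have hC' : ∀ x y, christoffel S.g (H.incl p) x y = C x y := fun x y => (hC x y).symm
  rw [nablaAlong_eq, nablaAlong_eq, hC', hC', map_smul, map_smul, LinearMap.smul_apply]
  unfold derivAlong
  rw [map_smul, map_smul, smul_add]

/-- Linearity is clear only in the direction of differentiation; symmetry transfers it to the other
argument. -/
theorem exists_B (p : M) : ∃ b : TangentSpace (𝓡 6) p →ₗ[ℝ] TangentSpace (𝓡 6) p →ₗ[ℝ] ℝ,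
    ∀ x y, b x y = H.B p x y := by
  have hadd : ∀ x x' y, H.B p (x + x') y = H.B p x y + H.B p x' y := fun x x' y => by
    rw [B_eq, B_eq, B_eq, nablaPush, nablaAlong_add]
    exact map_add ((S.gL (H.incl p)).flip (H.normal p)) _ _
  have hsmul : ∀ (c : ℝ) x y, H.B p (c • x) y = c • H.B p x y := fun c x y => by
    rw [B_eq, B_eq, nablaPush, nablaAlong_smul]
    exact map_smul ((S.gL (H.incl p)).flip (H.normal p)) _ _
  exact ⟨LinearMap.mk₂ ℝ (H.B p) hadd hsmul
    (fun x y y' => by rw [B_symm, hadd, H.B_symm p y, H.B_symm p y'])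
    (fun c x y => by rw [B_symm, hsmul, H.B_symm p y]), fun x y => rfl⟩

/-- The cross product with `n` is orthogonal to `n`, hence tangent to M, so the choice in the
definition of `I` does solve its equation. -/
theorem push_I (p : M) (x : TangentSpace (𝓡 6) p) :
    H.pushL p (H.I p x) = S.crossL (H.incl p) (H.normal p) (H.pushL p x) := by
  have h1 : S.gL (H.incl p) (H.normal p)
      (S.crossL (H.incl p) (H.normal p) (H.pushL p x)) = 0 := by
    obtain ⟨e, hC⟩ := S.exists_cayleySpace (H.incl p)
    rw [hC.symm, hC.cross, phi_swap₂ hC, phi_self₁ hC, neg_zero]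
  rw [G2Structure.crossL_apply] at h1 ⊢
  exact Classical.epsilon_spec
    (p := fun w => H.push p w = S.cross (H.incl p) (H.normal p) (H.push p x)) (H.exists_push p h1)

theorem exists_I (p : M) : ∃ J : TangentSpace (𝓡 6) p →ₗ[ℝ] TangentSpace (𝓡 6) p,
    ∀ x, J x = H.I p x := by
  refine ⟨⟨⟨H.I p, fun x y => H.immersion p ?_⟩, fun c x => H.immersion p ?_⟩, fun x => rfl⟩
  · change H.pushL p _ = H.pushL p _
    simp only [map_add, push_I]
  · change H.pushL p _ = H.pushL p _
    simp only [map_smul, push_I, RingHom.id_apply]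

/-- The almost complex structure as a field of linear maps. -/
def IL (p : M) : TangentSpace (𝓡 6) p →ₗ[ℝ] TangentSpace (𝓡 6) p := (H.exists_I p).choose

theorem IL_apply (p : M) (x : TangentSpace (𝓡 6) p) : H.IL p x = H.I p x :=
  (H.exists_I p).choose_spec x

theorem isHyperplane (p : M) {e : Fin 7 → TangentSpace (𝓡 7) (H.incl p)}
    (hC : CayleySpace (S.gL (H.incl p)) (S.phiL (H.incl p)) (S.crossL (H.incl p)) e) :
    IsHyperplane (S.gL (H.incl p)) (S.phiL (H.incl p)) (S.crossL (H.incl p)) e (H.normal p)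
      (H.pushL p) (H.gL p) (H.IL p) where
  cayley := hC
  unit := H.normal_unit p
  perp := H.normal_perp' p
  metric _ _ := rfl
  range _ hw := H.exists_push p hw
  map_I x := by rw [IL_apply, push_I]
  finrank := finrank_euclideanSpace_fin
  inj x y hxy := H.immersion p hxy

theorem omega_eq (p : M) (x y : TangentSpace (𝓡 6) p) : H.omega p x y =
    -S.phiL (H.incl p) (H.normal p) (H.pushL p x) (H.pushL p y) := by
  obtain ⟨e, hC⟩ := S.exists_cayleySpace (H.incl p)
  rw [(H.isHyperplane p hC).phi_normal, neg_neg, IL_apply]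
  rfl

/-- Leibniz rule for ω = -φ(n, ·, ·). By the Gauss formula, the tangential derivatives of the
arguments cancel the Christoffel terms, and the normal ones contribute φ(n, n, ·) = 0. -/
theorem nablaOmega_eq (p : M) (x y z : TangentSpace (𝓡 6) p) : H.nablaOmega p x y z =
    -S.nablaPhi (H.incl p) (H.pushL p x) (H.normal p) (H.pushL p y) (H.pushL p z)
      - S.phiL (H.incl p) (H.nablaNormal p x) (H.pushL p y) (H.pushL p z) := by
  obtain ⟨e, hC⟩ := S.exists_cayleySpace (H.incl p)
  have hd := (S.phi_along (H.mdifferentiableAt_incl p) (H.diffAlong_normal p)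
    (H.diffAlong_push p y) (H.diffAlong_push p z)).2 x
  simp only [coordField_self] at hd
  have hf : (fun q => H.omega q (coordField y q) (coordField z q)) = -fun q =>
      S.phiL (H.incl q) (H.normal q) (H.push q (coordField y q)) (H.push q (coordField z q)) :=
    funext fun q => H.omega_eq q _ _
  unfold nablaOmega nabla2
  rw [hf, mvfderiv_neg, neg_apply, hd]
  change -(S.nablaPhi (H.incl p) (H.pushL p x) (H.normal p) (H.pushL p y) (H.pushL p z)
    + S.phiL (H.incl p) (H.nablaNormal p x) (H.pushL p y) (H.pushL p z)
    + S.phiL (H.incl p) (H.normal p) (H.nablaPush p x y) (H.pushL p z)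
    + S.phiL (H.incl p) (H.normal p) (H.pushL p y) (H.nablaPush p x z)) - _ - _ = _
  have h0 := phi_swap₂ hC (H.normal p) (H.pushL p y) (H.normal p)
  rw [omega_eq, omega_eq, nablaPush_eq, nablaPush_eq]
  simp only [map_add, map_smul, LinearMap.add_apply, LinearMap.smul_apply, phi_self₁ hC, h0,
    smul_eq_mul]
  ring

end Hypersurface

/-! ### The derivative of ψ₊ -/

theorem mvfderiv_real_comp {k : ℕ} {M : Type*} [TopologicalSpace M]
    [ChartedSpace (EuclideanSpace ℝ (Fin k)) M] {F : ℝ → ℝ} {F' : ℝ} {θ : M → ℝ} {p : M}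
    (hF : HasDerivAt F F' (θ p)) (hθ : MDifferentiableAt (𝓡 k) 𝓘(ℝ, ℝ) θ p) :
    MDifferentiableAt (𝓡 k) 𝓘(ℝ, ℝ) (fun q => F (θ q)) p ∧
    ∀ x, mvfderiv (𝓡 k) (fun q => F (θ q)) p x = F' * mvfderiv (𝓡 k) θ p x := by
  have hF' := hF.differentiableAt.mdifferentiableAt
  refine ⟨hF'.comp p hθ, fun x => ?_⟩
  have h := mvfderiv_comp_apply p hF' hθ x
  have h1 : mvfderiv 𝓘(ℝ, ℝ) F (θ p) = fderiv ℝ F (θ p) := mfderiv_eq_fderiv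
  rw [h1] at h
  have h2 : mvfderiv (𝓡 k) (fun q => F (θ q)) p x = fderiv ℝ F (θ p) (mvfderiv (𝓡 k) θ p x) := h
  rw [h2, hF.hasFDerivAt.fderiv]
  simp [mul_comm]

namespace Hypersurface

variable {N : Type*} [TopologicalSpace N] [ChartedSpace (EuclideanSpace ℝ (Fin 7)) N]
  [IsManifold (𝓡 7) ∞ N] {S : G2Structure N} {M : Type*} [TopologicalSpace M]
  [ChartedSpace (EuclideanSpace ℝ (Fin 6)) M] [IsManifold (𝓡 6) ∞ M] (H : Hypersurface S M)

theorem pullPhi_eq (p : M) (x y z : TangentSpace (𝓡 6) p) : H.pullPhi p x y z =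
    S.phiL (H.incl p) (H.pushL p x) (H.pushL p y) (H.pushL p z) :=
  (S.phiL_apply _ _ _ _).symm

theorem pullStarPhi_eq (p : M) (x y z : TangentSpace (𝓡 6) p) : H.pullStarPhi p x y z =
    -S.phiL (H.incl p) (S.crossL (H.incl p) (H.normal p) (H.pushL p x)) (H.pushL p y)
      (H.pushL p z) := by
  obtain ⟨e, hC⟩ := S.exists_cayleySpace (H.incl p)
  unfold pullStarPhi
  rw [S.starPhi_eq hC]
  exact star_perp hC (H.normal_perp' p y) (H.normal_perp' p z)

theorem psiPlus_eq (p : M) (x y z : TangentSpace (𝓡 6) p) : H.psiPlus p x y z =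
    rotatedForm (S.phiL (H.incl p)) (H.pushL p) (H.IL p) (Real.cos (H.theta p))
      (Real.sin (H.theta p)) x y z := by
  rw [rotatedForm_eq, psiPlus, pullPhi_eq, pullStarPhi_eq, IL_apply, push_I]
  ring

theorem psiMinus_eq (p : M) (x y z : TangentSpace (𝓡 6) p) : H.psiMinus p x y z =
    rotatedForm (S.phiL (H.incl p)) (H.pushL p) (H.IL p) (Real.sin (H.theta p))
      (-Real.cos (H.theta p)) x y z := by
  rw [rotatedForm_eq, psiMinus, pullPhi_eq, pullStarPhi_eq, IL_apply, push_I]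
  ring

/-- Leibniz rule for ψ₊ = cos θ φ + sin θ φ(I·, ·, ·) with I = P(n, ·). The derivative of the phase
gives -dθ ⊗ ψ₋, the Gauss formula the terms with B, and the derivative of the cross product those
with ∇φ(n, ·, ·) and ∇n. -/
theorem nablaPsiPlus_eq (p : M) (x y z u : TangentSpace (𝓡 6) p) : H.nablaPsiPlus p x y z u =
    -H.dTheta p x * H.psiMinus p y z u
    + Real.cos (H.theta p) * (S.nablaPhi (H.incl p) (H.pushL p x) (H.pushL p y) (H.pushL p z)
        (H.pushL p u)
      + H.B p x y * S.phiL (H.incl p) (H.normal p) (H.pushL p z) (H.pushL p u)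
      + H.B p x z * S.phiL (H.incl p) (H.pushL p y) (H.normal p) (H.pushL p u)
      + H.B p x u * S.phiL (H.incl p) (H.pushL p y) (H.pushL p z) (H.normal p))
    + Real.sin (H.theta p) * (S.nablaPhi (H.incl p) (H.pushL p x) (H.pushL p (H.I p y))
        (H.pushL p z) (H.pushL p u)
      + S.nablaPhi (H.incl p) (H.pushL p x) (H.normal p) (H.pushL p y)
        (S.crossL (H.incl p) (H.pushL p z) (H.pushL p u))
      + S.phiL (H.incl p) (H.nablaNormal p x) (H.pushL p y)
        (S.crossL (H.incl p) (H.pushL p z) (H.pushL p u))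
      + H.B p x z * S.phiL (H.incl p) (H.pushL p (H.I p y)) (H.normal p) (H.pushL p u)
      + H.B p x u * S.phiL (H.incl p) (H.pushL p (H.I p y)) (H.pushL p z) (H.normal p)) := by
  obtain ⟨e, hC⟩ := S.exists_cayleySpace (H.incl p)
  have hf := H.mdifferentiableAt_incl p
  have hθ : MDifferentiableAt (𝓡 6) 𝓘(ℝ, ℝ) H.theta p :=
    (H.smooth_theta p).mdifferentiableAt (by simp)
  have hcos := mvfderiv_real_comp (Real.hasDerivAt_cos (H.theta p)) hθ
  have hsin := mvfderiv_real_comp (Real.hasDerivAt_sin (H.theta p)) hθ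
  have hP := S.cross_along hf (H.diffAlong_normal p) (H.diffAlong_push p y)
  have h1 := S.phi_along hf (H.diffAlong_push p y) (H.diffAlong_push p z) (H.diffAlong_push p u)
  have h2 := S.phi_along hf hP.1 (H.diffAlong_push p z) (H.diffAlong_push p u)
  have hfun : (fun q => H.psiPlus q (coordField y q) (coordField z q) (coordField u q)) = fun q =>
      Real.cos (H.theta q) * S.phiL (H.incl q) (H.push q (coordField y q))
        (H.push q (coordField z q)) (H.push q (coordField u q)) +
      Real.sin (H.theta q) * S.phiL (H.incl q)
        (S.crossL (H.incl q) (H.normal q) (H.push q (coordField y q)))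
        (H.push q (coordField z q)) (H.push q (coordField u q)) := by
    funext q
    rw [psiPlus, pullPhi_eq, pullStarPhi_eq, mul_neg, sub_neg_eq_add]
    rfl
  have hD := hP.2 x (S.crossL (H.incl p) (H.pushL p z) (H.pushL p u))
  unfold nablaPsiPlus nabla3
  rw [hfun, mvfderiv_fun_add (mdifferentiableAt_mul hcos.1 h1.1)
      (mdifferentiableAt_mul hsin.1 h2.1), add_apply, mvfderiv_mul_apply hcos.1 h1.1,
      mvfderiv_mul_apply hsin.1 h2.1, hcos.2, hsin.2, h1.2, h2.2]
  generalize nablaAlong S.g H.incl (fun q => S.crossL (H.incl q) (H.normal q)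
    (H.push q (coordField y q))) p x = D at hD ⊢
  simp only [coordField_self] at hD ⊢
  have hpush : ∀ v, H.push p v = H.pushL p v := fun v => rfl
  have hmf : mfderiv (𝓡 6) (𝓡 7) H.incl p x = H.pushL p x := rfl
  have hθ' : mvfderiv (𝓡 6) H.theta p x = H.dTheta p x := rfl
  have hn : ∀ y, nablaAlong S.g H.incl (fun q => H.push q (coordField y q)) p x =
      H.pushL p (christoffel H.g p x y) + H.B p x y • H.normal p := fun y => H.nablaPush_eq p x y
  have hnn : nablaAlong S.g H.incl H.normal p x = H.nablaNormal p x := rfl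
  rw [hmf, hnn, hn, hpush] at hD
  rw [hmf, hθ', hn, hn, hn]
  simp only [hpush, psiPlus, psiMinus, pullPhi_eq, pullStarPhi_eq, push_I, map_add, map_smul,
    LinearMap.add_apply, LinearMap.smul_apply, smul_eq_mul, phi_self₁ hC, add_zero, mul_zero] at hD ⊢
  -- The derivative of `I` is known only through its inner products, so its insertion into φ is
  -- rewritten as an inner product with P(z, u).
  have hDφ : ∀ w, S.phiL (H.incl p) w (H.pushL p z) (H.pushL p u) =
      S.gL (H.incl p) w (S.crossL (H.incl p) (H.pushL p z) (H.pushL p u)) := fun w => by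
    rw [hC.symm, hC.cross, phi_swap₁ hC, phi_swap₂ hC, neg_neg]
  have hD2 := hDφ (S.crossL (H.incl p) (H.normal p) (H.pushL p (christoffel H.g p x y)))
  rw [hC.cross] at hD2
  rw [hDφ D, hD, hD2]
  ring

end Hypersurface

/-! ### Three-forms orthogonal to a complex volume form -/

namespace SU3Space

variable {V : Type*} [AddCommGroup V] [Module ℝ V]
  {g : V →ₗ[ℝ] V →ₗ[ℝ] ℝ} {I : V →ₗ[ℝ] V} {ψ : V →ₗ[ℝ] V →ₗ[ℝ] V →ₗ[ℝ] ℝ} {u : Fin 6 → V}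
  (h : SU3Space g I ψ u)
include h

theorem psi_self (x y : V) : ψ x y y = 0 := by linarith [h.swap₂ x y y]

theorem contraction_g (v : V) : ∑ j, ∑ k, g (u j) (u k) * ψ v (u j) (u k) = 0 := by
  have h1 : ∀ j, ∑ k, g (u j) (u k) * ψ v (u j) (u k) = 0 := fun j => by
    rw [h.sum_frame (ψ v (u j)), h.psi_self]
  simp [h1]

theorem contraction_omega (v : V) : ∑ j, ∑ k, g (u j) (I (u k)) * ψ v (u j) (u k) = 0 := by
  have h1 : ∀ j, ∑ k, g (u j) (I (u k)) * ψ v (u j) (u k) = 0 := fun j => by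
    have h2 := h.move₂ v (u j) (u j)
    rw [h.swap₂] at h2
    rw [h.sum_frame_I (ψ v (u j))]
    linarith
  simp [h1]

omit [AddCommGroup V] [Module ℝ V] h in
theorem inner3_add (S T : V → V → V → ℝ) (R : V → V → V → ℝ) :
    inner3 u (fun x y z => S x y z + T x y z) R = inner3 u S R + inner3 u T R := by
  simp only [inner3, add_mul, Finset.sum_add_distrib, mul_add]

theorem inner3_self (t : ℝ) : inner3 u (fun x y z => t * ψ x y z) (fun x y z => ψ x y z) = 4 * t := by
  simp only [inner3, mul_assoc, ← Finset.mul_sum, h.psi_norm, h.sum_unit]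
  ring

/-- Each summand is a one-form times a bilinear form whose contraction with ψ vanishes, as it does
for g and ω. This discards every term of ∇ψ₊ except its multiple of ψ₋. -/
theorem inner3_null {k : V → V → ℝ}
    (hk : ∀ v, ∑ i, ∑ j, k (u i) (u j) * ψ v (u i) (u j) = 0) (a b c : V → ℝ) :
    inner3 u (fun x y z => a x * k y z + b y * k x z + c z * k x y) (fun x y z => ψ x y z) = 0 := by
  have h1 : ∑ i, ∑ j, ∑ l, a (u i) * k (u j) (u l) * ψ (u i) (u j) (u l) = 0 := by
    simp only [mul_assoc, ← Finset.mul_sum, hk, mul_zero, Finset.sum_const_zero]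
  have h2 : ∑ i, ∑ j, ∑ l, b (u j) * k (u i) (u l) * ψ (u i) (u j) (u l) = 0 := by
    rw [Finset.sum_comm]
    have : ∀ j i l, b (u j) * k (u i) (u l) * ψ (u i) (u j) (u l) =
        -(b (u j) * (k (u i) (u l) * ψ (u j) (u i) (u l))) := fun j i l => by
      rw [h.swap₁]
      ring
    simp only [this, Finset.sum_neg_distrib, ← Finset.mul_sum, hk, mul_zero,
      Finset.sum_const_zero, neg_zero]
  have h3 : ∑ i, ∑ j, ∑ l, c (u l) * k (u i) (u j) * ψ (u i) (u j) (u l) = 0 := by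
    rw [Finset.sum_congr rfl fun i _ => Finset.sum_comm, Finset.sum_comm]
    have : ∀ l i j, c (u l) * k (u i) (u j) * ψ (u i) (u j) (u l) =
        c (u l) * (k (u i) (u j) * ψ (u l) (u i) (u j)) := fun l i j => by
      rw [h.swap₂, h.swap₁]
      ring
    simp only [this, ← Finset.mul_sum, hk, mul_zero, Finset.sum_const_zero]
  simp only [inner3, add_mul, Finset.sum_add_distrib, h1, h2, h3]
  ring

end SU3Space

/-! ### The component of ∇ψ₊ along ψ₋ -/

section Torsion

variable {W : Type*} [AddCommGroup W] [Module ℝ W] {g : W →ₗ[ℝ] W →ₗ[ℝ] ℝ}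
  {φ : W →ₗ[ℝ] W →ₗ[ℝ] W →ₗ[ℝ] ℝ} {P : W →ₗ[ℝ] W →ₗ[ℝ] W} {e : Fin 7 → W}
  {V : Type*} [AddCommGroup V] [Module ℝ V]
  {n : W} {J : V →ₗ[ℝ] W} {gV : V →ₗ[ℝ] V →ₗ[ℝ] ℝ} {I : V →ₗ[ℝ] V}

namespace IsHyperplane

variable (h : IsHyperplane g φ P e n J gV I)
include h

theorem exists_split (w : W) : ∃ v, w = g n w • n + J v := by
  obtain ⟨v, hv⟩ := h.range (w - g n w • n) (by
    rw [map_sub, map_smul, h.unit]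
    simp)
  exact ⟨v, by rw [hv]; abel⟩

/-- The component of the derivative of `ψ₊` along `ψ₋`. -/
theorem inner3_psiMinus {c s : ℝ} (hcs : s ^ 2 + (-c) ^ 2 = 1) {u : Fin 6 → V}
    (hu : IsOrthonormal (fun x y => gV x y) u) {ρ ν : W} {b : V → ℝ}
    (hν : g n ν = 0) (t : ℝ) :
    inner3 u (fun y z w => -t * rotatedForm φ J I s (-c) y z w
      + c * (cayleyFour (fun x y => g x y) e ρ (J y) (J z) (J w)
        + b y * φ n (J z) (J w) + b z * φ (J y) n (J w) + b w * φ (J y) (J z) n)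
      + s * (cayleyFour (fun x y => g x y) e ρ (J (I y)) (J z) (J w)
        + cayleyFour (fun x y => g x y) e ρ n (J y) (P (J z) (J w)) + φ ν (J y) (P (J z) (J w))
        + b z * φ (J (I y)) n (J w) + b w * φ (J (I y)) (J z) n))
      (fun y z w => rotatedForm φ J I s (-c) y z w) = 4 * (g n ρ - t) := by
  have hψ := h.su3Space hcs hu
  have hC := h.cayley
  obtain ⟨σ, hσ⟩ := h.exists_split ρ
  obtain ⟨τ, rfl⟩ := h.range ν hν
  set r₀ := g n ρ
  -- The vector ρ is split into its normal part, which contributes a multiple of φ(I·, ·, ·), and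
  -- its tangential part, where *φ is -½ ω ∧ ω.
  have hstar : ∀ y z w : V, cayleyFour (fun x y => g x y) e ρ (J y) (J z) (J w) =
      -r₀ * φ (J (I y)) (J z) (J w) - φ n (J σ) (J y) * φ n (J z) (J w)
        + φ n (J σ) (J z) * φ n (J y) (J w) - φ n (J σ) (J w) * φ n (J y) (J z) := fun y z w => by
    have h1 : cayleyFour (fun x y => g x y) e ρ (J y) (J z) (J w) =
        r₀ * cayleyFour (fun x y => g x y) e n (J y) (J z) (J w)
        + cayleyFour (fun x y => g x y) e (J σ) (J y) (J z) (J w) := by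
      rw [star_eq hC, star_eq hC, star_eq hC, hσ]
      simp only [map_add, map_smul, LinearMap.add_apply, LinearMap.smul_apply, smul_eq_mul]
      ring
    rw [h1, star_perp hC (h.perp _) (h.perp _), star_perp_perp hC h.unit (h.perp _) (h.perp _)
      (h.perp _) (h.perp _), h.map_I]
    ring
  have hcross : ∀ x y z w : V, φ (J x) (J y) (P (J z) (J w)) =
      φ n (J x) (J y) * φ n (J z) (J w) - φ n (J x) (J z) * φ n (J y) (J w)
      + φ n (J x) (J w) * φ n (J y) (J z) + gV x z * gV y w - gV x w * gV y z := fun x y z w => by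
    have h1 := star_eq hC (J x) (J y) (J z) (J w)
    rw [star_perp_perp hC h.unit (h.perp _) (h.perp _) (h.perp _) (h.perp _), hC.cross] at h1
    simp only [h.metric]
    linarith
  have hnormal : ∀ y z w : V, cayleyFour (fun x y => g x y) e ρ n (J y) (P (J z) (J w)) =
      φ (J (I σ)) (J y) (P (J z) (J w)) + gV σ y * φ n (J z) (J w) := fun y z w => by
    have h1 : P ρ n = -J (I σ) := by
      rw [hσ, map_add, map_smul, LinearMap.add_apply, LinearMap.smul_apply, cross_swap hC (J σ),
        h.map_I]
      have : P n n = 0 := eq_of_metric hC fun z => by rw [hC.cross, phi_self₁ hC]; simp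
      rw [this, smul_zero, zero_add]
    have h2 : g n (P (J z) (J w)) = φ n (J z) (J w) := by
      rw [hC.symm, hC.cross, phi_swap₂ hC, phi_swap₁ hC, neg_neg]
    have h3 : g ρ (J y) = gV σ y := by
      rw [hσ, map_add, map_smul, LinearMap.add_apply, LinearMap.smul_apply, h.perp, h.metric,
        smul_zero, zero_add]
    rw [star_eq hC, h1, h2, h3, h.perp, map_neg, LinearMap.neg_apply, hC.symm, hC.cross,
      phi_swap₂ hC, phi_swap₁ hC]
    ring
  have hmid : ∀ y w : V, φ (J y) n (J w) = -φ n (J y) (J w) := fun y w => phi_swap₁ hC _ _ _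
  have hlast : ∀ y z : V, φ (J y) (J z) n = φ n (J y) (J z) := fun y z => by
    rw [phi_swap₂ hC, phi_swap₁ hC, neg_neg]
  -- Everything is sorted into a multiple of ψ₋, one-forms times ω, and one-forms times g. The
  -- vanishing coefficients are kept so that the terms have the form required by `inner3_null`.
  have hexp : ∀ y z w : V, -t * rotatedForm φ J I s (-c) y z w
      + c * (cayleyFour (fun x y => g x y) e ρ (J y) (J z) (J w)
        + b y * φ n (J z) (J w) + b z * φ (J y) n (J w) + b w * φ (J y) (J z) n)
      + s * (cayleyFour (fun x y => g x y) e ρ (J (I y)) (J z) (J w)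
        + cayleyFour (fun x y => g x y) e ρ n (J y) (P (J z) (J w))
        + φ (J τ) (J y) (P (J z) (J w))
        + b z * φ (J (I y)) n (J w) + b w * φ (J (I y)) (J z) n) =
      (r₀ - t) * rotatedForm φ J I s (-c) y z w
      + ((-(c * (gV σ (I y) + b y) + s * (-gV σ y + gV σ y - gV (I σ + τ) (I y))) * gV z (I w)
        + -(c * (-gV σ (I z) - b z) + s * gV (I σ + τ) (I z)) * gV y (I w)
        + -(c * (gV σ (I w) + b w) - s * gV (I σ + τ) (I w)) * gV y (I z))
      + (0 * gV z w + s * (gV σ (I z) + gV (I σ + τ) z + b z) * gV y w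
        + s * (-gV σ (I w) - gV (I σ + τ) w - b w) * gV y z)) := fun y z w => by
    rw [hnormal, hcross, hcross, hstar, hstar, rotatedForm_eq]
    simp only [hmid, hlast, h.phi_normal, h.I_sq, map_neg, LinearMap.neg_apply, map_add,
      LinearMap.add_apply, h.I_isom]
    ring
  simp only [hexp]
  rw [SU3Space.inner3_add, SU3Space.inner3_add, hψ.inner3_self,
    hψ.inner3_null hψ.contraction_omega, hψ.inner3_null hψ.contraction_g]
  ring

end IsHyperplane

end Torsion

/-! ### ∇ω and its trace in terms of r(φ) and B -/

section Torsion

variable {W : Type*} [AddCommGroup W] [Module ℝ W] {g : W →ₗ[ℝ] W →ₗ[ℝ] ℝ}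
  {φ : W →ₗ[ℝ] W →ₗ[ℝ] W →ₗ[ℝ] ℝ} {P : W →ₗ[ℝ] W →ₗ[ℝ] W} {e : Fin 7 → W}

theorem phi_contraction (hC : CayleySpace g φ P e) {r : W →ₗ[ℝ] W →ₗ[ℝ] ℝ}
    (hr : ∀ i, ∑ j, ∑ k, (phiT i j k : ℝ) * r (e j) (e k) = 0) (v : W) :
    ∑ j, ∑ k, φ v (e j) (e k) * r (e j) (e k) = 0 := by
  have h1 : ∀ j k, φ v (e j) (e k) * r (e j) (e k) =
      ∑ i, g (e i) v * ((phiT i j k : ℝ) * r (e j) (e k)) := fun j k => by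
    conv_lhs => rw [orthonormal_expand hC.finrank hC.frame.1 v]
    simp only [map_sum, map_smul, LinearMap.sum_apply, LinearMap.smul_apply, phi_frame hC,
      smul_eq_mul, Finset.sum_mul, mul_assoc]
  simp only [h1]
  rw [Finset.sum_congr rfl fun j _ => Finset.sum_comm, Finset.sum_comm]
  simp only [← Finset.mul_sum, hr, mul_zero, Finset.sum_const_zero]

variable {V : Type*} [AddCommGroup V] [Module ℝ V]
  {n : W} {J : V →ₗ[ℝ] W} {gV : V →ₗ[ℝ] V →ₗ[ℝ] ℝ} {I : V →ₗ[ℝ] V}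

/-- The bilinear form `B(x, y) + r(ι_* x, ι_* I y)` that determines `∇ω`. -/
def torsionForm (r : W →ₗ[ℝ] W →ₗ[ℝ] ℝ) (J : V →ₗ[ℝ] W) (I : V →ₗ[ℝ] V)
    (b : V →ₗ[ℝ] V →ₗ[ℝ] ℝ) : V →ₗ[ℝ] V →ₗ[ℝ] ℝ := b + r.compl₁₂ J (J.comp I)

theorem torsionForm_apply (r : W →ₗ[ℝ] W →ₗ[ℝ] ℝ) (J : V →ₗ[ℝ] W) (I : V →ₗ[ℝ] V)
    (b : V →ₗ[ℝ] V →ₗ[ℝ] ℝ) (x y : V) : torsionForm r J I b x y = b x y + r (J x) (J (I y)) := rfl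

/-- The bilinear form `c C(x, y) + s C(x, I y)`. -/
def rotatedBilin (C : V →ₗ[ℝ] V →ₗ[ℝ] ℝ) (I : V →ₗ[ℝ] V) (c s : ℝ) : V →ₗ[ℝ] V →ₗ[ℝ] ℝ :=
  c • C + s • C.compl₁₂ LinearMap.id I

theorem rotatedBilin_apply (C : V →ₗ[ℝ] V →ₗ[ℝ] ℝ) (I : V →ₗ[ℝ] V) (c s : ℝ) (x y : V) :
    rotatedBilin C I c s x y = c * C x y + s * C x (I y) := rfl

namespace IsHyperplane

variable (h : IsHyperplane g φ P e n J gV I)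
include h

/-- With `w` the tangential part of P(y, z), ψ(v, y, z) = ⟨v, (c - sI)w⟩, and evaluating the rotated
form on (c - sI)w gives C(x, w) because c² + s² = 1. The right-hand side does not involve (c, s), in
agreement with the fact that ∇ω does not see θ. -/
theorem ofBilin_rotatedBilin {c s : ℝ} (hcs : c ^ 2 + s ^ 2 = 1) {u : Fin 6 → V}
    (hu : IsOrthonormal (fun x y => gV x y) u) {ρ ν : W} {C : V →ₗ[ℝ] V →ₗ[ℝ] ℝ} {x : V}
    (hν : g n ν = 0) (hC : ∀ w, C x w = -g ν (J w) + g ρ (J (I w))) (y z : V) :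
    SU3Space.ofBilin (rotatedForm φ J I c s) u (rotatedBilin C I c s) x y z =
      -cayleyFour (fun x y => g x y) e ρ n (J y) (J z) - φ ν (J y) (J z) := by
  have hψ := h.su3Space hcs hu
  obtain ⟨w, hw⟩ := h.exists_tangential_cross y z
  have h1 : ∀ v, rotatedForm φ J I c s v y z = gV v (c • w - s • I w) := fun v => by
    rw [rotatedForm_apply, phi_swap₁ h.cayley, phi_swap₂ h.cayley, neg_neg, ← h.cayley.cross, hw,
      map_add, map_smul, LinearMap.add_apply, LinearMap.smul_apply, h.perp, ← h.metric, h.symm]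
    simp [hψ.g_I]
    ring
  have h2 : SU3Space.ofBilin (rotatedForm φ J I c s) u (rotatedBilin C I c s) x y z = C x w := by
    have h3 := hψ.sum_frame' (rotatedBilin C I c s x) (c • w - s • I w)
    simp only [SU3Space.ofBilin, h1]
    rw [Finset.sum_congr rfl fun j _ => mul_comm _ _, h3, rotatedBilin_apply]
    simp only [map_sub, map_smul, h.I_sq, map_neg, smul_eq_mul]
    linear_combination C x w * hcs
  obtain ⟨σ, hσ⟩ := h.exists_split ρ
  have h4 : P ρ n = -J (I σ) := by
    rw [hσ, map_add, map_smul, LinearMap.add_apply, LinearMap.smul_apply, cross_swap h.cayley (J σ),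
      h.map_I]
    have : P n n = 0 := eq_of_metric h.cayley fun z => by
      rw [h.cayley.cross, phi_self₁ h.cayley]
      simp
    rw [this, smul_zero, zero_add]
  have h5 : φ ν (J y) (J z) = g ν (J w) := by
    rw [phi_swap₁ h.cayley, phi_swap₂ h.cayley, neg_neg, ← h.cayley.cross, hw, map_add, map_smul,
      LinearMap.add_apply, LinearMap.smul_apply, hν, smul_zero, add_zero, h.cayley.symm]
  have h6 : g ρ (J (I w)) = -gV (I σ) w := by
    rw [hψ.g_I, neg_neg, hσ, map_add, map_smul, LinearMap.add_apply, LinearMap.smul_apply, h.perp,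
      smul_zero, zero_add, h.metric]
  rw [h2, hC, h5, h6, star_eq h.cayley, h4, hw, h.perp, h.perp, map_neg, LinearMap.neg_apply,
    map_add, map_smul, ← h.metric, h.cayley.symm _ n, h.perp]
  simp
  ring

/-- The contraction identity for the torsion of an almost parallel structure, decomposed along a
hyperplane. -/
theorem split_contraction {u : Fin 6 → V} (hu : IsOrthonormal (fun x y => gV x y) u)
    {r : W →ₗ[ℝ] W →ₗ[ℝ] ℝ} (hskew : ∀ x y, r x y = -r y x)
    (hr : ∀ v, ∑ j, ∑ k, φ v (e j) (e k) * r (e j) (e k) = 0) :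
    ∑ i, r (J (u i)) (J (I (u i))) = 0 ∧
    ∀ x, ∑ i, ∑ j, r (J (u i)) (J (u j)) * rotatedForm φ J I 1 0 x (u i) (u j) =
      -2 * r (J (I x)) n := by
  have hψ := h.su3Space (a := 1) (b := 0) (by norm_num) hu
  -- The contraction may be computed in the orthonormal basis formed by `n` and the frame of the
  -- hyperplane. For v = n it yields the ω-trace of r; for tangent v it relates the contraction of r
  -- with φ to the terms r(·, n).
  set f : Fin 7 → W := Fin.cons n (J ∘ u) with hf
  have hfo : IsOrthonormal (fun x y => g x y) f := fun i j => by
    refine Fin.cases ?_ (fun i => ?_) i <;> refine Fin.cases ?_ (fun j => ?_) j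
    · simp [hf, h.unit]
    · simp [hf, h.perp, (Fin.succ_ne_zero j).symm]
    · simp [hf, h.cayley.symm _ n, h.perp, Fin.succ_ne_zero]
    · have := hu i j
      simp only [hf, Fin.cons_succ, Function.comp_apply, ← h.metric, Fin.succ_inj]
      exact this
  have h1 : ∀ v, ∑ j, φ v n (J (u j)) * r n (J (u j)) + ∑ i, φ v (J (u i)) n * r (J (u i)) n
      + ∑ i, ∑ j, φ v (J (u i)) (J (u j)) * r (J (u i)) (J (u j)) = 0 := fun v => by
    have h2 := inner2_eq h.cayley.finrank h.cayley.frame.1 hfo (φ v) r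
    simp only [inner2, hr, mul_zero] at h2
    have h3 : φ v n n * r n n = 0 := by
      have := hskew n n
      rw [show r n n = 0 by linarith, mul_zero]
    simp only [Fin.sum_univ_succ (n := 6), hf, Fin.cons_zero, Fin.cons_succ, Function.comp_apply,
      Finset.sum_add_distrib, h3] at h2
    linarith
  have hmul : ∀ {ι : Type} [Fintype ι] (a b : ι → ℝ), ∑ i, a i * b i = ∑ i, b i * a i :=
    fun a b => Finset.sum_congr rfl fun i _ => mul_comm _ _
  constructor
  · have h2 := h1 n
    have h3 : ∀ v, φ n n v = 0 := fun v => by rw [phi_self₁ h.cayley]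
    have h4 : ∀ v, φ n v n = 0 := fun v => by rw [phi_swap₂ h.cayley, h3, neg_zero]
    simp only [h3, h4, zero_mul, Finset.sum_const_zero, zero_add, h.phi_normal] at h2
    have h5 : ∀ i, ∑ j, -gV (u i) (I (u j)) * r (J (u i)) (J (u j)) =
        r (J (u i)) (J (I (u i))) := fun i => by
      have := hψ.sum_frame_I ((r (J (u i))).comp J) (u i)
      simp only [LinearMap.comp_apply] at this
      simp only [neg_mul, Finset.sum_neg_distrib, this, neg_neg]
    simpa only [h5] using h2
  · intro x
    have h2 := h1 (J x)
    have h3 : ∀ j, φ (J x) n (J (u j)) * r n (J (u j)) = -(gV x (I (u j)) * r (J (u j)) n) :=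
      fun j => by
        rw [phi_swap₁ h.cayley, h.phi_normal, hskew n]
        ring
    have h4 : ∀ j, φ (J x) (J (u j)) n * r (J (u j)) n = -(gV x (I (u j)) * r (J (u j)) n) :=
      fun j => by
        rw [phi_swap₂ h.cayley, phi_swap₁ h.cayley, h.phi_normal]
        ring
    have h5 := hψ.sum_frame_I ((r.flip n).comp J) x
    simp only [LinearMap.comp_apply, LinearMap.flip_apply] at h5
    simp only [h3, h4, Finset.sum_neg_distrib, h5] at h2
    have h6 : ∀ i j, r (J (u i)) (J (u j)) * rotatedForm φ J I 1 0 x (u i) (u j) =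
        φ (J x) (J (u i)) (J (u j)) * r (J (u i)) (J (u j)) := fun i j => by
      rw [rotatedForm_eq]
      ring
    simp only [h6]
    linarith

/-- The contraction of `∇ω`. -/
theorem contract_torsionForm {u : Fin 6 → V} (hu : IsOrthonormal (fun x y => gV x y) u)
    {r : W →ₗ[ℝ] W →ₗ[ℝ] ℝ} (hskew : ∀ x y, r x y = -r y x)
    (hr : ∀ v, ∑ j, ∑ k, φ v (e j) (e k) * r (e j) (e k) = 0) {b : V →ₗ[ℝ] V →ₗ[ℝ] ℝ}
    (hb : ∀ x y, b x y = b y x) (x : V) :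
    contract u (SU3Space.ofBilin (rotatedForm φ J I 1 0) u (torsionForm r J I b)) x =
      2 * r (J x) n := by
  have hψ := h.su3Space (a := 1) (b := 0) (by norm_num) hu
  have h1 := (h.split_contraction hu hskew hr).2 (I x)
  rw [h.I_sq, map_neg, map_neg, LinearMap.neg_apply] at h1
  -- A symmetric form contracts to zero with the skew ψ, so B does not enter d^*ω.
  have h2 : ∑ i, ∑ j, b (u i) (u j) * rotatedForm φ J I 1 0 x (u i) (u j) = 0 := by
    have h3 : ∑ i, ∑ j, b (u i) (u j) * rotatedForm φ J I 1 0 x (u i) (u j) =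
        -∑ i, ∑ j, b (u i) (u j) * rotatedForm φ J I 1 0 x (u i) (u j) := by
      conv_lhs => rw [Finset.sum_comm]
      simp only [← Finset.sum_neg_distrib]
      refine Finset.sum_congr rfl fun i _ => Finset.sum_congr rfl fun j _ => ?_
      rw [hb, hψ.swap₂]
      ring
    linarith
  have h4 : ∀ i, ∑ j, r (J (u i)) (J (I (u j))) * rotatedForm φ J I 1 0 x (u i) (u j) =
      -∑ j, r (J (u i)) (J (u j)) * rotatedForm φ J I 1 0 (I x) (u i) (u j) := fun i => by
    have h5 := hψ.trace_I
      (((LinearMap.mul ℝ ℝ).compl₁₂ (rotatedForm φ J I 1 0 x (u i)) ((r (J (u i))).comp J)))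
    simp only [LinearMap.compl₁₂_apply, LinearMap.comp_apply, LinearMap.mul_apply'] at h5
    simp only [hψ.move, hψ.move₂]
    rw [Finset.sum_congr rfl fun j _ => mul_comm _ _, h5]
    exact congrArg _ (Finset.sum_congr rfl fun j _ => mul_comm _ _)
  have h6 : contract u (SU3Space.ofBilin (rotatedForm φ J I 1 0) u (torsionForm r J I b)) x =
      -∑ i, ∑ j, (b (u i) (u j) * rotatedForm φ J I 1 0 x (u i) (u j)
        + r (J (u i)) (J (I (u j))) * rotatedForm φ J I 1 0 x (u i) (u j)) := by
    simp only [contract, SU3Space.ofBilin, ← Finset.sum_neg_distrib]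
    refine Finset.sum_congr rfl fun i _ => Finset.sum_congr rfl fun j _ => ?_
    rw [torsionForm_apply, hψ.swap₁ (u j), hψ.swap₂ (u i), hψ.swap₁ (u i)]
    ring
  rw [h6]
  simp only [Finset.sum_add_distrib, h2, h4, Finset.sum_neg_distrib, h1]
  ring

end IsHyperplane

end Torsion

/-- A rotation of the plane is injective. This makes the W₃ and W₄ conditions independent of θ. -/
theorem rotation_eq_zero {c s a a' : ℝ} (hcs : c ^ 2 + s ^ 2 = 1) (h₁ : c * a + s * a' = 0)
    (h₂ : c * a' - s * a = 0) : a = 0 := by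
  linear_combination c * h₁ - s * h₂ - a * hcs

/-! ### The projections of the rotated torsion form -/

namespace SU3Space

variable {V : Type*} [AddCommGroup V] [Module ℝ V]
  {g : V →ₗ[ℝ] V →ₗ[ℝ] ℝ} {I : V →ₗ[ℝ] V} {ψ : V →ₗ[ℝ] V →ₗ[ℝ] V →ₗ[ℝ] ℝ} {u : Fin 6 → V}
  {C b R : V →ₗ[ℝ] V →ₗ[ℝ] ℝ} (h : SU3Space g I ψ u) (hb : ∀ x y, b x y = b y x)
  (hR : ∀ x y, R x y = -R y x) (hC : ∀ x y, C x y = b x y + R x (I y))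
include h hb hR hC

theorem trace_rotatedBilin (htr : ∑ i, R (u i) (I (u i)) = 0) (c s : ℝ) :
    ∑ i, rotatedBilin C I c s (u i) (u i) = c * ∑ i, b (u i) (u i) := by
  have h1 : ∑ i, R (u i) (u i) = 0 := trace_skew hR
  simp only [rotatedBilin_apply, hC, h.sq, map_neg, Finset.sum_add_distrib, ← Finset.mul_sum, htr,
    h.trace_symm_I hb, Finset.sum_neg_distrib, h1]
  ring

theorem trace_rotatedBilin_I (htr : ∑ i, R (u i) (I (u i)) = 0) (c s : ℝ) :
    ∑ i, rotatedBilin C I c s (u i) (I (u i)) = -(s * ∑ i, b (u i) (u i)) := by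
  have h1 : ∑ i, R (u i) (u i) = 0 := trace_skew hR
  simp only [rotatedBilin_apply, hC, h.sq, map_neg, Finset.sum_add_distrib, ← Finset.mul_sum, htr,
    h.trace_symm_I hb, Finset.sum_neg_distrib, h1]
  ring

theorem proj_W1p_iff (htr : ∑ i, R (u i) (I (u i)) = 0) (c s : ℝ) :
    (∀ x y, projBilin g I u (rotatedBilin C I c s) x y .W1p = 0) ↔
      1 / 6 * (∑ i, b (u i) (u i)) * c = 0 := by
  simp only [projBilin, h.trace_rotatedBilin hb hR hC htr]
  constructor
  · intro h1
    have h2 := h1 (u 0) (u 0)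
    rw [h.g_frame, if_pos rfl] at h2
    linarith
  · intro h1 x y
    linear_combination g x y * h1

theorem proj_W1m_iff (htr : ∑ i, R (u i) (I (u i)) = 0) (c s : ℝ) :
    (∀ x y, projBilin g I u (rotatedBilin C I c s) x y .W1m = 0) ↔
      1 / 6 * (∑ i, b (u i) (u i)) * s = 0 := by
  simp only [projBilin, h.trace_rotatedBilin_I hb hR hC htr]
  constructor
  · intro h1
    have h2 := h1 (I (u 0)) (u 0)
    rw [h.isom, h.g_frame, if_pos rfl] at h2
    linarith
  · intro h1 x y
    linear_combination g x (I y) * h1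

/-- The symmetric invariant part of the rotated form carries only the factor `c`: the terms
multiplied by `s` are skew there, since composing with `I` exchanges symmetric and skew invariant
forms. -/
theorem proj_W2p_iff (htr : ∑ i, R (u i) (I (u i)) = 0) (c s : ℝ) :
    (∀ x y, projBilin g I u (rotatedBilin C I c s) x y .W2p = 0) ↔
      ∀ x y, c * (-R (I x) y + R x (I y) + (b x y + b (I x) (I y))) =
        2 * (1 / 6 * ∑ i, b (u i) (u i)) * c * g x y := by
  simp only [projBilin, h.trace_rotatedBilin hb hR hC htr]
  refine forall_congr' fun x => forall_congr' fun y => ?_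
  have h1 : rotatedBilin C I c s x y + rotatedBilin C I c s y x + rotatedBilin C I c s (I x) (I y)
      + rotatedBilin C I c s (I y) (I x) =
      2 * (c * (-R (I x) y + R x (I y) + (b x y + b (I x) (I y)))) := by
    simp only [rotatedBilin_apply, hC, h.sq, map_neg]
    rw [hb y x, hb (I y) (I x), hb y (I x), hb (I y) x, hR y x, hR (I y) (I x), hR y (I x),
      hR (I y) x]
    ring
  rw [h1]
  constructor <;> intro h2 <;> linarith

theorem proj_W2m_iff (htr : ∑ i, R (u i) (I (u i)) = 0) (c s : ℝ) :
    (∀ x y, projBilin g I u (rotatedBilin C I c s) x y .W2m = 0) ↔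
      ∀ x y, s * (-R (I x) y + R x (I y) + (b x y + b (I x) (I y))) =
        2 * (1 / 6 * ∑ i, b (u i) (u i)) * s * g x y := by
  simp only [projBilin, h.trace_rotatedBilin_I hb hR hC htr]
  have h1 : ∀ x y, rotatedBilin C I c s x y - rotatedBilin C I c s y x
      + rotatedBilin C I c s (I x) (I y) - rotatedBilin C I c s (I y) (I x) =
      2 * (s * (-R (I x) (I y) - R x y + (b x (I y) - b (I x) y))) := fun x y => by
    simp only [rotatedBilin_apply, hC, h.sq, map_neg]
    rw [hb y x, hb (I y) (I x), hb y (I x), hb (I y) x, hR y x, hR (I y) (I x), hR y (I x),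
      hR (I y) x]
    ring
  simp only [h1]
  -- The skew invariant condition becomes the symmetric one when `y` is replaced by `I y`, which is
  -- a bijective substitution.
  constructor
  · intro h2 x y
    have h3 := h2 x (I y)
    simp only [h.sq, map_neg] at h3
    linarith
  · intro h2 x y
    have h3 := h2 x (I y)
    simp only [h.sq, map_neg] at h3
    linarith

theorem proj_W3_iff {c s : ℝ} (hcs : c ^ 2 + s ^ 2 = 1) :
    (∀ x y, projBilin g I u (rotatedBilin C I c s) x y .W3 = 0) ↔
      ∀ x y, b (I x) (I y) = b x y := by
  have h1 : ∀ x y, rotatedBilin C I c s x y + rotatedBilin C I c s y x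
      - rotatedBilin C I c s (I x) (I y) - rotatedBilin C I c s (I y) (I x) =
      2 * (c * (b x y - b (I x) (I y)) + s * (b x (I y) + b (I x) y)) := fun x y => by
    simp only [rotatedBilin_apply, hC, h.sq, map_neg]
    rw [hb y x, hb (I y) (I x), hb y (I x), hb (I y) x, hR y x, hR (I y) (I x), hR y (I x),
      hR (I y) x]
    ring
  simp only [projBilin, h1]
  constructor
  · intro h2 x y
    have h3 := h2 x y
    -- The condition at (x, y) and at (x, I y) gives both coordinates of a rotated vector, so each
    -- original coordinate vanishes.
    have h4 := h2 x (I y)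
    simp only [h.sq, map_neg] at h4
    have := rotation_eq_zero (a := b x y - b (I x) (I y)) (a' := b x (I y) + b (I x) y) hcs
      (by linarith) (by linarith)
    linarith
  · intro h2 x y
    have h3 := h2 x (I y)
    simp only [h.sq, map_neg] at h3
    rw [h2]
    linear_combination -s / 2 * h3

theorem proj_W4_iff {c s : ℝ} (hcs : c ^ 2 + s ^ 2 = 1) :
    (∀ x y, projBilin g I u (rotatedBilin C I c s) x y .W4 = 0) ↔
      ∀ x y, R (I x) (I y) = R x y := by
  have h1 : ∀ x y, rotatedBilin C I c s x y - rotatedBilin C I c s y x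
      - rotatedBilin C I c s (I x) (I y) + rotatedBilin C I c s (I y) (I x) =
      2 * (c * (R x (I y) + R (I x) y) + s * (R (I x) (I y) - R x y)) := fun x y => by
    simp only [rotatedBilin_apply, hC, h.sq, map_neg]
    rw [hb y x, hb (I y) (I x), hb y (I x), hb (I y) x, hR y x, hR (I y) (I x), hR y (I x),
      hR (I y) x]
    ring
  simp only [projBilin, h1]
  constructor
  · intro h2 x y
    have h3 := h2 x y
    have h4 := h2 x (I y)
    simp only [h.sq, map_neg] at h4
    have := rotation_eq_zero (a := R (I x) (I y) - R x y) (a' := -(R x (I y) + R (I x) y)) hcs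
      (by linarith) (by linarith)
    linarith
  · intro h2 x y
    have h3 := h2 x (I y)
    simp only [h.sq, map_neg] at h3
    rw [h2]
    linear_combination -c / 2 * h3

omit hb hC in
-- The contraction with ψ kills the I-invariant part of a two-form and determines the anti-invariant
-- part.
theorem invariant_iff_contraction : (∀ x y, R (I x) (I y) = R x y) ↔
    ∀ x, ∑ i, ∑ j, R (u i) (u j) * ψ x (u i) (u j) = 0 := by
  have h1 : ∀ x, ∑ i, ∑ j, R (I (u i)) (I (u j)) * ψ x (u i) (u j) =
      -∑ i, ∑ j, R (u i) (u j) * ψ x (u i) (u j) := fun x => by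
    have h3 : ∀ i, ∑ j, R (I (u i)) (I (u j)) * ψ x (u i) (u j) =
        -∑ j, R (I (u i)) (u j) * ψ x (u i) (I (u j)) := fun i => by
      have := h.trace_I ((LinearMap.mul ℝ ℝ).compl₁₂ (ψ x (u i)) (R (I (u i))))
      simp only [LinearMap.compl₁₂_apply, LinearMap.mul_apply'] at this
      simp only [mul_comm (R _ _)]
      exact this
    have h4 : ∀ j, ∑ i, R (I (u i)) (u j) * ψ x (u i) (I (u j)) =
        -∑ i, R (u i) (u j) * ψ x (I (u i)) (I (u j)) := fun j => by
      have := h.trace_I ((LinearMap.mul ℝ ℝ).compl₁₂ ((ψ x).flip (I (u j))) (R.flip (u j)))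
      simp only [LinearMap.compl₁₂_apply, LinearMap.mul_apply', LinearMap.flip_apply] at this
      simp only [mul_comm (R _ _)]
      exact this
    simp only [h3, Finset.sum_neg_distrib]
    rw [Finset.sum_comm]
    simp only [h4, h.psi_II, Finset.sum_neg_distrib, mul_neg, neg_neg]
    rw [Finset.sum_comm]
  constructor
  · intro h2 x
    have h3 := h1 x
    simp only [h2] at h3
    linarith
  · intro h2 x y
    have h3 := h.twoForm_eq (a := R - R.compl₁₂ I I) (fun x y => by
      simp only [LinearMap.sub_apply, LinearMap.compl₁₂_apply]
      rw [hR x, hR (I x)]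
      ring) (fun x y => by
      simp only [LinearMap.sub_apply, LinearMap.compl₁₂_apply, h.sq, map_neg, LinearMap.neg_apply]
      ring) x y
    simp only [LinearMap.sub_apply, LinearMap.compl₁₂_apply, sub_mul, Finset.sum_sub_distrib, h1,
      h2, neg_zero, sub_zero, mul_zero, zero_mul, Finset.sum_const_zero] at h3
    linarith

end SU3Space

/-! ### Assembly of the torsion of the hypersurface -/

/-- The vector representing the form `r(x, ·)`. -/
def rieszSum {W : Type*} [AddCommGroup W] [Module ℝ W] (e : Fin 7 → W) (a : W →ₗ[ℝ] ℝ) : W :=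
  ∑ l, a (e l) • e l

section Riesz

variable {W : Type*} [AddCommGroup W] [Module ℝ W] {g : W →ₗ[ℝ] W →ₗ[ℝ] ℝ}
  {φ : W →ₗ[ℝ] W →ₗ[ℝ] W →ₗ[ℝ] ℝ} {P : W →ₗ[ℝ] W →ₗ[ℝ] W} {e : Fin 7 → W}

theorem metric_rieszSum (hC : CayleySpace g φ P e) (a : W →ₗ[ℝ] ℝ) (y : W) :
    g (rieszSum e a) y = a y := by
  conv_rhs => rw [orthonormal_expand hC.finrank hC.frame.1 y]
  simp only [rieszSum, map_sum, map_smul, LinearMap.sum_apply, LinearMap.smul_apply, smul_eq_mul]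
  exact Finset.sum_congr rfl fun i _ => mul_comm _ _

theorem star_rieszSum (hC : CayleySpace g φ P e) (a : W →ₗ[ℝ] ℝ) (y z u : W) :
    cayleyFour (fun x y => g x y) e (rieszSum e a) y z u =
      ∑ l, a (e l) * cayleyFour (fun x y => g x y) e (e l) y z u := by
  simp only [star_eq hC, rieszSum, map_sum, map_smul, LinearMap.sum_apply, LinearMap.smul_apply,
    smul_eq_mul, Finset.sum_mul, mul_sub, mul_add, Finset.sum_add_distrib, Finset.sum_sub_distrib,
    mul_neg, Finset.sum_neg_distrib, mul_assoc]

end Riesz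

namespace Hypersurface

variable {N : Type*} [TopologicalSpace N] [ChartedSpace (EuclideanSpace ℝ (Fin 7)) N]
  [IsManifold (𝓡 7) ∞ N] {S : G2Structure N} {M : Type*} [TopologicalSpace M]
  [ChartedSpace (EuclideanSpace ℝ (Fin 6)) M] [IsManifold (𝓡 6) ∞ M] (H : Hypersurface S M)

/-- The last six vectors of a Cayley frame beginning with `n` are tangent to M; their existence
shows that the chosen frame is orthonormal. -/
theorem isOrthonormal_frame (p : M) : IsOrthonormal (fun x y => H.gL p x y) (H.frame p) := by
  obtain ⟨e, hC⟩ := S.exists_cayleySpace (H.incl p)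
  obtain ⟨f, hf, hf0⟩ := exists_adapted_frame hC (H.normal_unit p)
  have hv : ∀ i : Fin 6, ∃ x, H.pushL p x = f i.succ := fun i => H.exists_push p (by
    rw [← hf0]
    exact (hf.frame.1 0 i.succ).trans (if_neg (Fin.succ_ne_zero i).symm))
  choose v hv using hv
  refine G2Structure.orthoFrame_spec (G := H.g p) ⟨v, fun i j => ?_⟩
  change S.gL (H.incl p) (H.pushL p (v i)) (H.pushL p (v j)) = _
  rw [hv, hv]
  refine (hf.frame.1 i.succ j.succ).trans ?_
  simp only [Fin.succ_inj]

/-- The real part of the complex volume form as a field of trilinear maps. -/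
def psiL (p : M) : TangentSpace (𝓡 6) p →ₗ[ℝ] TangentSpace (𝓡 6) p →ₗ[ℝ]
    TangentSpace (𝓡 6) p →ₗ[ℝ] ℝ :=
  rotatedForm (S.phiL (H.incl p)) (H.pushL p) (H.IL p) (Real.cos (H.theta p))
    (Real.sin (H.theta p))

theorem su3Space_psiL (p : M) : SU3Space (H.gL p) (H.IL p) (H.psiL p) (H.frame p) := by
  obtain ⟨e, hC⟩ := S.exists_cayleySpace (H.incl p)
  exact (H.isHyperplane p hC).su3Space (Real.cos_sq_add_sin_sq _) (H.isOrthonormal_frame p)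

/-- The invariants of the second order of a hypersurface in an almost parallel manifold: the second
fundamental form `b`, the torsion `R` of the ambient structure, and the tensor `C` that determines
the torsion of the hypersurface. -/
structure IsTorsionData (p : M) (b R C : TangentSpace (𝓡 6) p →ₗ[ℝ] TangentSpace (𝓡 6) p →ₗ[ℝ] ℝ) :
    Prop where
  b_eq : ∀ x y, b x y = H.B p x y
  R_eq : ∀ x y, R x y = H.pullRbar p x y
  C_eq : ∀ x y, C x y = b x y + R x (H.IL p y)
  b_symm : ∀ x y, b x y = b y x
  R_skew : ∀ x y, R x y = -R y x
  R_trace : ∑ i, R (H.frame p i) (H.IL p (H.frame p i)) = 0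
  R_invariant : (∀ x y, R (H.IL p x) (H.IL p y) = R x y) ↔ ∀ x, H.rbarNormal p x = 0
  nablaOmega_eq : ∀ x y z, H.nablaOmega p x y z = SU3Space.ofBilin (H.psiL p) (H.frame p)
    (rotatedBilin C (H.IL p) (Real.cos (H.theta p)) (Real.sin (H.theta p))) x y z
  coderiv : ∀ x, H.coderivOmega p x = -2 * H.rbarNormal p x
  eta_eq : ∀ x, H.eta p x = (H.dTheta p (H.IL p x) - H.rbarNormal p (H.IL p x)) / 3
  IForm_eta : ∀ x, H.IForm H.eta p x = (H.dTheta p x - H.rbarNormal p x) / 3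

/-- Here the pointwise algebra meets the geometry: ρ is the vector dual to r(ι_* x, ·), so that ∇_x
φ = ρ ⌟ *φ, and ν is the derivative of the normal. -/
theorem exists_torsionData (hS : S.IsTypeX2) (p : M) : ∃ b R C, H.IsTorsionData p b R C := by
  obtain ⟨e, hC⟩ := S.exists_cayleySpace (H.incl p)
  obtain ⟨r, hr, hskew, hre⟩ := S.exists_rbar hS (H.incl p)
  obtain ⟨hnab, hcontr⟩ := hre e hC
  obtain ⟨b, hb⟩ := H.exists_B p
  have hP := H.isHyperplane p hC
  have hu := H.isOrthonormal_frame p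
  have hbs : ∀ x y, b x y = b y x := fun x y => by rw [hb, hb, H.B_symm]
  have hφ := phi_contraction hC hcontr
  have hF := hP.su3Space (a := 1) (b := 0) (by norm_num) hu
  obtain ⟨htr, hsplit⟩ := hP.split_contraction hu hskew hφ
  have hstar : ∀ x y z u, S.nablaPhi (H.incl p) x y z u =
      cayleyFour (fun x y => S.gL (H.incl p) x y) e (rieszSum e (r x)) y z u := fun x y z u => by
    rw [star_rieszSum hC, hnab, S.starPhi_eq hC]
  have hrn : ∀ x, r (H.pushL p x) (H.normal p) = H.rbarNormal p x := fun x => hr _ _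
  -- The pair (c, s) is left free: (cos θ, sin θ) is needed for the modules, and (1, 0) for d^*ω,
  -- where the phase is irrelevant.
  have hnabla : ∀ {c s : ℝ}, c ^ 2 + s ^ 2 = 1 → ∀ x y z, H.nablaOmega p x y z =
      SU3Space.ofBilin (rotatedForm (S.phiL (H.incl p)) (H.pushL p) (H.IL p) c s) (H.frame p)
        (rotatedBilin (torsionForm r (H.pushL p) (H.IL p) b) (H.IL p) c s) x y z :=
    fun hcs x y z => by
      rw [hP.ofBilin_rotatedBilin hcs hu (ρ := rieszSum e (r (H.pushL p x)))
        (H.nablaNormal_normal p x) (fun w => by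
          rw [torsionForm_apply, H.nablaNormal_push, neg_neg, metric_rieszSum hC, hb]),
        nablaOmega_eq, hstar]
  have heta : ∀ x, H.eta p x = (H.dTheta p (H.IL p x) - H.rbarNormal p (H.IL p x)) / 3 := fun x => by
    have h1 := hP.inner3_psiMinus (c := Real.cos (H.theta p)) (s := Real.sin (H.theta p))
      (by rw [neg_sq, Real.sin_sq_add_cos_sq]) hu (ρ := rieszSum e (r (H.pushL p (H.IL p x))))
      (b := H.B p (H.IL p x)) (H.nablaNormal_normal p (H.IL p x)) (H.dTheta p (H.IL p x))
    have h2 : H.psiMinus p = fun y z w => rotatedForm (S.phiL (H.incl p)) (H.pushL p) (H.IL p)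
        (Real.sin (H.theta p)) (-Real.cos (H.theta p)) y z w :=
      funext fun y => funext fun z => funext fun w => H.psiMinus_eq p y z w
    have h3 : H.nablaPsiPlus p (H.IL p x) = _ :=
      funext fun y => funext fun z => funext fun w => H.nablaPsiPlus_eq p (H.IL p x) y z w
    simp only [hstar, ← IL_apply, h2] at h3
    rw [eta, ← IL_apply, h2, h3, h1, hC.symm, metric_rieszSum hC, hrn]
    ring
  refine ⟨b, r.compl₁₂ (H.pushL p) (H.pushL p), torsionForm r (H.pushL p) (H.IL p) b, hb,
    fun x y => hr _ _, fun x y => rfl, hbs, fun x y => hskew _ _, htr, ?_,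
    hnabla (Real.cos_sq_add_sin_sq _), fun x => ?_, heta, fun x => ?_⟩
  · rw [hF.invariant_iff_contraction fun x y => hskew _ _]
    have h1 : ∀ x, ∑ i, ∑ j, r.compl₁₂ (H.pushL p) (H.pushL p) (H.frame p i) (H.frame p j) *
        rotatedForm (S.phiL (H.incl p)) (H.pushL p) (H.IL p) 1 0 x (H.frame p i) (H.frame p j) =
        -2 * H.rbarNormal p (H.IL p x) := fun x => (hsplit x).trans (by rw [hrn])
    simp only [h1]
    constructor
    · intro h2 x
      -- The contraction at -I x yields the value of r(·, n) at x.
      have h3 := h2 (-H.IL p x)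
      rw [map_neg, hP.I_sq, neg_neg] at h3
      linarith
    · intro h2 x
      rw [h2, mul_zero]
  · have h1 := hP.contract_torsionForm hu hskew hφ hbs x
    have h2 : rotatedBilin (torsionForm r (H.pushL p) (H.IL p) b) (H.IL p) 1 0 =
        torsionForm r (H.pushL p) (H.IL p) b :=
      LinearMap.ext₂ fun x y => by rw [rotatedBilin_apply]; ring
    have h3 := hnabla (c := 1) (s := 0) (by norm_num)
    rw [h2] at h3
    unfold coderivOmega
    simp only [h3]
    unfold contract at h1
    rw [h1, hrn]
    ring
  · have h1 : H.dTheta p (-x) = -H.dTheta p x := map_neg _ _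
    have h2 : H.rbarNormal p (-x) = -H.rbarNormal p x := by
      rw [← hrn, ← hrn, map_neg, map_neg, LinearMap.neg_apply]
    rw [IForm, heta, ← IL_apply, hP.I_sq, h1, h2]
    ring

/-- `M` has a given type if and only if the other components of the torsion vanish. -/
theorem hasType_iff {C : Finset TorsionClass} (T : ∀ p, TangentSpace (𝓡 6) p →ₗ[ℝ]
    TangentSpace (𝓡 6) p →ₗ[ℝ] ℝ) (hT : ∀ p, ∃ b R, H.IsTorsionData p b R (T p)) :
    H.HasType C ↔ (∀ c ∉ C, ∀ p x y, projBilin (H.gL p) (H.IL p) (H.frame p)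
      (rotatedBilin (T p) (H.IL p) (Real.cos (H.theta p)) (Real.sin (H.theta p))) x y c = 0) ∧
    (TorsionClass.W5 ∉ C → ∀ p x, H.dTheta p x = H.rbarNormal p x) := by
  have hI : H.I = fun p x => H.IL p x := funext fun p => funext fun x => (H.IL_apply p x).symm
  have hψ : ∀ p, H.psiPlus p = fun x y z => H.psiL p x y z := fun p =>
    funext fun x => funext fun y => funext fun z => H.psiPlus_eq p x y z
  have hg : ∀ p, H.g p = fun x y => H.gL p x y := fun p => rfl
  have key : ∀ p, ((∃ β : TorsionClass → TangentSpace (𝓡 6) p → TangentSpace (𝓡 6) p →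
      TangentSpace (𝓡 6) p → ℝ,
      (∀ c ∈ C, InModule (H.g p) (H.I p) (H.frame p) (H.psiPlus p) c (β c)) ∧
      ∀ x y z, H.nablaOmega p x y z = ∑ c ∈ C, β c x y z) ∧
      (TorsionClass.W5 ∉ C → ∀ x, H.eta p x = 0)) ↔
      (∀ c ∉ C, ∀ x y, projBilin (H.gL p) (H.IL p) (H.frame p)
      (rotatedBilin (T p) (H.IL p) (Real.cos (H.theta p)) (Real.sin (H.theta p))) x y c = 0) ∧
      (TorsionClass.W5 ∉ C → ∀ x, H.dTheta p x = H.rbarNormal p x) := fun p => by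
    obtain ⟨b, R, hD⟩ := hT p
    simp only [hI, hψ, hg, hD.nablaOmega_eq]
    refine and_congr ((H.su3Space_psiL p).exists_decomposition_iff C _)
      (imp_congr_right fun _ => ⟨fun h x => ?_, fun h x => ?_⟩)
    -- As `I` is invertible, η = 0 means Iη = 0, and Iη is a third of dθ - r(·, n).
    · have h1 := hD.IForm_eta x
      rw [IForm, h] at h1
      linarith
    · rw [hD.eta_eq, h, sub_self, zero_div]
  unfold HasType
  simp only [key]
  exact ⟨fun h => ⟨fun c hc p => (h p).1 c hc, fun hc p => (h p).2 hc⟩,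
    fun h p => ⟨fun c hc => h.1 c hc p, fun hc => h.2 hc p⟩⟩

end Hypersurface

/-- Read in a chart, θ has zero derivative on an open set, so its level sets there are open. -/
theorem mvfderiv_eq_zero_iff_isLocallyConstant {k : ℕ} {M : Type*} [TopologicalSpace M]
    [ChartedSpace (EuclideanSpace ℝ (Fin k)) M] [IsManifold (𝓡 k) ∞ M] {θ : M → ℝ}
    (hθ : ∀ p, MDifferentiableAt (𝓡 k) 𝓘(ℝ, ℝ) θ p) :
    (∀ p x, mvfderiv (𝓡 k) θ p x = 0) ↔ IsLocallyConstant θ := by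
  have : IsManifold (𝓡 k) 1 M := IsManifold.of_le (n := ∞) (by simp)
  constructor
  · intro h0
    rw [IsLocallyConstant.iff_eventually_eq]
    intro p
    set e := chartAt (EuclideanSpace ℝ (Fin k)) p
    have hsymm : ∀ y ∈ e.target, MDifferentiableAt (𝓡 k) (𝓡 k) e.symm y := fun y hy =>
      mdifferentiableAt_atlas_symm (chart_mem_atlas _ p) hy
    have hd : ∀ y ∈ e.target, MDifferentiableAt (𝓡 k) 𝓘(ℝ, ℝ) (fun y => θ (e.symm y)) y :=
      fun y hy => (hθ _).comp y (hsymm y hy)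
    have hopen := e.open_target.isOpen_inter_preimage_of_fderiv_eq_zero (𝕜 := ℝ)
      (f := fun y => θ (e.symm y))
      (fun y hy => (hd y hy).differentiableAt.differentiableWithinAt)
      (fun y hy => by
        ext v
        have h1 := mvfderiv_comp_apply y (hθ _) (hsymm y hy) v
        rw [h0] at h1
        have h2 : mvfderiv 𝓘(ℝ, EuclideanSpace ℝ (Fin k)) (fun y => θ (e.symm y)) y =
          fderiv ℝ (fun y => θ (e.symm y)) y := mfderiv_eq_fderiv
        rw [← h2]
        exact h1) {θ p}
    have hp : e p ∈ e.target ∩ (fun y => θ (e.symm y)) ⁻¹' {θ p} :=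
      ⟨e.map_source (mem_chart_source _ p), by simp [e.left_inv (mem_chart_source _ p)]⟩
    have h3 := (e.continuousAt (mem_chart_source _ p)).preimage_mem_nhds (hopen.mem_nhds hp)
    filter_upwards [h3, chart_source_mem_nhds (EuclideanSpace ℝ (Fin k)) p] with q hq hq'
    have h4 : θ (e.symm (e q)) = θ p := hq.2
    rwa [e.left_inv hq'] at h4
  · intro h0 p x
    have h1 : θ =ᶠ[𝓝 p] fun _ => θ p := (IsLocallyConstant.iff_eventually_eq θ).1 h0 p
    have h2 : mvfderiv (𝓡 k) θ p = mvfderiv (𝓡 k) (fun _ : M => θ p) p := h1.mfderiv_eq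
    rw [h2, mvfderiv_const, zero_apply]

end G2SU3
end

/-! ### The theorem -/

open G2SU3
theorem theorem4p7 {N : Type*} [TopologicalSpace N] [ChartedSpace (EuclideanSpace ℝ (Fin 7)) N]
    [IsManifold (𝓡 7) ∞ N] {M : Type*} [TopologicalSpace M]
    [ChartedSpace (EuclideanSpace ℝ (Fin 6)) M] [IsManifold (𝓡 6) ∞ M]
    (S : G2Structure N) (hS : S.IsTypeX2) (H : Hypersurface S M) :
    (∀ p x, H.coderivOmega p x = 6 * H.IForm H.eta p x - 2 * H.dTheta p x) ∧
    (∀ p x, H.coderivOmega p x = -2 * H.rbarNormal p x) ∧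
    (H.HasType {.W1p, .W1m, .W2p, .W2m, .W3, .W4} ↔
      ∀ p x, H.dTheta p x = H.rbarNormal p x) ∧
    (H.HasType {.W1p, .W1m, .W2p, .W2m, .W3, .W5} ↔
      ∀ p x, H.rbarNormal p x = 0) ∧
    (H.HasType {.W1p, .W1m, .W2p, .W2m, .W4, .W5} ↔
      ∀ p x y, H.I12 H.B p x y = H.B p x y) ∧
    (H.HasType {.W1p, .W1m, .W2p, .W3, .W4, .W5} ↔
      ∀ p x y, Real.sin (H.theta p) * (H.I1 H.pullRbar p x y - H.I2 H.pullRbar p x y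
          + (H.B p x y + H.I12 H.B p x y)) =
        2 * H.h p * Real.sin (H.theta p) * H.g p x y) ∧
    (H.HasType {.W1p, .W1m, .W2m, .W3, .W4, .W5} ↔
      ∀ p x y, Real.cos (H.theta p) * (H.I1 H.pullRbar p x y - H.I2 H.pullRbar p x y
          + (H.B p x y + H.I12 H.B p x y)) =
        2 * H.h p * Real.cos (H.theta p) * H.g p x y) ∧
    (H.HasType {.W1p, .W2p, .W2m, .W3, .W4, .W5} ↔
      ∀ p, H.h p * Real.sin (H.theta p) = 0) ∧
    (H.HasType {.W1m, .W2p, .W2m, .W3, .W4, .W5} ↔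
      ∀ p, H.h p * Real.cos (H.theta p) = 0) ∧
    (H.HasType {.W1p, .W1m, .W2p, .W2m, .W3} ↔
      (∀ p x, H.rbarNormal p x = 0) ∧ IsLocallyConstant H.theta) ∧
    (H.HasType {.W1p, .W1m, .W3, .W4, .W5} ↔
      ∀ p x y, H.I1 H.pullRbar p x y - H.I2 H.pullRbar p x y
          + (H.B p x y + H.I12 H.B p x y) = 2 * H.h p * H.g p x y) ∧
    (H.HasType {.W2p, .W2m, .W3, .W4, .W5} ↔ H.IsMinimal) := by
  choose b R T hT using H.exists_torsionData hS
  have hu := H.su3Space_psiL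
  have htype := fun C => H.hasType_iff (C := C) T fun p => ⟨b p, R p, hT p⟩
  have hh : ∀ p, 1 / 6 * ∑ i, b p (H.frame p i) (H.frame p i) = H.h p := fun p => by
    simp only [(hT p).b_eq]
    rfl
  have hD : ∀ p x y, -R p (H.IL p x) y + R p x (H.IL p y)
      + (b p x y + b p (H.IL p x) (H.IL p y)) =
      H.I1 H.pullRbar p x y - H.I2 H.pullRbar p x y + (H.B p x y + H.I12 H.B p x y) :=
    fun p x y => by
      simp only [(hT p).b_eq, (hT p).R_eq, Hypersurface.IL_apply, Hypersurface.I1,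
        Hypersurface.I2, Hypersurface.I12]
      ring
  have hg : ∀ p x y, H.gL p x y = H.g p x y := fun p x y => rfl
  have h1p := fun p => (hu p).proj_W1p_iff (hT p).b_symm (hT p).R_skew (hT p).C_eq (hT p).R_trace
    (Real.cos (H.theta p)) (Real.sin (H.theta p))
  have h1m := fun p => (hu p).proj_W1m_iff (hT p).b_symm (hT p).R_skew (hT p).C_eq (hT p).R_trace
    (Real.cos (H.theta p)) (Real.sin (H.theta p))
  have h2p := fun p => (hu p).proj_W2p_iff (hT p).b_symm (hT p).R_skew (hT p).C_eq (hT p).R_trace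
    (Real.cos (H.theta p)) (Real.sin (H.theta p))
  have h2m := fun p => (hu p).proj_W2m_iff (hT p).b_symm (hT p).R_skew (hT p).C_eq (hT p).R_trace
    (Real.cos (H.theta p)) (Real.sin (H.theta p))
  have h3 := fun p => (hu p).proj_W3_iff (hT p).b_symm (hT p).R_skew (hT p).C_eq
    (Real.cos_sq_add_sin_sq (H.theta p))
  have h4 := fun p => ((hu p).proj_W4_iff (hT p).b_symm (hT p).R_skew (hT p).C_eq
    (Real.cos_sq_add_sin_sq (H.theta p))).trans (hT p).R_invariant
  simp only [hh, hD, hg] at h1p h1m h2p h2m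
  -- The condition over all classes outside a given set becomes a conjunction of seven; only the
  -- missing classes then leave a condition.
  have hall : ∀ Q : TorsionClass → Prop, (∀ c, Q c) ↔
      Q .W1p ∧ Q .W1m ∧ Q .W2p ∧ Q .W2m ∧ Q .W3 ∧ Q .W4 ∧ Q .W5 := fun Q =>
    ⟨fun h => ⟨h _, h _, h _, h _, h _, h _, h _⟩,
      fun ⟨h1, h2, h3, h4, h5, h6, h7⟩ c => by cases c <;> assumption⟩
  refine ⟨fun p x => ?_, fun p x => (hT p).coderiv x, ?_, ?_, ?_, ?_, ?_, ?_, ?_, ?_, ?_, ?_⟩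
  · rw [(hT p).coderiv, (hT p).IForm_eta]
    ring
  all_goals
    rw [htype, hall]
    simp only [Finset.mem_insert, Finset.mem_singleton, reduceCtorEq, or_false, or_true,
      not_true_eq_false, not_false_eq_true, false_imp_iff, true_imp_iff, true_and,
      and_true, h1p, h1m, h2p, h2m, h3, h4]
  -- The projection of ∇ω to W₅ is zero by definition, so the equation for dθ is all that remains.
  · exact and_iff_right fun p x y => rfl
  · refine forall_congr' fun p => forall_congr' fun x => forall_congr' fun y => ?_
    rw [(hT p).b_eq, (hT p).b_eq, Hypersurface.IL_apply, Hypersurface.IL_apply]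
    rfl
  · have hθ := mvfderiv_eq_zero_iff_isLocallyConstant fun p =>
      (H.smooth_theta p).mdifferentiableAt (by simp)
    rw [← hθ]
    constructor
    · rintro ⟨⟨h5, -⟩, h6⟩
      exact ⟨h5, fun p x => (h6 p x).trans (h5 p x)⟩
    · rintro ⟨h5, h6⟩
      exact ⟨⟨h5, fun p x y => rfl⟩, fun p x => (h6 p x).trans (h5 p x).symm⟩
  · constructor
    · rintro ⟨h5, h6⟩ p x y
      -- The equations carrying the factors cos θ and sin θ are multiplied by the same factors and
      -- added; cos² θ + sin² θ = 1 removes the phase.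
      linear_combination Real.cos (H.theta p) * h5 p x y + Real.sin (H.theta p) * h6 p x y
        + (2 * H.h p * H.g p x y - (H.I1 H.pullRbar p x y - H.I2 H.pullRbar p x y
          + (H.B p x y + H.I12 H.B p x y))) * Real.cos_sq_add_sin_sq (H.theta p)
    · intro h5
      exact ⟨fun p x y => by rw [h5]; ring, fun p x y => by rw [h5]; ring⟩
  · constructor
    · rintro ⟨h5, h6⟩ p
      linear_combination Real.cos (H.theta p) * h5 p + Real.sin (H.theta p) * h6 p
        - H.h p * Real.cos_sq_add_sin_sq (H.theta p)
    · intro h5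
      exact ⟨fun p => by rw [h5, zero_mul], fun p => by rw [h5, zero_mul]⟩
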